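/- Let $n\geqslant 1$, $s\geqslant 0$, and let $c_0,\nu_0,\alpha_p,D_{\mathrm{Th}}>0$, $\gamma>1$, $\beta>1/3$ be constants. Consider the thermoviscous acoustic system on $\mathbb{R}^n$, $$\phi_{tt}-c_0^2\Delta\phi-(1+\beta)\nu_0\Delta\phi_t+\alpha_pc_0^2T_t=0,\qquad T_t-\gamma D_{\mathrm{Th}}\Delta T+\frac{\gamma-1}{\alpha_p}\Delta\phi=0\qquad(t>0),$$ with data $\phi(0)=\phi_0$, $\phi_t(0)=\phi_1$, $T(0)=T_0$, its energy term $\Phi:=(\phi_t+i\sqrt\gamma c_0|D|\phi,\ \phi_t-i\sqrt\gamma c_0|D|\phi,\ T)^{\mathrm T}$, where $|D|$ has symbol $|\xi|$, and the value $\Phi_0:=(\phi_1+i\sqrt\gamma c_0|D|\phi_0,\ \phi_1-i\sqrt\gamma c_0|D|\phi_0,\ T_0)^{\mathrm T}$ of the energy term at $t=0$. Put $\Gamma_0:=\frac12[(1+\beta)\nu_0+(\gamma-1)D_{\mathrm{Th}}]$, $P_{\Phi_0}:=\int_{\mathbb{R}^n}\Phi_0(x)\,dx\in\mathbb{C}^3$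 and $$U_1:=\begin{pmatrix}0&0&-\frac{2\gamma\alpha_pc_0^2}{\gamma-1}\\0&-\frac{2\gamma\alpha_pc_0^2}{\gamma-1}&0\\1&1&1\end{pmatrix}.$$ There are constants $c,C>0$ depending only on $n$, $s$ and the constants of the system such that, for all data with $\Phi_0\in H^s$, the following holds. (1) The Cauchy problem has a unique solution (in the sense of tempered distributions) with $\Phi\in\mathcal C([0,\infty),H^s)$; moreover $\Phi(0)=\Phi_0$ and $\|\Phi(t)\|_{H^s}\leqslant C\|\Phi_0\|_{H^s}$ for all $t\geqslant0$. (2) If in addition $\Phi_0\in L^1$, then $$\|\Phi(t)\|_{\dot H^s}\leqslant C\,t^{-\frac{n+2s}{4}}\big(\|\Phi_0\|_{H^s}+\|\Phi_0\|_{L^1}\big)\quad\text{for all } t\geqslant 1,$$ and, if $P_{\Phi_0}\neq0$, there is $t_0\geqslant1$, which may depend on the data, with $$c\,t^{-\frac{n+2s}{4}}|P_{\Phi_0}|\leqslant\|\Phi(t)\|_{\dot H^s}\quad\text{for all } t\geqslant t_0;$$ in particular $\|\Phi(t)\|_{\dot H^s}\simeq t^{-\frac{n+2s}{4}}$ as $t\to\infty$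 when $P_{\Phi_0}\neq0$. (3) If $\Phi_0\in H^s\cap L^1$, then $$\|\Phi(t)-U_1\Psi(t)\|_{\dot H^s}\leqslant C(1+t)^{-\frac{n+2s}{4}-\frac12}\big(\|\Phi_0\|_{H^s}+\|\Phi_0\|_{L^1}\big)\quad\text{for all } t\geqslant0,$$ where $\Psi\in\mathcal C([0,\infty),H^s)$ is the unique solution of $$\Psi_t+\mathrm{diag}(0,i\sqrt\gamma c_0,-i\sqrt\gamma c_0)|D|\Psi-\mathrm{diag}(D_{\mathrm{Th}},\Gamma_0,\Gamma_0)\Delta\Psi=0,\qquad\Psi(0)=U_1^{-1}\Phi_0.$$ -/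

import Mathlib

open MeasureTheory Filter Topology Set
open scoped FourierTransform SchwartzMap Laplacian LineDeriv

noncomputable section

/-- The physical constants: isothermal speed of sound `c0`, viscosity ratio `β` (of the form
`η^b/η^s + 1/3` with `η^b, η^s > 0`), momentum diffusion `ν0`, thermal expansion coefficient `αp`,
ratio of specific heats `γ > 1` and thermal diffusion `Dth`. -/
structure AcousticParams where
  c0 : ℝ
  β : ℝ
  ν0 : ℝ
  αp : ℝ
  γ : ℝ
  Dth : ℝ
  c0_pos : 0 < c0
  β_gt : 1 / 3 < β
  ν0_pos : 0 < ν0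
  αp_pos : 0 < αp
  γ_gt : 1 < γ
  Dth_pos : 0 < Dth

/-- The wave speed `√γ c₀`. -/
def AcousticParams.speed (p : AcousticParams) : ℝ := Real.sqrt p.γ * p.c0

/-- The diffusion constant `Γ₀ = ((1 + β) ν₀ + (γ - 1) D_th) / 2`. -/
def AcousticParams.Γ0 (p : AcousticParams) : ℝ :=
  ((1 + p.β) * p.ν0 + (p.γ - 1) * p.Dth) / 2

/-- The entry `-2 γ α_p c₀² / (γ - 1)` of the matrix `U₁`. -/
def AcousticParams.κ (p : AcousticParams) : ℝ :=
  -(2 * p.γ * p.αp * p.c0 ^ 2 / (p.γ - 1))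

/-- The constant matrix `U₁`. -/
def AcousticParams.U1 (p : AcousticParams) : Matrix (Fin 3) (Fin 3) ℂ :=
  !![0, 0, (p.κ : ℂ); 0, (p.κ : ℂ), 0; 1, 1, 1]

/-- Euclidean space `ℝⁿ`. -/
abbrev Rn (n : ℕ) : Type := EuclideanSpace ℝ (Fin n)

/-- Complex `L²(ℝⁿ)`. -/
abbrev L2 (n : ℕ) : Type := Lp ℂ 2 (volume : Measure (Rn n))

/-- Tempered distributions on `ℝⁿ`. -/
abbrev TD (n : ℕ) : Type := 𝓢'(Rn n, ℂ)

/-- The pairing `⟨m(D) f, η⟩` for `f ∈ L²`, where `m(D)` is the pseudo-differential operator with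
symbol `m` with respect to `D = -i∇`. As `𝓕` has the kernel `exp(-2πi x·ξ)`, the symbol is evaluated
at `2πξ`; the pairing is bilinear, `∫ (𝓕⁻ h) η = ∫ h (𝓕⁻ η)`. It is used only for measurable `m` of
at most polynomial growth. -/
def symbolPairing {n : ℕ} (m : Rn n → ℂ) (f : L2 n) (η : 𝓢(Rn n, ℂ)) : ℂ :=
  ∫ ξ : Rn n, m ((2 * Real.pi) • ξ) * (𝓕 f : L2 n) ξ * (𝓕⁻ η : 𝓢(Rn n, ℂ)) ξ

/-- `|D| u = g ∈ L²` for a tempered distribution `u` with square integrable gradient, expressed as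
`∇u = ∇|D|⁻¹ g`; the operator `m·∇|D|⁻¹` has the bounded symbol `i (m·ξ)/|ξ|`.
(The product `|ξ| û` is not defined for an arbitrary tempered distribution, since `|ξ|` is not
smooth at the origin.) -/
def IsAbsD {n : ℕ} (u : TD n) (g : L2 n) : Prop :=
  ∀ (m : Rn n) (η : 𝓢(Rn n, ℂ)),
    (∂_{m} u) η = symbolPairing (fun ξ => Complex.I * ((inner ℝ m ξ / ‖ξ‖ : ℝ) : ℂ)) g η

/-- `Φ = (φ_t + i√γ c₀|D|φ, φ_t - i√γ c₀|D|φ, T)`, with `φ_t`, `|D|φ` and `T` in `L²`. -/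
def IsEnergyTerm {n : ℕ} (p : AcousticParams) (φ φt T : TD n) (Φ : Fin 3 → L2 n) : Prop :=
  ∃ v g θ : L2 n, φt = (v : TD n) ∧ IsAbsD φ g ∧ T = (θ : TD n) ∧
    Φ = ![v + (Complex.I * (p.speed : ℂ)) • g, v - (Complex.I * (p.speed : ℂ)) • g, θ]

/-- The `H^s` norm `‖⟨D⟩^s f‖_{L²}` of a vector of elements of `H^s`. -/
def sobolevNorm {n k : ℕ} (s : ℝ) (f : Fin k → L2 n) : ℝ :=
  Real.sqrt (∑ i, ∫ ξ : Rn n, (1 + (2 * Real.pi * ‖ξ‖) ^ 2) ^ s * ‖(𝓕 (f i) : L2 n) ξ‖ ^ 2)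

/-- The `Ḣ^s` norm `‖|D|^s f‖_{L²}` of a vector of elements of `H^s`, `s ≥ 0`. -/
def homSobolevNorm {n k : ℕ} (s : ℝ) (f : Fin k → L2 n) : ℝ :=
  Real.sqrt (∑ i, ∫ ξ : Rn n, (2 * Real.pi * ‖ξ‖) ^ (2 * s) * ‖(𝓕 (f i) : L2 n) ξ‖ ^ 2)

/-- The `L¹` norm of a vector of integrable functions. -/
def lOneNorm {n k : ℕ} (f : Fin k → L2 n) : ℝ := ∑ i, ∫ x, ‖f i x‖

/-- The vector `P_f = ∫ f` for an integrable vector-valued `f`. -/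
def meanVec {n k : ℕ} (f : Fin k → L2 n) : EuclideanSpace ℂ (Fin k) :=
  WithLp.toLp 2 (fun i => ∫ x, f i x)

/-- All components of `f` belong to `H^s`. -/
def InSobolev {n k : ℕ} (s : ℝ) (f : Fin k → L2 n) : Prop :=
  ∀ i, TemperedDistribution.MemSobolev s 2 (f i : TD n)

/-- `F ∈ C([0,∞), H^s)`. -/
def ContinuousInSobolev {n k : ℕ} (s : ℝ) (F : ℝ → Fin k → L2 n) : Prop :=
  (∀ t, 0 ≤ t → InSobolev s (F t)) ∧
  ∀ t, 0 ≤ t → Tendsto (fun τ => sobolevNorm s (F τ - F t)) (𝓝[Ici 0] t) (𝓝 0)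

/-- `w` is the time derivative at `t`, relative to the set of times `S`, of the path `u` of
tempered distributions (in the topology of `𝓢'`, that is, tested with Schwartz functions). -/
def HasTimeDeriv {n : ℕ} (u : ℝ → TD n) (w : TD n) (S : Set ℝ) (t : ℝ) : Prop :=
  ∀ η : 𝓢(Rn n, ℂ), HasDerivWithinAt (fun τ => u τ η) (w η) S t

/-- `(φ, T)`, with `φt = ∂ₜφ`, is a Sobolev solution in the energy sense of the thermoviscous
acoustic system with data `(φ0, φ1, T0)`, and its energy term `Φ` is in `C([0,∞), H^s)`. -/
structure IsEnergySolution {n : ℕ} (p : AcousticParams) (s : ℝ) (φ0 φ1 T0 : TD n)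
    (φ φt T : ℝ → TD n) (Φ : ℝ → Fin 3 → L2 n) : Prop where
  init_phi : φ 0 = φ0
  init_phit : φt 0 = φ1
  init_T : T 0 = T0
  deriv_phi : ∀ t, 0 ≤ t → HasTimeDeriv φ (φt t) (Ici 0) t
  equations : ∃ φtt Tt : ℝ → TD n, ∀ t, 0 < t →
    HasTimeDeriv φt (φtt t) (Ici 0) t ∧ HasTimeDeriv T (Tt t) (Ici 0) t ∧
    φtt t - (p.c0 ^ 2) • Δ (φ t) - ((1 + p.β) * p.ν0) • Δ (φt t) + (p.αp * p.c0 ^ 2) • Tt t = 0 ∧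
    Tt t - (p.γ * p.Dth) • Δ (T t) + ((p.γ - 1) / p.αp) • Δ (φ t) = 0
  energy : ∀ t, 0 ≤ t → IsEnergyTerm p (φ t) (φt t) (T t) (Φ t)
  cont : ContinuousInSobolev s Φ

/-- A constant matrix applied to a vector of functions. -/
def matAct {n : ℕ} (U : Matrix (Fin 3) (Fin 3) ℂ) (f : Fin 3 → L2 n) : Fin 3 → L2 n :=
  fun i => ∑ j, U i j • f j

/-- The coefficients `diag(0, i√γ c₀, -i√γ c₀)` of `|D|` in the reference system. -/
def AcousticParams.waveCoeff (p : AcousticParams) : Fin 3 → ℂ :=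
  ![0, Complex.I * (p.speed : ℂ), -(Complex.I * (p.speed : ℂ))]

/-- The coefficients `diag(D_th, Γ₀, Γ₀)` of `Δ` in the reference system. -/
def AcousticParams.diffCoeff (p : AcousticParams) : Fin 3 → ℂ :=
  ![(p.Dth : ℂ), (p.Γ0 : ℂ), (p.Γ0 : ℂ)]

/-- `Ψ ∈ C([0,∞), H^s)` solves, in the sense of tempered distributions,
`Ψ_t + diag(0, i√γ c₀, -i√γ c₀)|D|Ψ - diag(D_th, Γ₀, Γ₀)ΔΨ = 0`, `Ψ(0) = Ψ0`. -/
structure IsReferenceSolution {n : ℕ} (p : AcousticParams) (s : ℝ) (Ψ0 : Fin 3 → L2 n)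
    (Ψ : ℝ → Fin 3 → L2 n) : Prop where
  init : Ψ 0 = Ψ0
  equation : ∀ t, 0 < t → ∀ (j : Fin 3) (η : 𝓢(Rn n, ℂ)),
    HasDerivAt (fun τ => (Ψ τ j : TD n) η)
      (-(p.waveCoeff j * symbolPairing (fun ξ => (‖ξ‖ : ℂ)) (Ψ t j) η)
        + p.diffCoeff j * (Δ (Ψ t j : TD n)) η) t
  cont : ContinuousInSobolev s Ψ

end

/-! The Fourier transform turns the system for the energy term into a family of linear ODEs `x' = (r
B₁ + r² B₂) x` in `ℂ³`, one for each frequency `r = 2π‖ξ‖`. Everything therefore reduces to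
estimates for the matrix exponentials that are uniform in `r`, to the integration of these estimates
over frequency, and to a translation between the distributional formulation and the ODEs.

For the ODE, use the velocity `v = φ_t`, the potential `h = √γ c₀|D|φ` and the entropy `y = T + ε
φ_t`, where `ε` is chosen so that the first-order terms cancel in the equation for `y`. There
remains a wave pair `(v, h)` in which only `v` is damped, coupled at order `r²` to the diffusing
`y`. The Lyapunov functional `|v|² + |h|² + μ|y|² + 2ε' (r/(1+r²)) Re(v h̄)` transfers dissipation
from `v` to `h`. It gives decay like `exp(-c t r²/(1+r²))` at every frequency
(`DampedWave.exists_decay`, `AcousticParams.exists_propagator_decay`), hence also the `H^s` bound.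

For the profile, the reference system shares the damping of `v` equally between `v` and `h` and
decouples `y`. An explicit corrector of size `r` makes the reference profile solve the full system
up to a residual of size `r³`. The same Lyapunov functional, applied to the difference, gives an
error `r exp(-c r² t)` for `r ≤ 1` (`exists_forced_decay`, `exists_low_frequency_profile`). Above `r
= 1` both flows decay exponentially in time. The additional factor `min r 1` is the gain `t^(-1/2)`
of part (3).

Decay rates come from splitting at `r = 1`. Low frequencies use `|F̂| ≤ ‖F‖_{L¹}` and the scaling `ξ
↦ √t ξ` of a Gaussian; high frequencies use the `H^s` norm and exponential decay
(`exists_homSobolevNorm_decay`). For the lower bound, `F̂` is continuous with `F̂(0) = P ≠ 0`, so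
the profile is of size at least `|P|` up to a constant on the ball `r ≤ t^(-1/2)`; the error of the
profile is of lower order (`exists_homSobolevNorm_lower`, `exists_energy_lower`).

For uniqueness, the difference `w` of two solutions satisfies `ŵ(t) = P(ξ) ∫₀ᵗ ŵ` with a symbol `P`
of order two. On each ball of frequencies `P` is bounded, so Gronwall's inequality forces `w = 0`
(`eq_zero_of_integrated`). -/

/-! ### Pairings with Schwartz functions on the Fourier side, and the relation `|D|u = g`. -/

/-- The Fourier transform of a vector of `L²` functions, as a vector-valued function. -/
noncomputable def hat {n k : ℕ} (F : Fin k → L2 n) (ξ : Rn n) : Fin k → ℂ :=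
  fun i => (𝓕 (F i) : L2 n) ξ

theorem toTD_apply_fourier {n : ℕ} (f : L2 n) (η : 𝓢(Rn n, ℂ)) :
    (f : TD n) η = ∫ ξ, (𝓕 f : L2 n) ξ * (𝓕⁻ η : 𝓢(Rn n, ℂ)) ξ := by
  have h : (f : TD n) = 𝓕⁻ (Lp.toTemperedDistribution (𝓕 f : L2 n)) := by
    rw [Lp.fourierInv_toTemperedDistribution_eq, FourierTransform.fourierInv_fourier_eq]
  rw [h, TemperedDistribution.fourierInv_apply, Lp.toTemperedDistribution_apply]
  simp only [smul_eq_mul, mul_comm]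

theorem toTD_injective {n : ℕ} : Function.Injective (fun f : L2 n => (f : TD n)) := by
  have := Lp.ker_toTemperedDistributionCLM_eq_bot (F := ℂ) (E := Rn n) (μ := volume) (p := 2)
  exact LinearMap.ker_eq_bot.mp this

theorem toTD_add {n : ℕ} (f g : L2 n) : ((f + g : L2 n) : TD n) = f + g :=
  map_add (Lp.toTemperedDistributionCLM ℂ volume 2) f g

theorem toTD_sub {n : ℕ} (f g : L2 n) : ((f - g : L2 n) : TD n) = f - g :=
  map_sub (Lp.toTemperedDistributionCLM ℂ volume 2) f g

theorem toTD_smul {n : ℕ} (c : ℂ) (f : L2 n) : ((c • f : L2 n) : TD n) = c • (f : TD n) :=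
  map_smul (Lp.toTemperedDistributionCLM ℂ volume 2) c f

theorem memLp_weight_schwartz {n : ℕ} (ψ : 𝓢(Rn n, ℂ)) :
    MemLp (fun ξ : Rn n => ((1 + ‖ξ‖ ^ 2 : ℝ) : ℂ) * ψ ξ) 2 volume := by
  have hg : (fun ξ : Rn n => ((1 + ‖ξ‖ ^ 2 : ℝ) : ℂ)).HasTemperateGrowth := by
    have h : (fun ξ : Rn n => ((1 + ‖ξ‖ ^ 2 : ℝ))).HasTemperateGrowth := by fun_prop
    exact Function.HasTemperateGrowth.comp Function.Complex.hasTemperateGrowth_ofReal h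
  have := (SchwartzMap.smulLeftCLM ℂ (fun ξ : Rn n => ((1 + ‖ξ‖ ^ 2 : ℝ) : ℂ)) ψ).memLp 2 volume
  refine this.congr_norm (by fun_prop) (Eventually.of_forall fun ξ => ?_)
  rw [SchwartzMap.smulLeftCLM_apply_apply hg]
  simp

/-- The weight `1 + ‖ξ‖²` is moved onto the Schwartz function, which leaves a product of two `L²`
functions. Quadratic growth is enough because every symbol of both systems has order at most two. -/
theorem integrable_mul_schwartz {n : ℕ} {f u : Rn n → ℂ} {C : ℝ}
    (hf : AEStronglyMeasurable f volume) (hu : MemLp u 2 volume)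
    (h : ∀ᵐ ξ, ‖f ξ‖ ≤ C * (1 + ‖ξ‖ ^ 2) * ‖u ξ‖) (ψ : 𝓢(Rn n, ℂ)) :
    Integrable (fun ξ => f ξ * ψ ξ) volume := by
  have h1 : Integrable (fun ξ => u ξ * (((1 + ‖ξ‖ ^ 2 : ℝ) : ℂ) * ψ ξ)) volume :=
    hu.integrable_mul (memLp_weight_schwartz ψ)
  refine (h1.norm.const_mul C).mono' (hf.mul ψ.continuous.aestronglyMeasurable) ?_
  filter_upwards [h] with ξ hξ
  have h2 : ‖((1 + ‖ξ‖ ^ 2 : ℝ) : ℂ)‖ = 1 + ‖ξ‖ ^ 2 := by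
    rw [Complex.norm_real, Real.norm_of_nonneg (by positivity)]
  rw [norm_mul, norm_mul, norm_mul, h2]
  calc _ ≤ C * (1 + ‖ξ‖ ^ 2) * ‖u ξ‖ * ‖ψ ξ‖ := by gcongr
    _ = _ := by ring

theorem locallyIntegrable_of_le {n : ℕ} {f u : Rn n → ℂ} {C : ℝ}
    (hf : AEStronglyMeasurable f volume) (hu : MemLp u 2 volume)
    (h : ∀ᵐ ξ, ‖f ξ‖ ≤ C * (1 + ‖ξ‖ ^ 2) * ‖u ξ‖) : LocallyIntegrable f volume := by
  have h1 : LocallyIntegrable (fun ξ => (C * (1 + ‖ξ‖ ^ 2)) * ‖u ξ‖) volume := by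
    have h2 : LocallyIntegrable (fun ξ => ‖u ξ‖) volume :=
      fun x => ((hu.locallyIntegrable (by norm_num)) x).norm
    have hc : Continuous (fun ξ : Rn n => C * (1 + ‖ξ‖ ^ 2)) := by fun_prop
    rw [← locallyIntegrableOn_univ] at h2 ⊢
    exact h2.continuousOn_mul hc.continuousOn isOpen_univ.isLocallyClosed
  refine h1.mono hf ?_
  filter_upwards [h] with ξ hξ
  exact hξ.trans (le_abs_self _)

/-- Two locally integrable functions with the same pairings with Schwartz functions coincide. -/
theorem ae_eq_of_pairing {n : ℕ} {f g : Rn n → ℂ} (hf : LocallyIntegrable f volume)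
    (hg : LocallyIntegrable g volume)
    (h : ∀ η : 𝓢(Rn n, ℂ), ∫ ξ, f ξ * (𝓕⁻ η : 𝓢(Rn n, ℂ)) ξ = ∫ ξ, g ξ * (𝓕⁻ η : 𝓢(Rn n, ℂ)) ξ) :
    f =ᵐ[volume] g := by
  refine ae_eq_of_integral_contDiff_smul_eq hf hg fun φ hφ hc => ?_
  have hc' : HasCompactSupport (Complex.ofRealCLM ∘ φ) := hc.comp_left rfl
  have hφ' : ContDiff ℝ ((⊤ : ℕ∞) : WithTop ℕ∞) (Complex.ofRealCLM ∘ φ) := by fun_prop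
  -- A smooth compactly supported function is the inverse transform of its own Fourier transform, so
  -- the hypothesis reaches all test functions.
  have := h (𝓕 (hc'.toSchwartzMap hφ'))
  rw [FourierTransform.fourierInv_fourier_eq] at this
  simpa [mul_comm] using this

theorem fourierInv_lineDeriv_apply {n : ℕ} (m : Rn n) (η : 𝓢(Rn n, ℂ)) (ξ : Rn n) :
    (𝓕⁻ (∂_{m} η) : 𝓢(Rn n, ℂ)) ξ
      = -(2 * Real.pi * Complex.I) * ((inner ℝ ξ m : ℝ) : ℂ) * (𝓕⁻ η : 𝓢(Rn n, ℂ)) ξ := by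
  have : (inner ℝ · m : Rn n → ℝ).HasTemperateGrowth := by fun_prop
  rw [SchwartzMap.fourierInv_lineDerivOp_eq, smul_apply,
    SchwartzMap.smulLeftCLM_apply_apply this]
  simp only [smul_eq_mul, Complex.real_smul]
  ring

theorem fourierInv_laplacian_apply {n : ℕ} (η : 𝓢(Rn n, ℂ)) (ξ : Rn n) :
    (𝓕⁻ (Δ η) : 𝓢(Rn n, ℂ)) ξ
      = -(((2 * Real.pi * ‖ξ‖) ^ 2 : ℝ) : ℂ) * (𝓕⁻ η : 𝓢(Rn n, ℂ)) ξ := by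
  have h := SchwartzMap.laplacian_eq_sum (EuclideanSpace.basisFun (Fin n) ℝ) η
  have h2 : (𝓕⁻ (Δ η) : 𝓢(Rn n, ℂ)) = ∑ i, 𝓕⁻ (∂_{EuclideanSpace.basisFun (Fin n) ℝ i}
      (∂_{EuclideanSpace.basisFun (Fin n) ℝ i} η)) := by
    rw [h]
    exact map_sum (FourierTransform.fourierInvCLM ℂ 𝓢(Rn n, ℂ)) _ _
  rw [h2, sum_apply]
  simp only [fourierInv_lineDeriv_apply]
  rw [EuclideanSpace.norm_eq]
  have h3 : ∀ i, (inner ℝ ξ (EuclideanSpace.basisFun (Fin n) ℝ i) : ℝ) = ξ i := by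
    intro i; simp [EuclideanSpace.inner_single_right]
  simp only [h3]
  rw [mul_pow, Real.sq_sqrt (by positivity)]
  push_cast
  rw [Finset.mul_sum, ← Finset.sum_neg_distrib, Finset.sum_mul]
  refine Finset.sum_congr rfl fun i _ => ?_
  have : ((‖ξ i‖ : ℝ) : ℂ) ^ 2 = (ξ i : ℂ) ^ 2 := by
    rw [← Complex.ofReal_pow, Real.norm_eq_abs, sq_abs, Complex.ofReal_pow]
  rw [this]
  linear_combination (4 * (Real.pi : ℂ) ^ 2 * (ξ i : ℂ) ^ 2 * (𝓕⁻ η : 𝓢(Rn n, ℂ)) ξ) * Complex.I_sq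

theorem laplacian_toTD_apply {n : ℕ} (f : L2 n) (η : 𝓢(Rn n, ℂ)) :
    (Δ (f : TD n)) η
      = ∫ ξ, -(((2 * Real.pi * ‖ξ‖) ^ 2 : ℝ) : ℂ) * (𝓕 f : L2 n) ξ * (𝓕⁻ η : 𝓢(Rn n, ℂ)) ξ := by
  rw [TemperedDistribution.laplacian_apply_apply, toTD_apply_fourier]
  refine integral_congr_ae (Eventually.of_forall fun ξ => ?_)
  simp only [fourierInv_laplacian_apply]
  ring

theorem norm_two_pi_smul {n : ℕ} (ξ : Rn n) : ‖(2 * Real.pi) • ξ‖ = 2 * Real.pi * ‖ξ‖ := by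
  rw [norm_smul, Real.norm_of_nonneg (by positivity)]

theorem inner_div_norm_two_pi {n : ℕ} (m ξ : Rn n) :
    inner ℝ m ((2 * Real.pi) • ξ) / ‖(2 * Real.pi) • ξ‖ = inner ℝ m ξ / ‖ξ‖ := by
  rw [norm_two_pi_smul, inner_smul_right, mul_div_mul_left _ _ (by positivity)]

theorem symbolPairing_riesz {n : ℕ} (m : Rn n) (g : L2 n) (η : 𝓢(Rn n, ℂ)) :
    symbolPairing (fun ξ => Complex.I * ((inner ℝ m ξ / ‖ξ‖ : ℝ) : ℂ)) g η
      = ∫ ξ, Complex.I * ((inner ℝ m ξ / ‖ξ‖ : ℝ) : ℂ) * (𝓕 g : L2 n) ξ *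
        (𝓕⁻ η : 𝓢(Rn n, ℂ)) ξ := by
  simp only [symbolPairing, inner_div_norm_two_pi]

theorem symbolPairing_norm {n : ℕ} (g : L2 n) (η : 𝓢(Rn n, ℂ)) :
    symbolPairing (fun ξ => (‖ξ‖ : ℂ)) g η
      = ∫ ξ, ((2 * Real.pi * ‖ξ‖ : ℝ) : ℂ) * (𝓕 g : L2 n) ξ * (𝓕⁻ η : 𝓢(Rn n, ℂ)) ξ := by
  simp only [symbolPairing, norm_two_pi_smul]

theorem abs_inner_div_norm_le {n : ℕ} (m ξ : Rn n) : |inner ℝ m ξ / ‖ξ‖| ≤ ‖m‖ := by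
  rcases eq_or_ne ξ 0 with rfl | h
  · simp
  rw [abs_div, abs_norm, div_le_iff₀ (norm_pos_iff.mpr h)]
  exact abs_real_inner_le_norm m ξ

theorem aestronglyMeasurable_fourier {n : ℕ} (f : L2 n) :
    AEStronglyMeasurable (fun ξ => (𝓕 f : L2 n) ξ) volume := Lp.aestronglyMeasurable _

theorem memLp_fourier {n : ℕ} (f : L2 n) : MemLp (fun ξ => (𝓕 f : L2 n) ξ) 2 volume := Lp.memLp _

theorem measurable_riesz {n : ℕ} (m : Rn n) :
    Measurable (fun ξ : Rn n => Complex.I * ((inner ℝ m ξ / ‖ξ‖ : ℝ) : ℂ)) := by fun_prop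

theorem integrable_riesz_pairing {n : ℕ} (m : Rn n) (g : L2 n) (ψ : 𝓢(Rn n, ℂ)) :
    Integrable (fun ξ => Complex.I * ((inner ℝ m ξ / ‖ξ‖ : ℝ) : ℂ) * (𝓕 g : L2 n) ξ * ψ ξ)
      volume := by
  refine integrable_mul_schwartz (u := fun ξ => (𝓕 g : L2 n) ξ) (C := ‖m‖)
    ((measurable_riesz m).aestronglyMeasurable.mul (aestronglyMeasurable_fourier g))
    (memLp_fourier g) (Eventually.of_forall fun ξ => ?_) ψ
  simp only [Pi.mul_apply]
  rw [norm_mul, norm_mul, Complex.norm_I, one_mul, Complex.norm_real, Real.norm_eq_abs]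
  gcongr
  exact (abs_inner_div_norm_le m ξ).trans
    (le_mul_of_one_le_right (norm_nonneg _) (by nlinarith [sq_nonneg ‖ξ‖]))

theorem fourier_add_ae {n : ℕ} (f g : L2 n) :
    ∀ᵐ ξ, (𝓕 (f + g) : L2 n) ξ = (𝓕 f : L2 n) ξ + (𝓕 g : L2 n) ξ := by
  rw [FourierTransform.fourier_add]; exact Lp.coeFn_add _ _

theorem fourier_sub_ae {n : ℕ} (f g : L2 n) :
    ∀ᵐ ξ, (𝓕 (f - g) : L2 n) ξ = (𝓕 f : L2 n) ξ - (𝓕 g : L2 n) ξ := by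
  have : (𝓕 (f - g) : L2 n) = 𝓕 f - 𝓕 g := map_sub (Lp.fourierTransformₗᵢ (Rn n) ℂ) f g
  rw [this]; exact Lp.coeFn_sub _ _

theorem fourier_smul_ae {n : ℕ} (c : ℂ) (f : L2 n) :
    ∀ᵐ ξ, (𝓕 (c • f) : L2 n) ξ = c * (𝓕 f : L2 n) ξ := by
  rw [FourierTransform.fourier_smul]; exact Lp.coeFn_smul _ _

theorem IsAbsD.add {n : ℕ} {u v : TD n} {g h : L2 n} (hu : IsAbsD u g) (hv : IsAbsD v h) :
    IsAbsD (u + v) (g + h) := by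
  intro m η
  rw [LineDeriv.lineDerivOp_add]
  change (∂_{m} u) η + (∂_{m} v) η = _
  rw [hu m η, hv m η, symbolPairing_riesz, symbolPairing_riesz, symbolPairing_riesz,
    ← integral_add (integrable_riesz_pairing m g _) (integrable_riesz_pairing m h _)]
  refine integral_congr_ae ?_
  filter_upwards [fourier_add_ae g h] with ξ hξ
  rw [hξ]; ring

/-- If `ĝ = |ξ| v̂` then `|D| v = g`. -/
theorem isAbsD_of_fourier {n : ℕ} {v g : L2 n}
    (h : ∀ᵐ ξ, (𝓕 g : L2 n) ξ = ((2 * Real.pi * ‖ξ‖ : ℝ) : ℂ) * (𝓕 v : L2 n) ξ) :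
    IsAbsD (v : TD n) g := by
  intro m η
  rw [symbolPairing_riesz, TemperedDistribution.lineDerivOp_apply_apply, map_neg,
    toTD_apply_fourier, ← integral_neg]
  refine integral_congr_ae ?_
  filter_upwards [h] with ξ hξ
  rw [hξ, fourierInv_lineDeriv_apply, real_inner_comm]
  rcases eq_or_ne ξ 0 with rfl | h0
  · simp
  have : ((‖ξ‖ : ℝ) : ℂ) ≠ 0 := by exact_mod_cast norm_ne_zero_iff.mpr h0
  push_cast
  field_simp

/-- `Δ u = -|D| (|D| u)`. -/
theorem IsAbsD.laplacian_apply {n : ℕ} {u : TD n} {g : L2 n} (hu : IsAbsD u g) (η : 𝓢(Rn n, ℂ)) :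
    (Δ u) η = ∫ ξ, -((2 * Real.pi * ‖ξ‖ : ℝ) : ℂ) * (𝓕 g : L2 n) ξ *
      (𝓕⁻ η : 𝓢(Rn n, ℂ)) ξ := by
  have h := TemperedDistribution.laplacian_eq_sum (EuclideanSpace.basisFun (Fin n) ℝ) u
  have h2 : (Δ u) η = ∑ i, (∂_{EuclideanSpace.basisFun (Fin n) ℝ i}
      (∂_{EuclideanSpace.basisFun (Fin n) ℝ i} u)) η := by
    rw [h]
    exact sum_apply _ _ _
  rw [h2]
  simp only [TemperedDistribution.lineDerivOp_apply_apply (∂_{_} u)]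
  simp only [hu _ _, symbolPairing_riesz]
  rw [← integral_finsetSum _ (fun i _ => integrable_riesz_pairing _ g _)]
  refine integral_congr_ae (Eventually.of_forall fun ξ => ?_)
  have h4 : ∀ i, (𝓕⁻ (-∂_{EuclideanSpace.basisFun (Fin n) ℝ i} η) : 𝓢(Rn n, ℂ)) ξ
      = (2 * Real.pi * Complex.I) * ((ξ i : ℝ) : ℂ) * (𝓕⁻ η : 𝓢(Rn n, ℂ)) ξ := by
    intro i
    have : (𝓕⁻ (-∂_{EuclideanSpace.basisFun (Fin n) ℝ i} η) : 𝓢(Rn n, ℂ))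
        = -𝓕⁻ (∂_{EuclideanSpace.basisFun (Fin n) ℝ i} η) := FourierTransform.fourierInv_neg _
    rw [this, neg_apply, fourierInv_lineDeriv_apply]
    simp [EuclideanSpace.inner_single_right]
  simp only [h4]
  have h3 : ∀ i, (inner ℝ (EuclideanSpace.basisFun (Fin n) ℝ i) ξ : ℝ) = ξ i := by
    intro i; simp [EuclideanSpace.inner_single_left]
  simp only [h3]
  rcases eq_or_ne ξ 0 with rfl | h0
  · simp
  have hn : ((‖ξ‖ : ℝ) : ℂ) ≠ 0 := by exact_mod_cast norm_ne_zero_iff.mpr h0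
  have hs : (∑ i, ((ξ i : ℝ) : ℂ) ^ 2) = ((‖ξ‖ : ℝ) : ℂ) ^ 2 := by
    rw [EuclideanSpace.norm_eq, ← Complex.ofReal_pow, Real.sq_sqrt (by positivity)]
    push_cast
    refine Finset.sum_congr rfl fun i _ => ?_
    rw [← Complex.ofReal_pow ‖ξ i‖, Real.norm_eq_abs, sq_abs, Complex.ofReal_pow]
  have : ∀ i, Complex.I * ((ξ i / ‖ξ‖ : ℝ) : ℂ) * (𝓕 g : L2 n) ξ *
      ((2 * Real.pi * Complex.I) * ((ξ i : ℝ) : ℂ) * (𝓕⁻ η : 𝓢(Rn n, ℂ)) ξ)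
      = ((ξ i : ℝ) : ℂ) ^ 2 *
        (-(2 * Real.pi) / ((‖ξ‖ : ℝ) : ℂ) * (𝓕 g : L2 n) ξ * (𝓕⁻ η : 𝓢(Rn n, ℂ)) ξ) := by
    intro i
    push_cast
    field_simp
    rw [Complex.I_sq]; ring
  simp only [this]
  rw [← Finset.sum_mul, hs]
  push_cast
  field_simp

/-! ### Sobolev norms as weighted `L²` norms of Fourier transforms. -/

theorem one_le_weight {n : ℕ} {s : ℝ} (hs : 0 ≤ s) (ξ : Rn n) :
    1 ≤ (1 + (2 * Real.pi * ‖ξ‖) ^ 2) ^ s :=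
  Real.one_le_rpow (by nlinarith [sq_nonneg (2 * Real.pi * ‖ξ‖)]) hs

theorem continuous_weight {n : ℕ} {s : ℝ} :
    Continuous (fun ξ : Rn n => (1 + (2 * Real.pi * ‖ξ‖) ^ 2) ^ s) :=
  Continuous.rpow_const (by fun_prop) (fun ξ => Or.inl (by positivity))

/-- `MemSobolev` weights by `(1 + ‖ξ‖²)^(s/2)`, without the factor `2π`. The two weights are
comparable because `1 ≤ 2π`. Pairings identify the distributional product with the pointwise one. -/
theorem memSobolev_iff_integrable {n : ℕ} {s : ℝ} (hs : 0 ≤ s) (f : L2 n) :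
    TemperedDistribution.MemSobolev s 2 (f : TD n) ↔
      Integrable (fun ξ : Rn n => (1 + (2 * Real.pi * ‖ξ‖) ^ 2) ^ s * ‖(𝓕 f : L2 n) ξ‖ ^ 2)
        volume := by
  have hw : (fun ξ : Rn n => (((1 + ‖ξ‖ ^ 2) ^ (s / 2) : ℝ) : ℂ)).HasTemperateGrowth := by
    have h := Function.hasTemperateGrowth_one_add_norm_sq_rpow (Rn n) (s / 2)
    exact Function.HasTemperateGrowth.comp Function.Complex.hasTemperateGrowth_ofReal h
  have hcont : Continuous (fun ξ : Rn n => (((1 + ‖ξ‖ ^ 2) ^ (s / 2) : ℝ) : ℂ)) :=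
    hw.1.continuous
  have hm : AEStronglyMeasurable
      (fun ξ : Rn n => (((1 + ‖ξ‖ ^ 2) ^ (s / 2) : ℝ) : ℂ) * (𝓕 f : L2 n) ξ) volume :=
    hcont.aestronglyMeasurable.mul (aestronglyMeasurable_fourier f)
  have hsq : ∀ ξ : Rn n, ‖(((1 + ‖ξ‖ ^ 2) ^ (s / 2) : ℝ) : ℂ) * (𝓕 f : L2 n) ξ‖ ^ 2
      = (1 + ‖ξ‖ ^ 2) ^ s * ‖(𝓕 f : L2 n) ξ‖ ^ 2 := by
    intro ξ
    rw [norm_mul, mul_pow, Complex.norm_real, Real.norm_of_nonneg (by positivity),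
      ← Real.rpow_mul_natCast (by positivity)]
    norm_num
  rw [TemperedDistribution.memSobolev_iff_exists_smulLeftCLM_fourier,
    Lp.fourier_toTemperedDistribution_eq]
  have key : (∃ f' : L2 n, TemperedDistribution.smulLeftCLM ℂ
        (fun x : Rn n => (((1 + ‖x‖ ^ 2) ^ (s / 2) : ℝ) : ℂ))
        ((𝓕 f : L2 n) : TD n) = (f' : TD n)) ↔
      MemLp (fun ξ : Rn n => (((1 + ‖ξ‖ ^ 2) ^ (s / 2) : ℝ) : ℂ) * (𝓕 f : L2 n) ξ) 2 volume := by
    constructor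
    · rintro ⟨f', hf'⟩
      refine (memLp_congr_ae ?_).mp (Lp.memLp f')
      have hloc : LocallyIntegrable (fun ξ : Rn n => (((1 + ‖ξ‖ ^ 2) ^ (s / 2) : ℝ) : ℂ) *
          (𝓕 f : L2 n) ξ) volume := by
        have h2 := (memLp_fourier f).locallyIntegrable (by norm_num)
        rw [← locallyIntegrableOn_univ] at h2 ⊢
        exact h2.continuousOn_mul hcont.continuousOn isOpen_univ.isLocallyClosed
      refine ae_eq_of_pairing ((Lp.memLp f').locallyIntegrable (by norm_num)) hloc fun η => ?_
      have h3 := congrArg (fun u : TD n => u (𝓕⁻ η)) hf'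
      simp only [TemperedDistribution.smulLeftCLM_apply_apply,
        Lp.toTemperedDistribution_apply] at h3
      rw [show (∫ ξ, f' ξ * (𝓕⁻ η : 𝓢(Rn n, ℂ)) ξ) = ∫ ξ, (𝓕⁻ η : 𝓢(Rn n, ℂ)) ξ • f' ξ by
        simp only [smul_eq_mul, mul_comm], ← h3]
      refine integral_congr_ae (Eventually.of_forall fun ξ => ?_)
      simp only [SchwartzMap.smulLeftCLM_apply_apply hw, smul_eq_mul]
      ring
    · intro h
      refine ⟨h.toLp, ?_⟩
      ext η
      simp only [TemperedDistribution.smulLeftCLM_apply_apply,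
        Lp.toTemperedDistribution_apply]
      refine integral_congr_ae ?_
      filter_upwards [h.coeFn_toLp] with ξ hξ
      simp only [SchwartzMap.smulLeftCLM_apply_apply hw, smul_eq_mul, hξ]
      ring
  rw [key, memLp_two_iff_integrable_sq_norm hm]
  simp only [hsq]
  have hm2 : AEStronglyMeasurable (fun ξ : Rn n => (1 + ‖ξ‖ ^ 2) ^ s * ‖(𝓕 f : L2 n) ξ‖ ^ 2)
      volume := by
    have hc : Continuous (fun ξ : Rn n => (1 + ‖ξ‖ ^ 2) ^ s) :=
      Continuous.rpow_const (by fun_prop) (fun ξ => Or.inl (by positivity))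
    exact hc.aestronglyMeasurable.mul ((aestronglyMeasurable_fourier f).norm.pow 2)
  have hm3 : AEStronglyMeasurable (fun ξ : Rn n => (1 + (2 * Real.pi * ‖ξ‖) ^ 2) ^ s *
      ‖(𝓕 f : L2 n) ξ‖ ^ 2) volume :=
    continuous_weight.aestronglyMeasurable.mul ((aestronglyMeasurable_fourier f).norm.pow 2)
  have hpi : 1 ≤ 2 * Real.pi := by nlinarith [Real.pi_gt_three]
  constructor
  · intro h
    refine (h.const_mul (((2 * Real.pi) ^ 2) ^ s)).mono' hm3 (Eventually.of_forall fun ξ => ?_)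
    rw [Real.norm_of_nonneg (by positivity), ← mul_assoc, ← Real.mul_rpow (by positivity)
      (by positivity)]
    gcongr
    rw [mul_pow]
    nlinarith
  · intro h
    refine h.mono' hm2 (Eventually.of_forall fun ξ => ?_)
    rw [Real.norm_of_nonneg (by positivity)]
    gcongr
    exact le_mul_of_one_le_left (norm_nonneg _) hpi

theorem aestronglyMeasurable_hat {n k : ℕ} (F : Fin k → L2 n) :
    AEStronglyMeasurable (hat F) volume :=
  (aemeasurable_pi_iff.mpr fun i =>
    (aestronglyMeasurable_fourier (F i)).aemeasurable).aestronglyMeasurable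

/-- `Fin k → ℂ` carries the supremum norm while the Sobolev norms sum over the components. This
bound and the next one pass between them at the cost of a factor `k`, the origin of the factors `3`
below. -/
theorem sq_norm_le_sum {k : ℕ} (x : Fin k → ℂ) : ‖x‖ ^ 2 ≤ ∑ i, ‖x i‖ ^ 2 := by
  have h : ‖x‖ ≤ Real.sqrt (∑ i, ‖x i‖ ^ 2) := by
    refine (pi_norm_le_iff_of_nonneg (Real.sqrt_nonneg _)).mpr fun i => ?_
    refine Real.le_sqrt_of_sq_le ?_
    exact Finset.single_le_sum (f := fun i => ‖x i‖ ^ 2) (fun i _ => sq_nonneg _) (Finset.mem_univ i)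
  calc ‖x‖ ^ 2 ≤ (Real.sqrt (∑ i, ‖x i‖ ^ 2)) ^ 2 := by gcongr
    _ = _ := Real.sq_sqrt (Finset.sum_nonneg fun i _ => sq_nonneg _)

theorem sum_sq_norm_le {k : ℕ} (x : Fin k → ℂ) : ∑ i, ‖x i‖ ^ 2 ≤ k * ‖x‖ ^ 2 := by
  calc ∑ i, ‖x i‖ ^ 2 ≤ ∑ _i : Fin k, ‖x‖ ^ 2 :=
        Finset.sum_le_sum fun i _ => by gcongr; exact norm_le_pi_norm x i
    _ = _ := by simp

theorem memLp_hat {n k : ℕ} (F : Fin k → L2 n) : MemLp (hat F) 2 volume := by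
  rw [memLp_two_iff_integrable_sq_norm (aestronglyMeasurable_hat F)]
  have h : Integrable (fun ξ => ∑ i, ‖(𝓕 (F i) : L2 n) ξ‖ ^ 2) volume :=
    integrable_finsetSum _ fun i _ =>
      (memLp_two_iff_integrable_sq_norm (aestronglyMeasurable_fourier _)).mp (memLp_fourier (F i))
  refine h.mono' ((aestronglyMeasurable_hat F).norm.pow 2) (Eventually.of_forall fun ξ => ?_)
  rw [Real.norm_of_nonneg (by positivity)]
  exact sq_norm_le_sum _

theorem aestronglyMeasurable_weight_hat {n k : ℕ} (s : ℝ) (F : Fin k → L2 n) :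
    AEStronglyMeasurable (fun ξ => (1 + (2 * Real.pi * ‖ξ‖) ^ 2) ^ s * ‖hat F ξ‖ ^ 2) volume :=
  continuous_weight.aestronglyMeasurable.mul ((aestronglyMeasurable_hat F).norm.pow 2)

theorem inSobolev_iff {n k : ℕ} {s : ℝ} (hs : 0 ≤ s) (F : Fin k → L2 n) :
    InSobolev s F ↔
      Integrable (fun ξ => (1 + (2 * Real.pi * ‖ξ‖) ^ 2) ^ s * ‖hat F ξ‖ ^ 2) volume := by
  simp only [InSobolev, memSobolev_iff_integrable hs]
  constructor
  · intro h
    refine (integrable_finsetSum Finset.univ fun i _ => h i).mono'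
      (aestronglyMeasurable_weight_hat s F) (Eventually.of_forall fun ξ => ?_)
    rw [Real.norm_of_nonneg (by positivity), ← Finset.mul_sum]
    gcongr
    exact sq_norm_le_sum _
  · intro h i
    refine h.mono' (continuous_weight.aestronglyMeasurable.mul
      ((aestronglyMeasurable_fourier (F i)).norm.pow 2)) (Eventually.of_forall fun ξ => ?_)
    rw [Real.norm_of_nonneg (by positivity)]
    gcongr
    exact norm_le_pi_norm (hat F ξ) i

theorem sobolevNorm_nonneg {n k : ℕ} (s : ℝ) (F : Fin k → L2 n) : 0 ≤ sobolevNorm s F :=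
  Real.sqrt_nonneg _

theorem sobolevNorm_sq {n k : ℕ} (s : ℝ) (F : Fin k → L2 n) :
    sobolevNorm s F ^ 2 =
      ∑ i, ∫ ξ : Rn n, (1 + (2 * Real.pi * ‖ξ‖) ^ 2) ^ s * ‖(𝓕 (F i) : L2 n) ξ‖ ^ 2 := by
  rw [sobolevNorm, Real.sq_sqrt]
  exact Finset.sum_nonneg fun i _ => integral_nonneg fun ξ => by positivity

theorem homSobolevNorm_sq {n k : ℕ} (s : ℝ) (F : Fin k → L2 n) :
    homSobolevNorm s F ^ 2 =
      ∑ i, ∫ ξ : Rn n, (2 * Real.pi * ‖ξ‖) ^ (2 * s) * ‖(𝓕 (F i) : L2 n) ξ‖ ^ 2 := by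
  rw [homSobolevNorm, Real.sq_sqrt]
  exact Finset.sum_nonneg fun i _ => integral_nonneg fun ξ => by positivity

theorem integral_weight_le_sobolevNorm_sq {n k : ℕ} {s : ℝ} (hs : 0 ≤ s) {F : Fin k → L2 n}
    (hF : InSobolev s F) :
    ∫ ξ, (1 + (2 * Real.pi * ‖ξ‖) ^ 2) ^ s * ‖hat F ξ‖ ^ 2 ≤ sobolevNorm s F ^ 2 := by
  have hi := fun i => (memSobolev_iff_integrable hs (F i)).mp (hF i)
  rw [sobolevNorm_sq, ← integral_finsetSum _ fun i _ => hi i]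
  refine integral_mono ((inSobolev_iff hs F).mp hF) (integrable_finsetSum _ fun i _ => hi i)
    fun ξ => ?_
  simp only [← Finset.mul_sum]
  gcongr
  exact sq_norm_le_sum _

theorem sobolevNorm_sq_le {n k : ℕ} {s : ℝ} (hs : 0 ≤ s) {F : Fin k → L2 n}
    (hF : InSobolev s F) :
    sobolevNorm s F ^ 2 ≤ k * ∫ ξ, (1 + (2 * Real.pi * ‖ξ‖) ^ 2) ^ s * ‖hat F ξ‖ ^ 2 := by
  have hi := fun i => (memSobolev_iff_integrable hs (F i)).mp (hF i)
  rw [sobolevNorm_sq, ← integral_finsetSum _ fun i _ => hi i, ← integral_const_mul]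
  refine integral_mono (integrable_finsetSum _ fun i _ => hi i)
    (((inSobolev_iff hs F).mp hF).const_mul _) fun ξ => ?_
  simp only [← Finset.mul_sum]
  rw [mul_left_comm]
  gcongr
  exact sum_sq_norm_le _

theorem rpow_two_mul_le_weight {n : ℕ} {s : ℝ} (hs : 0 ≤ s) (ξ : Rn n) :
    (2 * Real.pi * ‖ξ‖) ^ (2 * s) ≤ (1 + (2 * Real.pi * ‖ξ‖) ^ 2) ^ s := by
  rw [Real.rpow_mul (by positivity), Real.rpow_two]
  gcongr
  linarith

theorem continuous_hom_weight {n : ℕ} {s : ℝ} (hs : 0 ≤ s) :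
    Continuous (fun ξ : Rn n => (2 * Real.pi * ‖ξ‖) ^ (2 * s)) :=
  Continuous.rpow_const (by fun_prop) (fun ξ => Or.inr (by positivity))

theorem integrable_hom_weight {n k : ℕ} {s : ℝ} (hs : 0 ≤ s) {F : Fin k → L2 n}
    (hF : InSobolev s F) :
    Integrable (fun ξ => (2 * Real.pi * ‖ξ‖) ^ (2 * s) * ‖hat F ξ‖ ^ 2) volume := by
  refine ((inSobolev_iff hs F).mp hF).mono' ((continuous_hom_weight hs).aestronglyMeasurable.mul
    ((aestronglyMeasurable_hat F).norm.pow 2)) (Eventually.of_forall fun ξ => ?_)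
  rw [Real.norm_of_nonneg (by positivity)]
  gcongr
  exact rpow_two_mul_le_weight hs ξ

theorem integrable_hom_weight_comp {n k : ℕ} {s : ℝ} (hs : 0 ≤ s) {F : Fin k → L2 n}
    (hF : InSobolev s F) (i : Fin k) :
    Integrable (fun ξ => (2 * Real.pi * ‖ξ‖) ^ (2 * s) * ‖(𝓕 (F i) : L2 n) ξ‖ ^ 2) volume := by
  refine (integrable_hom_weight hs hF).mono' ((continuous_hom_weight hs).aestronglyMeasurable.mul
    ((aestronglyMeasurable_fourier (F i)).norm.pow 2)) (Eventually.of_forall fun ξ => ?_)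
  rw [Real.norm_of_nonneg (by positivity)]
  gcongr
  exact norm_le_pi_norm (hat F ξ) i

theorem homSobolevNorm_sq_le {n k : ℕ} {s : ℝ} (hs : 0 ≤ s) {F : Fin k → L2 n}
    (hF : InSobolev s F) :
    homSobolevNorm s F ^ 2 ≤ k * ∫ ξ, (2 * Real.pi * ‖ξ‖) ^ (2 * s) * ‖hat F ξ‖ ^ 2 := by
  have hi := fun i => integrable_hom_weight_comp hs hF i
  rw [homSobolevNorm_sq, ← integral_finsetSum _ fun i _ => hi i, ← integral_const_mul]
  refine integral_mono (integrable_finsetSum _ fun i _ => hi i)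
    ((integrable_hom_weight hs hF).const_mul _) fun ξ => ?_
  simp only [← Finset.mul_sum]
  rw [mul_left_comm]
  gcongr
  exact sum_sq_norm_le _

theorem integral_hom_weight_le {n k : ℕ} {s : ℝ} (hs : 0 ≤ s) {F : Fin k → L2 n}
    (hF : InSobolev s F) :
    ∫ ξ, (2 * Real.pi * ‖ξ‖) ^ (2 * s) * ‖hat F ξ‖ ^ 2 ≤ homSobolevNorm s F ^ 2 := by
  have hi := fun i => integrable_hom_weight_comp hs hF i
  rw [homSobolevNorm_sq, ← integral_finsetSum _ fun i _ => hi i]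
  refine integral_mono (integrable_hom_weight hs hF) (integrable_finsetSum _ fun i _ => hi i)
    fun ξ => ?_
  simp only [← Finset.mul_sum]
  gcongr
  exact sq_norm_le_sum _

theorem hat_sub_ae {n k : ℕ} (F G : Fin k → L2 n) : ∀ᵐ ξ, hat (F - G) ξ = hat F ξ - hat G ξ := by
  filter_upwards [ae_all_iff.mpr fun i => fourier_sub_ae (F i) (G i)] with ξ hξ
  ext i
  exact hξ i

theorem fourier_sum_ae {n k : ℕ} (F : Fin k → L2 n) :
    ∀ᵐ ξ, (𝓕 (∑ j, F j) : L2 n) ξ = ∑ j, (𝓕 (F j) : L2 n) ξ := by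
  have : (𝓕 (∑ j, F j) : L2 n) = ∑ j, 𝓕 (F j) := map_sum (Lp.fourierTransformₗᵢ (Rn n) ℂ) F _
  rw [this]
  filter_upwards [Lp.coeFn_finsetSum Finset.univ (fun j => (𝓕 (F j) : L2 n))] with ξ hξ
  simpa using hξ

theorem hat_matAct_ae {n : ℕ} (U : Matrix (Fin 3) (Fin 3) ℂ) (F : Fin 3 → L2 n) :
    ∀ᵐ ξ, hat (matAct U F) ξ = U.mulVec (hat F ξ) := by
  filter_upwards [ae_all_iff.mpr fun i => fourier_sum_ae (fun j => U i j • F j),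
    ae_all_iff.mpr fun i => ae_all_iff.mpr fun j => fourier_smul_ae (U i j) (F j)] with ξ h1 h2
  ext i
  simp only [hat, matAct, Matrix.mulVec, dotProduct]
  rw [h1 i]
  exact Finset.sum_congr rfl fun j _ => h2 i j

theorem eq_of_hat_ae_eq {n k : ℕ} {F G : Fin k → L2 n} (h : ∀ᵐ ξ, hat F ξ = hat G ξ) : F = G := by
  ext1 i
  apply (Lp.fourierTransformₗᵢ (Rn n) ℂ).injective
  refine Lp.ext ?_
  filter_upwards [h] with ξ hξ
  exact congrFun hξ i

/-! ### Matrix-valued Fourier multipliers. -/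

open Classical in
/-- The Fourier multiplier with a matrix-valued symbol, applied to a vector of `L²` functions. -/
noncomputable def applySymbol {n : ℕ} (K : Rn n → (Fin 3 → ℂ) →L[ℂ] (Fin 3 → ℂ))
    (F : Fin 3 → L2 n) : Fin 3 → L2 n := fun i =>
  if h : MemLp (fun ξ => K ξ (hat F ξ) i) 2 volume then 𝓕⁻ h.toLp else 0

theorem aestronglyMeasurable_clm_apply {n : ℕ} {K : Rn n → (Fin 3 → ℂ) →L[ℂ] (Fin 3 → ℂ)}
    (hK : Continuous K) {f : Rn n → Fin 3 → ℂ} (hf : AEStronglyMeasurable f volume) :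
    AEStronglyMeasurable (fun ξ => K ξ (f ξ)) volume :=
  isBoundedBilinearMap_apply.continuous.comp_aestronglyMeasurable
    (hK.aestronglyMeasurable.prodMk hf)

theorem hat_applySymbol_ae {n : ℕ} {K : Rn n → (Fin 3 → ℂ) →L[ℂ] (Fin 3 → ℂ)} {C : ℝ}
    (hK : Continuous K) (hC : ∀ ξ, ‖K ξ‖ ≤ C) (F : Fin 3 → L2 n) :
    ∀ᵐ ξ, hat (applySymbol K F) ξ = K ξ (hat F ξ) := by
  have hM : ∀ i, MemLp (fun ξ => K ξ (hat F ξ) i) 2 volume := by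
    intro i
    have hm := aestronglyMeasurable_clm_apply hK (aestronglyMeasurable_hat F)
    refine MemLp.of_le_mul (memLp_hat F)
      ((continuous_apply i).comp_aestronglyMeasurable hm) (c := C)
      (Eventually.of_forall fun ξ => ?_)
    calc _ ≤ ‖K ξ (hat F ξ)‖ := norm_le_pi_norm (K ξ (hat F ξ)) i
      _ ≤ ‖K ξ‖ * ‖hat F ξ‖ := (K ξ).le_opNorm _
      _ ≤ _ := by gcongr; exact hC ξ
  filter_upwards [ae_all_iff.mpr fun i => (hM i).coeFn_toLp] with ξ hξ
  ext i
  simp only [hat, applySymbol, dif_pos (hM i), FourierTransform.fourier_fourierInv_eq]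
  exact hξ i

theorem inSobolev_of_hat_le {n : ℕ} {s : ℝ} (hs : 0 ≤ s) {F G : Fin 3 → L2 n} {C : ℝ}
    (hF : InSobolev s F) (h : ∀ᵐ ξ, ‖hat G ξ‖ ≤ C * ‖hat F ξ‖) : InSobolev s G := by
  rw [inSobolev_iff hs] at hF ⊢
  refine (hF.const_mul (C ^ 2)).mono' (aestronglyMeasurable_weight_hat s G) ?_
  filter_upwards [h] with ξ hξ
  rw [Real.norm_of_nonneg (by positivity), mul_left_comm, ← mul_pow]
  gcongr

theorem sobolevNorm_le_of_hat_le {n : ℕ} {s : ℝ} (hs : 0 ≤ s) {F G : Fin 3 → L2 n} {C : ℝ}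
    (hC : 0 ≤ C) (hF : InSobolev s F) (h : ∀ᵐ ξ, ‖hat G ξ‖ ≤ C * ‖hat F ξ‖) :
    sobolevNorm s G ≤ 2 * C * sobolevNorm s F := by
  have hG := inSobolev_of_hat_le hs hF h
  refine le_of_sq_le_sq ?_ (mul_nonneg (by positivity) (sobolevNorm_nonneg s F))
  calc sobolevNorm s G ^ 2
      ≤ 3 * ∫ ξ, (1 + (2 * Real.pi * ‖ξ‖) ^ 2) ^ s * ‖hat G ξ‖ ^ 2 := by
        exact_mod_cast sobolevNorm_sq_le hs hG
    _ ≤ 3 * ∫ ξ, C ^ 2 * ((1 + (2 * Real.pi * ‖ξ‖) ^ 2) ^ s * ‖hat F ξ‖ ^ 2) := by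
        refine mul_le_mul_of_nonneg_left (integral_mono_ae ((inSobolev_iff hs G).mp hG)
          (((inSobolev_iff hs F).mp hF).const_mul _) ?_) (by norm_num)
        filter_upwards [h] with ξ hξ
        rw [mul_left_comm, ← mul_pow]
        gcongr
    _ ≤ 3 * (C ^ 2 * sobolevNorm s F ^ 2) := by
        rw [integral_const_mul]
        gcongr
        exact integral_weight_le_sobolevNorm_sq hs hF
    _ ≤ (2 * C * sobolevNorm s F) ^ 2 := by
        nlinarith [sq_nonneg (C * sobolevNorm s F)]

/-- A pointwise continuous, uniformly bounded family of multipliers yields a path in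
`C([0,∞), H^s)`. -/
theorem continuousInSobolev_of_symbol {n : ℕ} {s : ℝ} (hs : 0 ≤ s) {F₀ : Fin 3 → L2 n}
    (hF : InSobolev s F₀) {K : ℝ → Rn n → (Fin 3 → ℂ) →L[ℂ] (Fin 3 → ℂ)} {C : ℝ}
    (hC : ∀ t, 0 ≤ t → ∀ ξ, ‖K t ξ‖ ≤ C) (hcont : ∀ ξ, Continuous fun t => K t ξ)
    {F : ℝ → Fin 3 → L2 n}
    (h : ∀ t, 0 ≤ t → ∀ᵐ ξ, hat (F t) ξ = K t ξ (hat F₀ ξ)) : ContinuousInSobolev s F := by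
  have hle : ∀ t, 0 ≤ t → ∀ᵐ ξ, ‖hat (F t) ξ‖ ≤ C * ‖hat F₀ ξ‖ := by
    intro t ht
    filter_upwards [h t ht] with ξ hξ
    rw [hξ]
    exact (K t ξ).le_of_opNorm_le (hC t ht ξ) _
  have hS : ∀ t, 0 ≤ t → InSobolev s (F t) := fun t ht => inSobolev_of_hat_le hs hF (hle t ht)
  refine ⟨hS, fun t ht => ?_⟩
  have hle2 : ∀ τ, 0 ≤ τ → ∀ᵐ ξ, ‖hat (F τ - F t) ξ‖ ≤ (2 * C) * ‖hat F₀ ξ‖ := by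
    intro τ hτ
    filter_upwards [hle t ht, hle τ hτ, hat_sub_ae (F τ) (F t)] with ξ h1 h2 h3
    rw [h3]
    calc _ ≤ ‖hat (F τ) ξ‖ + ‖hat (F t) ξ‖ := norm_sub_le _ _
      _ ≤ _ := by linarith
  have hlim : Tendsto (fun τ => ∫ ξ, (1 + (2 * Real.pi * ‖ξ‖) ^ 2) ^ s *
      ‖hat (F τ - F t) ξ‖ ^ 2) (𝓝[Ici 0] t) (𝓝 0) := by
    have heq : ∀ τ, 0 ≤ τ → (fun ξ => (1 + (2 * Real.pi * ‖ξ‖) ^ 2) ^ s * ‖hat (F τ - F t) ξ‖ ^ 2)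
        =ᵐ[volume] fun ξ => (1 + (2 * Real.pi * ‖ξ‖) ^ 2) ^ s *
          ‖(K τ ξ - K t ξ) (hat F₀ ξ)‖ ^ 2 := by
      intro τ hτ
      filter_upwards [h t ht, h τ hτ, hat_sub_ae (F τ) (F t)] with ξ h1 h2 h3
      rw [h3, h1, h2, sub_apply]
    have hK : Tendsto (fun τ => ∫ ξ, (1 + (2 * Real.pi * ‖ξ‖) ^ 2) ^ s *
        ‖(K τ ξ - K t ξ) (hat F₀ ξ)‖ ^ 2) (𝓝[Ici 0] t) (𝓝 (∫ _ξ : Rn n, (0 : ℝ))) := by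
      -- The symbols converge pointwise in frequency and are bounded by `C`, so `(2C)²` times the
      -- `H^s` density of `F₀` dominates.
      refine tendsto_integral_filter_of_dominated_convergence
        (fun ξ => (2 * C) ^ 2 * ((1 + (2 * Real.pi * ‖ξ‖) ^ 2) ^ s * ‖hat F₀ ξ‖ ^ 2)) ?_ ?_ ?_ ?_
      · filter_upwards [self_mem_nhdsWithin] with τ hτ
        exact (aestronglyMeasurable_weight_hat s _).congr (heq τ hτ)
      · filter_upwards [self_mem_nhdsWithin] with τ hτ
        filter_upwards [hle2 τ hτ, heq τ hτ] with ξ hξ h2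
        rw [← h2, Real.norm_of_nonneg (by positivity), mul_left_comm, ← mul_pow]
        gcongr
      · exact ((inSobolev_iff hs F₀).mp hF).const_mul _
      · refine Eventually.of_forall fun ξ => ?_
        have : Continuous fun τ => (1 + (2 * Real.pi * ‖ξ‖) ^ 2) ^ s *
            ‖(K τ ξ - K t ξ) (hat F₀ ξ)‖ ^ 2 := by
          have := hcont ξ
          fun_prop
        have h2 := (this.tendsto t).mono_left (nhdsWithin_le_nhds (s := Ici 0))
        simpa using h2
    rw [integral_zero] at hK
    refine hK.congr' ?_
    filter_upwards [self_mem_nhdsWithin] with τ hτ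
    exact (integral_congr_ae (heq τ hτ)).symm
  have hsq : Tendsto (fun τ => Real.sqrt (3 * ∫ ξ, (1 + (2 * Real.pi * ‖ξ‖) ^ 2) ^ s *
      ‖hat (F τ - F t) ξ‖ ^ 2)) (𝓝[Ici 0] t) (𝓝 0) := by
    have := (Real.continuous_sqrt.tendsto _).comp (hlim.const_mul 3)
    rw [mul_zero, Real.sqrt_zero] at this
    exact this
  refine squeeze_zero' (Eventually.of_forall fun τ => sobolevNorm_nonneg s _) ?_ hsq
  filter_upwards [self_mem_nhdsWithin] with τ hτ
  refine Real.le_sqrt_of_sq_le ?_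
  exact_mod_cast sobolevNorm_sq_le hs (inSobolev_of_hat_le hs hF (hle2 τ hτ))

/-! ### Linear evolution equations for `L²` paths, tested with Schwartz functions. -/

theorem norm_L2_sq {n : ℕ} (f : L2 n) : ‖f‖ ^ 2 = ∫ ξ, ‖f ξ‖ ^ 2 := by
  have h := inner_self_eq_norm_sq_to_K (𝕜 := ℂ) f
  rw [L2.inner_def] at h
  simp_rw [inner_self_eq_norm_sq_to_K] at h
  have h2 : ((∫ ξ, ‖f ξ‖ ^ 2 : ℝ) : ℂ) = ((‖f‖ ^ 2 : ℝ) : ℂ) := by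
    rw [← integral_complex_ofReal]
    push_cast
    exact h
  exact_mod_cast h2.symm

theorem norm_le_sobolevNorm {n k : ℕ} {s : ℝ} (hs : 0 ≤ s) {F : Fin k → L2 n}
    (hF : InSobolev s F) (i : Fin k) : ‖F i‖ ≤ sobolevNorm s F := by
  refine le_of_sq_le_sq ?_ (sobolevNorm_nonneg s F)
  rw [← Lp.norm_fourier_eq (F i), norm_L2_sq]
  refine le_trans ?_ (integral_weight_le_sobolevNorm_sq hs hF)
  refine integral_mono ((memLp_two_iff_integrable_sq_norm (aestronglyMeasurable_fourier _)).mp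
    (memLp_fourier (F i))) ((inSobolev_iff hs F).mp hF) fun ξ => ?_
  have h1 : ‖(𝓕 (F i) : L2 n) ξ‖ ≤ ‖hat F ξ‖ := norm_le_pi_norm (hat F ξ) i
  calc ‖(𝓕 (F i) : L2 n) ξ‖ ^ 2 ≤ ‖hat F ξ‖ ^ 2 := by gcongr
    _ ≤ _ := le_mul_of_one_le_left (sq_nonneg _) (one_le_weight hs ξ)

theorem InSobolev.sub {n k : ℕ} {s : ℝ} {F G : Fin k → L2 n} (hF : InSobolev s F)
    (hG : InSobolev s G) : InSobolev s (F - G) := by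
  intro i
  rw [Pi.sub_apply, toTD_sub]
  exact (hF i).sub (hG i)

theorem ContinuousInSobolev.continuousOn {n k : ℕ} {s : ℝ} (hs : 0 ≤ s) {F : ℝ → Fin k → L2 n}
    (hF : ContinuousInSobolev s F) (i : Fin k) : ContinuousOn (fun t => F t i) (Ici 0) := by
  intro t ht
  rw [ContinuousWithinAt, tendsto_iff_norm_sub_tendsto_zero]
  refine squeeze_zero' (Eventually.of_forall fun τ => norm_nonneg _) ?_ (hF.2 t ht)
  filter_upwards [self_mem_nhdsWithin] with τ hτ
  exact norm_le_sobolevNorm hs ((hF.1 τ hτ).sub (hF.1 t ht)) i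

theorem continuousOn_toTD_apply {n : ℕ} {f : ℝ → L2 n} {S : Set ℝ} (hf : ContinuousOn f S)
    (η : 𝓢(Rn n, ℂ)) : ContinuousOn (fun t => (f t : TD n) η) S := by
  have h : Continuous fun g : L2 n => (g : TD n) η :=
    (PointwiseConvergenceCLM.evalCLM (RingHom.id ℂ) ℂ η).continuous.comp
      (Lp.toTemperedDistributionCLM ℂ volume 2).continuous
  exact h.comp_continuousOn hf

theorem memLp_symbol_schwartz {n : ℕ} {p : Rn n → ℂ} {C : ℝ}
    (hp : AEStronglyMeasurable p volume) (hC : ∀ ξ, ‖p ξ‖ ≤ C * (1 + ‖ξ‖ ^ 2))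
    (ψ : 𝓢(Rn n, ℂ)) : MemLp (fun ξ => p ξ * ψ ξ) 2 volume := by
  refine (memLp_weight_schwartz ψ).of_le_mul (c := C) (hp.mul ψ.continuous.aestronglyMeasurable)
    (Eventually.of_forall fun ξ => ?_)
  rw [norm_mul, norm_mul, Complex.norm_real, Real.norm_of_nonneg (by positivity), ← mul_assoc]
  gcongr
  exact hC ξ

/-- The product `p ψ` lies in `L²`, so the pairing is an inner product with its conjugate. Having it
as a continuous functional allows it to commute with time integrals of `L²` paths. -/
theorem exists_pairing_clm {n : ℕ} {p : Rn n → ℂ} {C : ℝ}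
    (hp : AEStronglyMeasurable p volume) (hC : ∀ ξ, ‖p ξ‖ ≤ C * (1 + ‖ξ‖ ^ 2))
    (ψ : 𝓢(Rn n, ℂ)) :
    ∃ Λ : L2 n →L[ℂ] ℂ, ∀ f : L2 n, Λ f = ∫ ξ, p ξ * (𝓕 f : L2 n) ξ * ψ ξ := by
  have hm := memLp_symbol_schwartz hp hC ψ
  have hstar : MemLp (fun ξ => (starRingEnd ℂ) (p ξ * ψ ξ)) 2 volume := hm.star
  refine ⟨(innerSL ℂ (hstar.toLp)).comp
    (Lp.fourierTransformₗᵢ (Rn n) ℂ).toContinuousLinearEquiv.toContinuousLinearMap, fun f => ?_⟩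
  change inner ℂ (hstar.toLp) (𝓕 f : L2 n) = _
  rw [L2.inner_def]
  refine integral_congr_ae ?_
  filter_upwards [hstar.coeFn_toLp] with ξ hξ
  rw [hξ]
  simp
  ring

theorem integrable_symbol_pairing {n : ℕ} {p : Rn n → ℂ} {C : ℝ}
    (hp : AEStronglyMeasurable p volume) (hC : ∀ ξ, ‖p ξ‖ ≤ C * (1 + ‖ξ‖ ^ 2))
    (f : L2 n) (ψ : 𝓢(Rn n, ℂ)) :
    Integrable (fun ξ => p ξ * (𝓕 f : L2 n) ξ * ψ ξ) volume := by
  refine integrable_mul_schwartz (u := fun ξ => (𝓕 f : L2 n) ξ) (C := C)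
    (hp.mul (aestronglyMeasurable_fourier f)) (memLp_fourier f)
    (Eventually.of_forall fun ξ => ?_) ψ
  simp only [Pi.mul_apply, norm_mul]
  gcongr
  exact hC ξ

theorem exists_row_clm {n : ℕ} {p : Fin 3 → Rn n → ℂ} {C : ℝ}
    (hp : ∀ j, AEStronglyMeasurable (p j) volume) (hC : ∀ j ξ, ‖p j ξ‖ ≤ C * (1 + ‖ξ‖ ^ 2))
    (ψ : 𝓢(Rn n, ℂ)) :
    ∃ Λ : (Fin 3 → L2 n) →L[ℂ] ℂ, ∀ F : Fin 3 → L2 n,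
      Λ F = ∫ ξ, (∑ j, p j ξ * (𝓕 (F j) : L2 n) ξ) * ψ ξ := by
  choose Λ hΛ using fun j => exists_pairing_clm (hp j) (hC j) ψ
  refine ⟨∑ j, (Λ j).comp (ContinuousLinearMap.proj j), fun F => ?_⟩
  simp only [Finset.sum_mul]
  rw [integral_finsetSum _ fun j _ => integrable_symbol_pairing (hp j) (hC j) (F j) ψ]
  simp [hΛ]

theorem locallyIntegrable_row {n : ℕ} {p : Fin 3 → Rn n → ℂ} {C : ℝ}
    (hp : ∀ j, AEStronglyMeasurable (p j) volume) (hC : ∀ j ξ, ‖p j ξ‖ ≤ C * (1 + ‖ξ‖ ^ 2))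
    (F : Fin 3 → L2 n) :
    LocallyIntegrable (fun ξ => ∑ j, p j ξ * (𝓕 (F j) : L2 n) ξ) volume := by
  refine locallyIntegrable_finsetSum _ fun j _ => ?_
  refine locallyIntegrable_of_le (u := fun ξ => (𝓕 (F j) : L2 n) ξ) (C := C)
    ((hp j).mul (aestronglyMeasurable_fourier (F j))) (memLp_fourier (F j))
    (Eventually.of_forall fun ξ => ?_)
  simp only [norm_mul]
  gcongr
  exact hC j ξ

theorem intervalIntegrable_of_continuousOn_Ici {E : Type*} [NormedAddCommGroup E]
    {f : ℝ → E} (hf : ContinuousOn f (Ici 0)) {t : ℝ} (ht : 0 ≤ t) :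
    IntervalIntegrable f volume 0 t :=
  (hf.mono (by rw [uIcc_of_le ht]; exact Icc_subset_Ici_self)).intervalIntegrable

/-- A linear evolution equation between `L²` paths, tested with Schwartz functions, holds
pointwise in frequency after an integration in time. -/
theorem integrated_equation {n : ℕ} {q p : Fin 3 → Rn n → ℂ} {C : ℝ}
    (hq : ∀ j, AEStronglyMeasurable (q j) volume) (hqC : ∀ j ξ, ‖q j ξ‖ ≤ C * (1 + ‖ξ‖ ^ 2))
    (hp : ∀ j, AEStronglyMeasurable (p j) volume) (hpC : ∀ j ξ, ‖p j ξ‖ ≤ C * (1 + ‖ξ‖ ^ 2))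
    {w : ℝ → Fin 3 → L2 n} (hw : ∀ j, ContinuousOn (fun t => w t j) (Ici 0))
    (h : ∀ t, 0 < t → ∀ η : 𝓢(Rn n, ℂ), HasDerivAt
      (fun τ => ∫ ξ, (∑ j, q j ξ * (𝓕 (w τ j) : L2 n) ξ) * (𝓕⁻ η : 𝓢(Rn n, ℂ)) ξ)
      (∫ ξ, (∑ j, p j ξ * (𝓕 (w t j) : L2 n) ξ) * (𝓕⁻ η : 𝓢(Rn n, ℂ)) ξ) t)
    {t : ℝ} (ht : 0 ≤ t) :
    ∀ᵐ ξ, ∑ j, q j ξ * ((𝓕 (w t j) : L2 n) ξ - (𝓕 (w 0 j) : L2 n) ξ)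
      = ∑ j, p j ξ * (𝓕 (∫ τ in 0..t, w τ j) : L2 n) ξ := by
  have hw' : ContinuousOn w (Ici 0) := continuousOn_pi.mpr hw
  have hint := intervalIntegrable_of_continuousOn_Ici hw' ht
  have hZ : ∀ j, (∫ τ in 0..t, w τ) j = ∫ τ in 0..t, w τ j := fun j =>
    ((ContinuousLinearMap.proj (R := ℂ) j : (Fin 3 → L2 n) →L[ℂ] L2 n).intervalIntegral_comp_comm
      hint).symm
  have key : (fun ξ => ∑ j, q j ξ * (𝓕 ((w t - w 0) j) : L2 n) ξ)
      =ᵐ[volume] fun ξ => ∑ j, p j ξ * (𝓕 ((∫ τ in 0..t, w τ) j) : L2 n) ξ := by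
    refine ae_eq_of_pairing (locallyIntegrable_row hq hqC _) (locallyIntegrable_row hp hpC _)
      fun η => ?_
    obtain ⟨Λ, hΛ⟩ := exists_row_clm hq hqC (𝓕⁻ η)
    obtain ⟨M, hM⟩ := exists_row_clm hp hpC (𝓕⁻ η)
    rw [← hΛ, ← hM, ← M.intervalIntegral_comp_comm hint, map_sub]
    symm
    -- The derivative is known only for positive times. Continuity of the path at time `0` suffices
    -- for the fundamental theorem of calculus on `[0, t]`.
    refine intervalIntegral.integral_eq_sub_of_hasDerivAt_of_le (f := fun τ => Λ (w τ)) ht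
      (Λ.continuous.comp_continuousOn (hw'.mono Icc_subset_Ici_self)) (fun τ hτ => ?_)
      (intervalIntegrable_of_continuousOn_Ici (M.continuous.comp_continuousOn hw') ht)
    have := h τ hτ.1 η
    simp only [← hΛ, ← hM] at this
    exact this
  filter_upwards [key, ae_all_iff.mpr fun j => fourier_sub_ae (w t j) (w 0 j)] with ξ h1 h2
  simp only [Pi.sub_apply, hZ] at h1
  rw [← h1]
  exact Finset.sum_congr rfl fun j _ => by rw [h2 j]

theorem norm_restrict_le_sum {n : ℕ} {B : Set (Rn n)} {c : ℝ}
    {f : Lp ℂ 2 (volume.restrict B)} {g : Fin 3 → Lp ℂ 2 (volume.restrict B)}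
    (h : ∀ᵐ ξ ∂(volume.restrict B), ‖f ξ‖ ≤ c * ∑ j, ‖g j ξ‖) :
    ‖f‖ ≤ c * ∑ j, ‖g j‖ := by
  rcases le_or_gt 0 c with hc | hc
  · let G : Lp ℝ 2 (volume.restrict B) := ∑ j, ((Lp.memLp (g j)).norm).toLp
    have hG : ‖f‖ ≤ c * ‖G‖ := by
      refine Lp.norm_le_mul_norm_of_ae_le_mul ?_
      filter_upwards [h, Lp.coeFn_finsetSum Finset.univ fun j => ((Lp.memLp (g j)).norm).toLp,
        ae_all_iff.mpr fun j => ((Lp.memLp (g j)).norm).coeFn_toLp] with ξ h1 h2 h3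
      refine h1.trans ?_
      gcongr
      simp only [G]
      rw [h2]
      simp only [Finset.sum_apply, h3]
      exact le_abs_self _
    refine hG.trans ?_
    gcongr
    refine (norm_sum_le _ _).trans (Finset.sum_le_sum fun j _ => ?_)
    refine Lp.norm_le_norm_of_ae_le ?_
    filter_upwards [((Lp.memLp (g j)).norm).coeFn_toLp] with ξ hξ
    rw [hξ, norm_norm]
  · have hf : f = 0 := by
      refine Lp.ext ?_
      filter_upwards [h, Lp.coeFn_zero ℂ 2 (volume.restrict B)] with ξ h1 h2
      rw [h2]
      have h3 : 0 ≤ ∑ j, ‖g j ξ‖ := Finset.sum_nonneg fun _ _ => norm_nonneg _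
      have h4 : ‖f ξ‖ ≤ 0 := h1.trans (mul_nonpos_of_nonpos_of_nonneg hc.le h3)
      simpa using h4
    have hg : ∀ j, g j = 0 := by
      intro j
      refine Lp.ext ?_
      filter_upwards [h, Lp.coeFn_zero ℂ 2 (volume.restrict B)] with ξ h1 h2
      rw [h2]
      have h3 : ‖g j ξ‖ ≤ ∑ j, ‖g j ξ‖ :=
        Finset.single_le_sum (f := fun j => ‖g j ξ‖) (fun _ _ => norm_nonneg _) (Finset.mem_univ j)
      have h4 : 0 ≤ c * ∑ j, ‖g j ξ‖ := (norm_nonneg _).trans h1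
      have h5 : ‖g j ξ‖ ≤ 0 := by nlinarith [norm_nonneg (g j ξ)]
      simpa using h5
    simp [hf, hg]

/-- A continuous `L²` path `w` with `ŵ(t) = B(ξ) ∫₀ᵗ ŵ`, for a symbol `B` of order two, vanishes. -/
theorem eq_zero_of_integrated {n : ℕ} {C : ℝ} {w : ℝ → Fin 3 → L2 n}
    (hw : ∀ j, ContinuousOn (fun t => w t j) (Ici 0))
    (h : ∀ t, 0 ≤ t → ∀ᵐ ξ, ‖hat (w t) ξ‖ ≤
      C * (1 + ‖ξ‖ ^ 2) * ‖hat (fun j => ∫ τ in 0..t, w τ j) ξ‖) :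
    ∀ t, 0 ≤ t → w t = 0 := by
  have hC : ∃ C' : ℝ, 0 ≤ C' ∧ C ≤ C' := ⟨|C|, abs_nonneg _, le_abs_self _⟩
  obtain ⟨C', hC'0, hCC'⟩ := hC
  have hcont0 : ∀ j, ContinuousOn (fun t => ∫ τ in 0..t, w τ j) (Ici 0) := by
    intro j t ht
    have hi : IntervalIntegrable (fun τ => w τ j) volume 0 (t + 1) :=
      intervalIntegrable_of_continuousOn_Ici (hw j) (by linarith [mem_Ici.mp ht])
    have h0 : (0 : ℝ) ≤ t + 1 := by linarith [mem_Ici.mp ht]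
    have h1 := intervalIntegral.continuousOn_primitive_interval (a := 0) (b := t + 1)
      (f := fun τ => w τ j) (μ := volume)
      ((intervalIntegrable_iff_integrableOn_Icc_of_le h0).mp hi |>.mono_set
        (by rw [uIcc_of_le h0]))
    rw [uIcc_of_le h0] at h1
    refine (h1 t ⟨ht, by linarith⟩).mono_of_mem_nhdsWithin ?_
    rw [mem_nhdsWithin]
    exact ⟨Iio (t + 1), isOpen_Iio, by simp, fun x hx => ⟨hx.2, hx.1.le⟩⟩
  have hderiv0 : ∀ j t, 0 ≤ t →
      HasDerivWithinAt (fun t => ∫ τ in 0..t, w τ j) (w t j) (Ici t) t := by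
    intro j t ht
    have hc : ContinuousOn (fun τ => w τ j) (Ici t) := (hw j).mono (Ici_subset_Ici.mpr ht)
    refine intervalIntegral.integral_hasDerivWithinAt_right
      (intervalIntegrable_of_continuousOn_Ici (hw j) ht) (t := Ioi t) ?_ ?_
    · exact (hc.mono Ioi_subset_Ici_self).stronglyMeasurableAtFilter_nhdsWithin
        measurableSet_Ioi t
    · exact (hc t self_mem_Ici).mono Ioi_subset_Ici_self
  -- The symbol is unbounded, so Gronwall's inequality is not available on all of `L²`. After
  -- restriction to `‖ξ‖ < R` the symbol is bounded by `C' (1 + R²)`, and these balls exhaust the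
  -- space.
  have hball : ∀ (R : ℕ) t, 0 ≤ t →
      ∀ᵐ ξ ∂(volume.restrict (Metric.ball (0 : Rn n) R)), hat (w t) ξ = 0 := by
    intro R
    set B := Metric.ball (0 : Rn n) R with hB
    let r : L2 n →L[ℂ] Lp ℂ 2 (volume.restrict B) :=
      (LpToLpRestrictCLM (Rn n) ℂ ℂ volume 2 B).comp
        (Lp.fourierTransformₗᵢ (Rn n) ℂ).toContinuousLinearEquiv.toContinuousLinearMap
    have hr : ∀ f : L2 n, ∀ᵐ ξ ∂(volume.restrict B), r f ξ = (𝓕 f : L2 n) ξ := fun f =>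
      LpToLpRestrictCLM_coeFn ℂ B (𝓕 f : L2 n)
    let Y : ℝ → Fin 3 → Lp ℂ 2 (volume.restrict B) := fun t j => r (∫ τ in 0..t, w τ j)
    have hbound : ∀ t, 0 ≤ t → ‖fun j => r (w t j)‖ ≤ (C' * (1 + (R : ℝ) ^ 2) * 3) * ‖Y t‖ := by
      intro t ht
      refine (pi_norm_le_iff_of_nonneg (by positivity)).mpr fun i => ?_
      have h1 : ‖r (w t i)‖ ≤ (C' * (1 + (R : ℝ) ^ 2)) * ∑ j, ‖Y t j‖ := by
        refine norm_restrict_le_sum ?_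
        filter_upwards [hr (w t i), ae_all_iff.mpr fun j => hr (∫ τ in 0..t, w τ j),
          ae_restrict_of_ae (h t ht), ae_restrict_mem Metric.isOpen_ball.measurableSet]
          with ξ h1 h2 h3 h4
        rw [h1]
        have h5 : ‖ξ‖ < R := by simpa [hB] using h4
        simp only [Y, h2]
        calc ‖(𝓕 (w t i) : L2 n) ξ‖ ≤ ‖hat (w t) ξ‖ := norm_le_pi_norm (hat (w t) ξ) i
          _ ≤ C * (1 + ‖ξ‖ ^ 2) * ‖hat (fun j => ∫ τ in 0..t, w τ j) ξ‖ := h3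
          _ ≤ C' * (1 + (R : ℝ) ^ 2) * ∑ j, ‖(𝓕 (∫ τ in 0..t, w τ j) : L2 n) ξ‖ := by
            gcongr
            refine (pi_norm_le_iff_of_nonneg (Finset.sum_nonneg fun _ _ => norm_nonneg _)).mpr
              fun j => ?_
            exact Finset.single_le_sum (f := fun j => ‖(𝓕 (∫ τ in 0..t, w τ j) : L2 n) ξ‖)
              (fun _ _ => norm_nonneg _) (Finset.mem_univ j)
      refine h1.trans ?_
      have h2 : ∑ j, ‖Y t j‖ ≤ 3 * ‖Y t‖ := by
        calc _ ≤ ∑ _j : Fin 3, ‖Y t‖ := Finset.sum_le_sum fun j _ => norm_le_pi_norm (Y t) j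
          _ = _ := by simp
      calc _ ≤ (C' * (1 + (R : ℝ) ^ 2)) * (3 * ‖Y t‖) := by gcongr
        _ = _ := by ring
    intro t ht
    -- Gronwall is applied to the primitive `Y`, which is differentiable in time with derivative
    -- controlled by `Y` itself; the path `w` is only known to be continuous.
    have hY : ∀ x ∈ Icc (0 : ℝ) (t + 1), Y x = 0 := by
      refine eq_zero_of_abs_deriv_le_mul_abs_self_of_eq_zero_right
        (f' := fun x j => r (w x j)) (K := C' * (1 + (R : ℝ) ^ 2) * 3) ?_ ?_ ?_ ?_
      · exact continuousOn_pi.mpr fun j => r.continuous.comp_continuousOn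
          ((hcont0 j).mono Icc_subset_Ici_self)
      · intro x hx
        exact hasDerivWithinAt_pi.mpr fun j =>
          (r.restrictScalars ℝ).hasFDerivAt.comp_hasDerivWithinAt x (hderiv0 j x hx.1)
      · ext1 j
        simp [Y]
      · exact fun x hx => hbound x hx.1
    have h0 := hbound t ht
    rw [hY t ⟨ht, by linarith⟩, norm_zero, mul_zero] at h0
    have h1 : ∀ j, r (w t j) = 0 := fun j =>
      congrFun (norm_le_zero_iff.mp h0) j
    filter_upwards [ae_all_iff.mpr fun j => hr (w t j),
      Lp.coeFn_zero ℂ 2 (volume.restrict B)] with ξ h2 h3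
    ext j
    have h4 := h2 j
    rw [h1 j, h3] at h4
    exact h4.symm
  intro t ht
  refine eq_of_hat_ae_eq ?_
  have h1 : ∀ᵐ ξ : Rn n, hat (w t) ξ = 0 := by
    have := (ae_restrict_iUnion_iff (fun R : ℕ => Metric.ball (0 : Rn n) R)
      (fun ξ => hat (w t) ξ = 0) (μ := volume)).mpr fun R => hball R t ht
    rwa [Metric.iUnion_ball_nat, Measure.restrict_univ] at this
  filter_upwards [h1, hat_sub_ae (0 : Fin 3 → L2 n) 0] with ξ h2 h3
  rw [h2]
  simpa using h3.symm

/-- Differentiation in time of the pairing of a time-dependent multiplier with a test function. -/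
theorem hasDerivAt_symbol_pairing {n : ℕ} {K K' : ℝ → Rn n → (Fin 3 → ℂ) →L[ℂ] (Fin 3 → ℂ)}
    {C t T : ℝ} (ht : 0 < t) (htT : t < T) (hK : ∀ τ, Continuous (K τ))
    (hK' : ∀ τ, Continuous (K' τ))
    (hd : ∀ τ ∈ Ioo 0 T, ∀ ξ, HasDerivAt (fun τ => K τ ξ) (K' τ ξ) τ)
    (hC : ∀ τ ∈ Ioo 0 T, ∀ ξ, ‖K τ ξ‖ ≤ C * (1 + ‖ξ‖ ^ 2))
    (hC' : ∀ τ ∈ Ioo 0 T, ∀ ξ, ‖K' τ ξ‖ ≤ C * (1 + ‖ξ‖ ^ 2))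
    {F₀ : Fin 3 → L2 n} {F : ℝ → Fin 3 → L2 n}
    (hF : ∀ τ, 0 ≤ τ → ∀ᵐ ξ, hat (F τ) ξ = K τ ξ (hat F₀ ξ)) (i : Fin 3) (ψ : 𝓢(Rn n, ℂ)) :
    HasDerivAt (fun τ => ∫ ξ, (𝓕 (F τ i) : L2 n) ξ * ψ ξ)
      (∫ ξ, K' t ξ (hat F₀ ξ) i * ψ ξ) t := by
  have hmeas : ∀ L : Rn n → (Fin 3 → ℂ) →L[ℂ] (Fin 3 → ℂ), Continuous L →
      AEStronglyMeasurable (fun ξ => L ξ (hat F₀ ξ) i) volume := fun L hL =>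
    (continuous_apply i).comp_aestronglyMeasurable
      (aestronglyMeasurable_clm_apply hL (aestronglyMeasurable_hat F₀))
  have hle : ∀ L : Rn n → (Fin 3 → ℂ) →L[ℂ] (Fin 3 → ℂ), ∀ ξ, ‖L ξ‖ ≤ C * (1 + ‖ξ‖ ^ 2) →
      ‖L ξ (hat F₀ ξ) i‖ ≤ C * (1 + ‖ξ‖ ^ 2) * ‖hat F₀ ξ‖ := fun L ξ hL =>
    (norm_le_pi_norm (L ξ (hat F₀ ξ)) i).trans ((L ξ).le_of_opNorm_le hL _)
  have hu : MemLp (fun ξ => ((‖hat F₀ ξ‖ : ℝ) : ℂ)) 2 volume := (memLp_hat F₀).norm.ofReal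
  have hint : ∀ L : Rn n → (Fin 3 → ℂ) →L[ℂ] (Fin 3 → ℂ), Continuous L →
      (∀ ξ, ‖L ξ‖ ≤ C * (1 + ‖ξ‖ ^ 2)) →
      Integrable (fun ξ => L ξ (hat F₀ ξ) i * ψ ξ) volume := fun L hL hLC => by
    refine integrable_mul_schwartz (C := C) (hmeas L hL) hu (Eventually.of_forall fun ξ => ?_) ψ
    rw [Complex.norm_real, norm_norm]
    exact hle L ξ (hLC ξ)
  -- Differentiation under the integral sign: the bound on `K'` is uniform in time on `(0, T)`, and
  -- the Schwartz function absorbs its quadratic growth.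
  have hmain := (hasDerivAt_integral_of_dominated_loc_of_deriv_le (μ := volume) (x₀ := t)
    (s := Ioo 0 T) (F := fun τ ξ => K τ ξ (hat F₀ ξ) i * ψ ξ)
    (F' := fun τ ξ => K' τ ξ (hat F₀ ξ) i * ψ ξ)
    (bound := fun ξ => C * (1 + ‖ξ‖ ^ 2) * ‖hat F₀ ξ‖ * ‖ψ ξ‖)
    (Ioo_mem_nhds ht htT)
    (Eventually.of_forall fun τ => (hmeas _ (hK τ)).mul ψ.continuous.aestronglyMeasurable)
    (hint _ (hK t) (hC t ⟨ht, htT⟩))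
    ((hmeas _ (hK' t)).mul ψ.continuous.aestronglyMeasurable)
    (Eventually.of_forall fun ξ τ hτ => by
      rw [norm_mul]
      exact mul_le_mul_of_nonneg_right (hle _ ξ (hC' τ hτ ξ)) (norm_nonneg _))
    (by
      have := (integrable_mul_schwartz (f := fun ξ => ((C * (1 + ‖ξ‖ ^ 2) * ‖hat F₀ ξ‖ : ℝ) : ℂ))
        (C := |C|) (u := fun ξ => ((‖hat F₀ ξ‖ : ℝ) : ℂ)) ?_ hu
        (Eventually.of_forall fun ξ => ?_) ψ).norm
      · refine (this.mono' ?_ (Eventually.of_forall fun ξ => ?_))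
        · have hc : Continuous fun ξ : Rn n => C * (1 + ‖ξ‖ ^ 2) := by fun_prop
          exact (hc.aestronglyMeasurable.mul (aestronglyMeasurable_hat F₀).norm).mul
            ψ.continuous.aestronglyMeasurable.norm
        · simp only [norm_mul, Complex.norm_real, norm_norm, le_refl]
      · have hc : Continuous fun ξ : Rn n => C * (1 + ‖ξ‖ ^ 2) := by fun_prop
        exact Complex.continuous_ofReal.comp_aestronglyMeasurable
          (hc.aestronglyMeasurable.mul (aestronglyMeasurable_hat F₀).norm)
      · rw [Complex.norm_real, Complex.norm_real, norm_mul, norm_mul, norm_norm,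
          Real.norm_eq_abs, Real.norm_of_nonneg (by positivity : 0 ≤ 1 + ‖ξ‖ ^ 2)])
    (Eventually.of_forall fun ξ τ hτ => by
      have h1 := hd τ hτ ξ
      have h2 := ((((ContinuousLinearMap.proj i : (Fin 3 → ℂ) →L[ℂ] ℂ)).comp
        (ContinuousLinearMap.apply ℂ (Fin 3 → ℂ) (hat F₀ ξ))).restrictScalars ℝ).hasFDerivAt
          (x := K τ ξ)
      exact (h2.comp_hasDerivAt τ h1).mul_const (ψ ξ))).2
  refine hmain.congr_of_eventuallyEq ?_
  filter_upwards [Ioi_mem_nhds ht] with τ hτ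
  refine integral_congr_ae ?_
  filter_upwards [hF τ (mem_Ioi.mp hτ).le] with ξ hξ
  rw [show (𝓕 (F τ i) : L2 n) ξ = hat (F τ) ξ i from rfl, hξ]

/-! ### Lyapunov functional for the damped wave system at a fixed frequency. -/

/-- `exp(k t) G(t)` is nonincreasing. No sign of `G` is required, so the bound can also be applied
to `-G` to obtain a lower estimate. -/
theorem le_exp_mul_of_deriv_le {G G' : ℝ → ℝ} {k : ℝ} (hG : ∀ t, HasDerivAt G (G' t) t)
    (h : ∀ t, 0 ≤ t → G' t ≤ -k * G t) {t : ℝ} (ht : 0 ≤ t) :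
    G t ≤ Real.exp (-(k * t)) * G 0 := by
  have hd : ∀ t, HasDerivAt (fun t => Real.exp (k * t) * G t)
      (Real.exp (k * t) * (k * G t + G' t)) t := by
    intro t
    have h1 : HasDerivAt (fun t => Real.exp (k * t)) (Real.exp (k * t) * k) t := by
      simpa using ((hasDerivAt_id t).const_mul k).exp
    exact (h1.mul (hG t)).congr_deriv (by ring)
  have hanti : AntitoneOn (fun t => Real.exp (k * t) * G t) (Ici 0) := by
    refine antitoneOn_of_deriv_nonpos (convex_Ici 0)
      (fun t _ => (hd t).continuousAt.continuousWithinAt)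
      (fun t _ => (hd t).differentiableAt.differentiableWithinAt) fun t ht => ?_
    rw [(hd t).deriv]
    have := h t (interior_subset ht)
    exact mul_nonpos_of_nonneg_of_nonpos (Real.exp_pos _).le (by linarith)
  have h1 := hanti self_mem_Ici ht ht
  simp only [mul_zero, Real.exp_zero, one_mul] at h1
  rw [Real.exp_neg, inv_mul_eq_div, le_div_iff₀ (Real.exp_pos _)]
  linarith

/-- The coefficients of the linearised system in the variables (velocity, potential, entropy),
in which it reads `v' = -2Γr²v - a r h + e r²y`, `h' = a r v`, `y' = -D r²y - δ r²v`. -/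
structure DampedWave where
  a : ℝ
  Γ : ℝ
  e : ℝ
  D : ℝ
  δ : ℝ
  μ : ℝ
  a_pos : 0 < a
  Γ_pos : 0 < Γ
  D_pos : 0 < D
  μ_pos : 0 < μ
  discr : (e - μ * δ) ^ 2 < 8 * Γ * D * μ

namespace DampedWave

/-- A solution of the system at frequency `r` with forcing `(fv, fh, fy)`. -/
structure IsSolution (q : DampedWave) (r : ℝ) (fv fh fy v h y : ℝ → ℂ) : Prop where
  deriv_v : ∀ t, HasDerivAt v (((-(2 * q.Γ * r ^ 2) : ℝ) : ℂ) * v t - ((q.a * r : ℝ) : ℂ) * h t +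
    ((q.e * r ^ 2 : ℝ) : ℂ) * y t + fv t) t
  deriv_h : ∀ t, HasDerivAt h (((q.a * r : ℝ) : ℂ) * v t + fh t) t
  deriv_y : ∀ t, HasDerivAt y (((-(q.D * r ^ 2) : ℝ) : ℂ) * y t - ((q.δ * r ^ 2 : ℝ) : ℂ) * v t +
    fy t) t

/-- The Lyapunov functional with parameter `ε`. -/
noncomputable def energy (q : DampedWave) (ε r : ℝ) (v h y : ℂ) : ℝ :=
  ‖v‖ ^ 2 + ‖h‖ ^ 2 + q.μ * ‖y‖ ^ 2 + 2 * ε * (r / (1 + r ^ 2)) * inner ℝ v h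

/-- Negative definiteness of the quadratic form in `(‖v‖, ‖y‖)` is exactly the condition `discr` on
the discriminant. -/
theorem exists_coercive (q : DampedWave) : ∃ κ : ℝ, 0 < κ ∧ ∀ v y : ℂ,
    -(2 * q.Γ) * ‖v‖ ^ 2 - q.μ * q.D * ‖y‖ ^ 2 + (q.e - q.μ * q.δ) * inner ℝ v y
      ≤ -κ * (‖v‖ ^ 2 + ‖y‖ ^ 2) := by
  have hΓ := q.Γ_pos
  have hμD := mul_pos q.μ_pos q.D_pos
  have hd := q.discr
  set m := q.e - q.μ * q.δ
  set s := 2 * q.Γ + q.μ * q.D with hs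
  have hs0 : 0 < s := by positivity
  -- Determinant over trace of the form bounds its smaller eigenvalue from below: `4 (2Γ - κ)(μD -
  -- κ) = m² + 4κ²`, so the form stays nonnegative after subtracting `κ`.
  set κ := (8 * q.Γ * q.D * q.μ - m ^ 2) / (4 * s) with hκ
  have hκ0 : 0 < κ := div_pos (by linarith) (by positivity)
  have hκs : κ * (4 * s) = 8 * q.Γ * q.D * q.μ - m ^ 2 := by
    rw [hκ]; field_simp
  have hP : 0 < 2 * q.Γ - κ := by
    have : κ * s < 2 * q.Γ * s := by nlinarith [sq_nonneg m, sq_pos_of_pos hΓ]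
    linarith [lt_of_mul_lt_mul_right this hs0.le]
  refine ⟨κ, hκ0, fun v y => ?_⟩
  have hin : m * inner ℝ v y ≤ |m| * (‖v‖ * ‖y‖) := by
    calc _ ≤ |m * inner ℝ v y| := le_abs_self _
      _ = |m| * |inner ℝ v y| := abs_mul _ _
      _ ≤ _ := by gcongr; exact abs_real_inner_le_norm v y
  have h1 : |m| ^ 2 ≤ 4 * (2 * q.Γ - κ) * (q.μ * q.D - κ) := by
    rw [sq_abs]
    nlinarith [sq_nonneg κ]
  have h2 : 0 ≤ 4 * (2 * q.Γ - κ) * ((2 * q.Γ - κ) * ‖v‖ ^ 2 - |m| * (‖v‖ * ‖y‖) +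
      (q.μ * q.D - κ) * ‖y‖ ^ 2) := by
    nlinarith [sq_nonneg (2 * (2 * q.Γ - κ) * ‖v‖ - |m| * ‖y‖), sq_nonneg ‖y‖,
      mul_le_mul_of_nonneg_right h1 (sq_nonneg ‖y‖)]
  have h3 := nonneg_of_mul_nonneg_right h2 (by positivity)
  linarith

theorem mul_inner_le (α η : ℝ) (hη : 0 < η) (x y : ℂ) :
    α * inner ℝ x y ≤ η * ‖y‖ ^ 2 + α ^ 2 / (4 * η) * ‖x‖ ^ 2 := by
  have h1 : α * inner ℝ x y ≤ |α| * (‖x‖ * ‖y‖) := by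
    calc _ ≤ |α * inner ℝ x y| := le_abs_self _
      _ = |α| * |inner ℝ x y| := abs_mul _ _
      _ ≤ _ := by gcongr; exact abs_real_inner_le_norm x y
  have h2 : |α| * (‖x‖ * ‖y‖) ≤ η * ‖y‖ ^ 2 + |α| ^ 2 / (4 * η) * ‖x‖ ^ 2 := by
    have h3 : η * ‖y‖ ^ 2 + |α| ^ 2 / (4 * η) * ‖x‖ ^ 2 - |α| * (‖x‖ * ‖y‖)
        = (2 * η * ‖y‖ - |α| * ‖x‖) ^ 2 / (4 * η) := by
      field_simp; ring
    have h4 : 0 ≤ (2 * η * ‖y‖ - |α| * ‖x‖) ^ 2 / (4 * η) := by positivity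
    linarith
  rw [sq_abs] at h2
  linarith

/-- The dissipation inequality for the Lyapunov functional. -/
theorem exists_dissipation (q : DampedWave) : ∃ ε c : ℝ, 0 < ε ∧ ε ≤ 1 / 2 ∧ 0 < c ∧
    ∀ r : ℝ, 0 ≤ r → ∀ v h y : ℂ,
      r ^ 2 * (-(2 * q.Γ) * ‖v‖ ^ 2 - q.μ * q.D * ‖y‖ ^ 2 + (q.e - q.μ * q.δ) * inner ℝ v y) +
        ε * (r / (1 + r ^ 2)) * (q.a * r * ‖v‖ ^ 2 - q.a * r * ‖h‖ ^ 2 -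
          2 * q.Γ * r ^ 2 * inner ℝ v h + q.e * r ^ 2 * inner ℝ y h)
      ≤ -c * (r ^ 2 / (1 + r ^ 2)) * (‖v‖ ^ 2 + ‖h‖ ^ 2 + ‖y‖ ^ 2) := by
  obtain ⟨κ, hκ, hco⟩ := q.exists_coercive
  have ha := q.a_pos
  -- `L` bounds what the cross term costs in `‖v‖²` and `‖y‖²`. The choice `ε L ≤ κ / 2` lets half
  -- of the coercivity pay for it.
  set L := q.a + 4 * q.Γ ^ 2 / q.a + q.e ^ 2 / q.a with hL
  have hL0 : 0 < L := by positivity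
  set ε := min (κ / (2 * L)) (1 / 2) with hε
  have hε0 : 0 < ε := lt_min (by positivity) (by norm_num)
  have hεL : ε * L ≤ κ / 2 := by
    calc ε * L ≤ κ / (2 * L) * L := by gcongr; exact min_le_left _ _
      _ = κ / 2 := by field_simp
  refine ⟨ε, min (κ / 2) (ε * q.a / 2), hε0, min_le_right _ _, lt_min (by positivity)
    (by positivity), fun r hr v h y => ?_⟩
  set c := min (κ / 2) (ε * q.a / 2) with hc
  set ρ := r ^ 2 / (1 + r ^ 2) with hρ
  have hρ0 : 0 ≤ ρ := by positivity
  have hρ1 : ρ ≤ 1 := by rw [hρ, div_le_one (by positivity)]; linarith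
  have hρr : ρ ≤ r ^ 2 := div_le_self (by positivity) (by nlinarith [sq_nonneg r])
  have e1 : ε * (r / (1 + r ^ 2)) * (q.a * r * ‖v‖ ^ 2 - q.a * r * ‖h‖ ^ 2 -
          2 * q.Γ * r ^ 2 * inner ℝ v h + q.e * r ^ 2 * inner ℝ y h)
      = ε * ρ * (q.a * ‖v‖ ^ 2 - q.a * ‖h‖ ^ 2 + (-(2 * q.Γ) * r) * inner ℝ v h
          + (q.e * r) * inner ℝ y h) := by
    rw [hρ]; field_simp; ring
  -- The cross term yields `-a‖h‖²`. Young's inequality spends `a/4` on each of the two mixed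
  -- products, which leaves `-(a/2)‖h‖²`.
  have i1 := mul_inner_le (-(2 * q.Γ) * r) (q.a / 4) (by positivity) v h
  have i2 := mul_inner_le (q.e * r) (q.a / 4) (by positivity) y h
  have i3 : (-(2 * q.Γ) * r) ^ 2 / (4 * (q.a / 4)) = 4 * q.Γ ^ 2 / q.a * r ^ 2 := by
    field_simp; ring
  have i4 : (q.e * r) ^ 2 / (4 * (q.a / 4)) = q.e ^ 2 / q.a * r ^ 2 := by
    field_simp
  rw [i3] at i1
  rw [i4] at i2
  rw [e1]
  have hX : 0 ≤ ‖v‖ ^ 2 + ‖y‖ ^ 2 := by positivity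
  have g1 : ρ * (q.a * ‖v‖ ^ 2 + 4 * q.Γ ^ 2 / q.a * r ^ 2 * ‖v‖ ^ 2 +
      q.e ^ 2 / q.a * r ^ 2 * ‖y‖ ^ 2) ≤ L * r ^ 2 * (‖v‖ ^ 2 + ‖y‖ ^ 2) := by
    have t1 : ρ * (q.a * ‖v‖ ^ 2) ≤ r ^ 2 * (q.a * (‖v‖ ^ 2 + ‖y‖ ^ 2)) := by
      gcongr; exact le_add_of_nonneg_right (by positivity)
    have t2 : ρ * (4 * q.Γ ^ 2 / q.a * r ^ 2 * ‖v‖ ^ 2) ≤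
        1 * (4 * q.Γ ^ 2 / q.a * r ^ 2 * (‖v‖ ^ 2 + ‖y‖ ^ 2)) := by
      gcongr; exact le_add_of_nonneg_right (by positivity)
    have t3 : ρ * (q.e ^ 2 / q.a * r ^ 2 * ‖y‖ ^ 2) ≤
        1 * (q.e ^ 2 / q.a * r ^ 2 * (‖v‖ ^ 2 + ‖y‖ ^ 2)) := by
      gcongr; exact le_add_of_nonneg_left (by positivity)
    rw [hL]
    linarith
  have g2 := mul_le_mul_of_nonneg_left (hco v y) (sq_nonneg r)
  have g3 : ε * ρ * (q.a * ‖v‖ ^ 2 - q.a * ‖h‖ ^ 2 + (-(2 * q.Γ) * r) * inner ℝ v h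
          + (q.e * r) * inner ℝ y h) ≤ ε * ρ * (q.a * ‖v‖ ^ 2 + 4 * q.Γ ^ 2 / q.a * r ^ 2 * ‖v‖ ^ 2 +
      q.e ^ 2 / q.a * r ^ 2 * ‖y‖ ^ 2 - q.a / 2 * ‖h‖ ^ 2) := by
    gcongr
    linarith
  have g4 : ε * (L * r ^ 2 * (‖v‖ ^ 2 + ‖y‖ ^ 2)) ≤ κ / 2 * (r ^ 2 * (‖v‖ ^ 2 + ‖y‖ ^ 2)) := by
    calc _ = ε * L * (r ^ 2 * (‖v‖ ^ 2 + ‖y‖ ^ 2)) := by ring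
      _ ≤ _ := by gcongr
  have g5 := mul_le_mul_of_nonneg_left g1 hε0.le
  have g6 : c * ρ * (‖v‖ ^ 2 + ‖y‖ ^ 2) ≤ κ / 2 * r ^ 2 * (‖v‖ ^ 2 + ‖y‖ ^ 2) := by
    gcongr
    exact min_le_left _ _
  have g7 : c * ρ * ‖h‖ ^ 2 ≤ ε * q.a / 2 * ρ * ‖h‖ ^ 2 := by
    gcongr
    exact min_le_right _ _
  linarith

/-- With `ε ≤ 1/2` and `r/(1+r²) ≤ 1` the cross term is at most half of `‖v‖² + ‖h‖²`, uniformly in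
`r`. -/
theorem energy_bounds (q : DampedWave) {ε r : ℝ} (hε : 0 < ε) (hε2 : ε ≤ 1 / 2) (hr : 0 ≤ r)
    (v h y : ℂ) :
    min (1 / 2) q.μ * (‖v‖ ^ 2 + ‖h‖ ^ 2 + ‖y‖ ^ 2) ≤ q.energy ε r v h y ∧
      q.energy ε r v h y ≤ (2 + q.μ) * (‖v‖ ^ 2 + ‖h‖ ^ 2 + ‖y‖ ^ 2) := by
  have hμ := q.μ_pos
  have hσ0 : 0 ≤ r / (1 + r ^ 2) := by positivity
  have hσ : r / (1 + r ^ 2) ≤ 1 := by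
    rw [div_le_one (by positivity)]; nlinarith [sq_nonneg (r - 1)]
  have hin := abs_real_inner_le_norm v h
  have h1 : |2 * ε * (r / (1 + r ^ 2)) * inner ℝ v h| ≤ (‖v‖ ^ 2 + ‖h‖ ^ 2) / 2 := by
    rw [abs_mul, abs_of_nonneg (by positivity : 0 ≤ 2 * ε * (r / (1 + r ^ 2)))]
    calc _ ≤ (2 * (1 / 2) * 1) * (‖v‖ * ‖h‖) := by gcongr
      _ ≤ _ := by nlinarith [sq_nonneg (‖v‖ - ‖h‖)]
  have h2 := abs_le.mp h1
  have m1 : min (1 / 2) q.μ * (‖v‖ ^ 2 + ‖h‖ ^ 2) ≤ 1 / 2 * (‖v‖ ^ 2 + ‖h‖ ^ 2) := by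
    gcongr; exact min_le_left _ _
  have m2 : min (1 / 2) q.μ * ‖y‖ ^ 2 ≤ q.μ * ‖y‖ ^ 2 := by
    gcongr; exact min_le_right _ _
  unfold energy
  constructor
  · linarith [h2.1]
  · nlinarith [h2.2, mul_nonneg hμ.le (sq_nonneg ‖v‖), mul_nonneg hμ.le (sq_nonneg ‖h‖),
      sq_nonneg ‖v‖, sq_nonneg ‖h‖, sq_nonneg ‖y‖]

/-- The energy identity, with the forcing estimated. -/
theorem exists_energy_deriv_le (q : DampedWave) : ∃ ε c K : ℝ, 0 < ε ∧ ε ≤ 1 / 2 ∧ 0 < c ∧ 0 < K ∧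
    ∀ (r : ℝ) (fv fh fy v h y : ℝ → ℂ), 0 ≤ r → q.IsSolution r fv fh fy v h y →
      ∃ E' : ℝ → ℝ, ∀ t, HasDerivAt (fun t => q.energy ε r (v t) (h t) (y t)) (E' t) t ∧
        E' t ≤ -c * (r ^ 2 / (1 + r ^ 2)) * (‖v t‖ ^ 2 + ‖h t‖ ^ 2 + ‖y t‖ ^ 2) +
          K * (‖v t‖ + ‖h t‖ + ‖y t‖) * (‖fv t‖ + ‖fh t‖ + ‖fy t‖) := by
  obtain ⟨ε, c, hε, hε2, hc, hdis⟩ := q.exists_dissipation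
  have hμ := q.μ_pos
  -- The terms of order `r` coupling `v` and `h` cancel in the derivative of the squares. What
  -- remains without forcing is twice the form estimated in `exists_dissipation`, hence `2 * c`.
  refine ⟨ε, 2 * c, 2 * (2 + q.μ), hε, hε2, by positivity, by positivity,
    fun r fv fh fy v h y hr hsol => ?_⟩
  set σ := r / (1 + r ^ 2) with hσd
  have hσ0 : 0 ≤ σ := by positivity
  have hσ1 : σ ≤ 1 := by
    rw [hσd, div_le_one (by positivity)]; nlinarith [sq_nonneg (r - 1)]
  have hdv := hsol.deriv_v
  have hdh := hsol.deriv_h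
  have hdy := hsol.deriv_y
  refine ⟨_, fun t => ⟨(((((hdv t).norm_sq).add ((hdh t).norm_sq)).add
    (((hdy t).norm_sq).const_mul q.μ)).add (((hdv t).inner ℝ (hdh t)).const_mul
      (2 * ε * σ))), ?_⟩⟩
  have hs : ∀ (α : ℝ) (x : ℂ), ((α : ℝ) : ℂ) * x = α • x := fun α x => (Complex.real_smul).symm
  simp only [hs, inner_add_right, inner_sub_right, inner_add_left, inner_sub_left,
    inner_smul_right, inner_smul_left, real_inner_self_eq_norm_sq, RCLike.conj_to_real]
  rw [real_inner_comm (v t) (h t), real_inner_comm (v t) (y t)]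
  have hD := hdis r hr (v t) (h t) (y t)
  have c1 : ∀ x y : ℂ, inner ℝ x y ≤ ‖x‖ * ‖y‖ := fun x y => real_inner_le_norm x y
  have f1 := c1 (v t) (fv t)
  have f2 := c1 (h t) (fh t)
  have f3 := mul_le_mul_of_nonneg_left (c1 (y t) (fy t)) hμ.le
  have f4 : ε * σ * inner ℝ (fv t) (h t) ≤ 1 * (‖fv t‖ * ‖h t‖) := by
    calc _ ≤ ε * σ * (‖fv t‖ * ‖h t‖) := by gcongr; exact c1 _ _
      _ ≤ _ := by gcongr; nlinarith
  have f5 : ε * σ * inner ℝ (v t) (fh t) ≤ 1 * (‖v t‖ * ‖fh t‖) := by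
    calc _ ≤ ε * σ * (‖v t‖ * ‖fh t‖) := by gcongr; exact c1 _ _
      _ ≤ _ := by gcongr; nlinarith
  have hsum : ‖v t‖ * ‖fv t‖ + ‖h t‖ * ‖fh t‖ + q.μ * (‖y t‖ * ‖fy t‖) + ‖fv t‖ * ‖h t‖ +
      ‖v t‖ * ‖fh t‖ ≤ (2 + q.μ) * (‖v t‖ + ‖h t‖ + ‖y t‖) * (‖fv t‖ + ‖fh t‖ + ‖fy t‖) := by
    have n1 := norm_nonneg (v t)
    have n2 := norm_nonneg (h t)
    have n3 := norm_nonneg (y t)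
    have n4 := norm_nonneg (fv t)
    have n5 := norm_nonneg (fh t)
    have n6 := norm_nonneg (fy t)
    have : 0 ≤ (2 + q.μ) * (‖v t‖ + ‖h t‖ + ‖y t‖) * (‖fv t‖ + ‖fh t‖ + ‖fy t‖) -
      (‖v t‖ * ‖fv t‖ + ‖h t‖ * ‖fh t‖ + q.μ * (‖y t‖ * ‖fy t‖) + ‖fv t‖ * ‖h t‖ +
      ‖v t‖ * ‖fh t‖) := by
      ring_nf
      positivity
    linarith
  rw [← hσd] at hD
  linarith

/-- Exponential decay of the homogeneous system with rate `∼ r²/(1+r²)`. -/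
theorem exists_decay (q : DampedWave) : ∃ c C : ℝ, 0 < c ∧ 0 < C ∧
    ∀ (r : ℝ) (v h y : ℝ → ℂ), 0 ≤ r → q.IsSolution r 0 0 0 v h y → ∀ t, 0 ≤ t →
      ‖v t‖ ^ 2 + ‖h t‖ ^ 2 + ‖y t‖ ^ 2 ≤
        C * Real.exp (-(c * (r ^ 2 / (1 + r ^ 2)) * t)) *
          (‖v 0‖ ^ 2 + ‖h 0‖ ^ 2 + ‖y 0‖ ^ 2) := by
  obtain ⟨ε, c, K, hε, hε2, hc, hK, hE⟩ := q.exists_energy_deriv_le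
  have hμ := q.μ_pos
  have hm : 0 < min (1 / 2) q.μ := lt_min (by norm_num) hμ
  refine ⟨c / (2 + q.μ), (2 + q.μ) / min (1 / 2) q.μ, by positivity, by positivity,
    fun r v h y hr hsol t ht => ?_⟩
  obtain ⟨E', hE'⟩ := hE r 0 0 0 v h y hr hsol
  set ρ := r ^ 2 / (1 + r ^ 2) with hρ
  have hρ0 : 0 ≤ ρ := by positivity
  have hb := fun t => q.energy_bounds hε hε2 hr (v t) (h t) (y t)
  have h1 := le_exp_mul_of_deriv_le (k := c / (2 + q.μ) * ρ) (fun t => (hE' t).1)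
    (fun t _ => by
      have h2 := (hE' t).2
      simp only [Pi.zero_apply, norm_zero, add_zero, mul_zero] at h2
      refine h2.trans ?_
      have h3 := mul_le_mul_of_nonneg_left (hb t).2 (by positivity : 0 ≤ c / (2 + q.μ) * ρ)
      have h4 : c / (2 + q.μ) * ρ * ((2 + q.μ) * (‖v t‖ ^ 2 + ‖h t‖ ^ 2 + ‖y t‖ ^ 2))
        = c * ρ * (‖v t‖ ^ 2 + ‖h t‖ ^ 2 + ‖y t‖ ^ 2) := by field_simp
      linarith) ht
  rw [div_mul_eq_mul_div, div_mul_eq_mul_div, le_div_iff₀ hm]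
  calc _ = min (1 / 2) q.μ * (‖v t‖ ^ 2 + ‖h t‖ ^ 2 + ‖y t‖ ^ 2) := by ring
    _ ≤ _ := (hb t).1
    _ ≤ _ := h1
    _ ≤ Real.exp (-(c / (2 + q.μ) * ρ * t)) * ((2 + q.μ) *
        (‖v 0‖ ^ 2 + ‖h 0‖ ^ 2 + ‖y 0‖ ^ 2)) := by
      gcongr
      exact (hb 0).2
    _ = _ := by ring

/-- Low-frequency estimate for small data and small, diffusively decaying forcing. -/
theorem exists_forced_decay (q : DampedWave) {c₁ : ℝ} (hc₁ : 0 < c₁) : ∃ c C : ℝ, 0 < c ∧ 0 < C ∧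
    ∀ (r m : ℝ) (fv fh fy v h y : ℝ → ℂ), 0 ≤ r → r ≤ 1 → q.IsSolution r fv fh fy v h y →
      (∀ t, 0 ≤ t → (‖fv t‖ + ‖fh t‖ + ‖fy t‖) ^ 2 ≤ r ^ 6 * m ^ 2 * Real.exp (-(c₁ * r ^ 2 * t))) →
      ‖v 0‖ ^ 2 + ‖h 0‖ ^ 2 + ‖y 0‖ ^ 2 ≤ r ^ 2 * m ^ 2 →
      ∀ t, 0 ≤ t → ‖v t‖ ^ 2 + ‖h t‖ ^ 2 + ‖y t‖ ^ 2 ≤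
        C * r ^ 2 * m ^ 2 * Real.exp (-(c * r ^ 2 * t)) := by
  obtain ⟨ε, c, K, hε, hε2, hc, hK, hE⟩ := q.exists_energy_deriv_le
  have hμ := q.μ_pos
  have hm : 0 < min (1 / 2) q.μ := lt_min (by norm_num) hμ
  -- This is the constant from Young's inequality with weight `c r²/12`. As `(‖v‖+‖h‖+‖y‖)²` is at
  -- most three times the sum of squares, it uses `c r²/4` of the available dissipation `c r²/2`.
  set K₂ := 3 * K ^ 2 / c with hK₂
  have hK₂0 : 0 < K₂ := by positivity
  set k := min (c / (4 * (2 + q.μ))) (c₁ / 2) with hk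
  have hk0 : 0 < k := lt_min (by positivity) (by positivity)
  refine ⟨k, (2 + q.μ + 2 * K₂ / c₁) / min (1 / 2) q.μ, hk0, by positivity,
    fun r m fv fh fy v h y hr hr1 hsol hf h0 t ht => ?_⟩
  obtain ⟨E', hE'⟩ := hE r fv fh fy v h y hr hsol
  have hb := fun t => q.energy_bounds hε hε2 hr (v t) (h t) (y t)
  -- The forcing contributes at most `K₂ r⁴ m² exp(-c₁ r² t)` to the derivative. The added term
  -- decreases at twice this rate: one half cancels the forcing, the other half keeps the sum
  -- decaying, since `k ≤ c₁ / 2`.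
  have hd : ∀ t, HasDerivAt (fun t => q.energy ε r (v t) (h t) (y t) +
      2 * K₂ / c₁ * (r ^ 2 * m ^ 2 * Real.exp (-(c₁ * r ^ 2 * t))))
      (E' t + 2 * K₂ / c₁ * (r ^ 2 * m ^ 2 * (Real.exp (-(c₁ * r ^ 2 * t)) * -(c₁ * r ^ 2)))) t := by
    intro t
    have h1 : HasDerivAt (fun t => Real.exp (-(c₁ * r ^ 2 * t)))
        (Real.exp (-(c₁ * r ^ 2 * t)) * -(c₁ * r ^ 2)) t := by
      simpa using (((hasDerivAt_id t).const_mul (c₁ * r ^ 2)).neg).exp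
    exact (hE' t).1.add ((h1.const_mul _).const_mul _)
  have h1 := le_exp_mul_of_deriv_le (k := k * r ^ 2) hd (fun t ht => by
    have h2 := (hE' t).2
    set N := ‖v t‖ ^ 2 + ‖h t‖ ^ 2 + ‖y t‖ ^ 2 with hN
    set X := Real.exp (-(c₁ * r ^ 2 * t)) with hX
    have hX0 : 0 < X := Real.exp_pos _
    have hN0 : 0 ≤ N := by positivity
    have hρ : r ^ 2 / 2 ≤ r ^ 2 / (1 + r ^ 2) := by
      gcongr
      nlinarith
    have h3 : -c * (r ^ 2 / (1 + r ^ 2)) * N ≤ -(c / 2) * r ^ 2 * N := by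
      have := mul_le_mul_of_nonneg_left hρ (by positivity : 0 ≤ c * N)
      linarith
    have h4 : K * (‖v t‖ + ‖h t‖ + ‖y t‖) * (‖fv t‖ + ‖fh t‖ + ‖fy t‖) ≤
        c / 4 * r ^ 2 * N + K₂ * r ^ 4 * m ^ 2 * X := by
      set S := ‖v t‖ + ‖h t‖ + ‖y t‖ with hS
      set f := ‖fv t‖ + ‖fh t‖ + ‖fy t‖ with hfd
      have hS3 : S ^ 2 ≤ 3 * N := by
        rw [hS, hN]
        nlinarith [sq_nonneg (‖v t‖ - ‖h t‖), sq_nonneg (‖v t‖ - ‖y t‖),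
          sq_nonneg (‖h t‖ - ‖y t‖)]
      have hft := hf t ht
      rw [← hfd] at hft
      -- Young's inequality divides by `r²`. At `r = 0` the forcing bound itself gives zero.
      rcases hr.eq_or_lt with hr0 | hr0
      · have hf0 : f = 0 := by
          have : f ^ 2 ≤ 0 := by rw [← hr0] at hft; simpa using hft
          exact pow_eq_zero_iff (two_ne_zero) |>.mp (le_antisymm this (sq_nonneg _))
        rw [hf0, mul_zero]
        positivity
      · have a1 : K * S * f ≤ c / 12 * r ^ 2 * S ^ 2 + 3 * K ^ 2 / (c * r ^ 2) * f ^ 2 := by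
          have e1 : c / 12 * r ^ 2 * S ^ 2 + 3 * K ^ 2 / (c * r ^ 2) * f ^ 2 - K * S * f
              = (c * r ^ 2 * S - 6 * K * f) ^ 2 / (12 * (c * r ^ 2)) := by
            field_simp; ring
          have e2 : 0 ≤ (c * r ^ 2 * S - 6 * K * f) ^ 2 / (12 * (c * r ^ 2)) := by positivity
          linarith
        have a2 : c / 12 * r ^ 2 * S ^ 2 ≤ c / 12 * r ^ 2 * (3 * N) := by gcongr
        have a3 : 3 * K ^ 2 / (c * r ^ 2) * f ^ 2 ≤ 3 * K ^ 2 / (c * r ^ 2) *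
            (r ^ 6 * m ^ 2 * X) := by gcongr
        have a4 : 3 * K ^ 2 / (c * r ^ 2) * (r ^ 6 * m ^ 2 * X) = K₂ * r ^ 4 * m ^ 2 * X := by
          rw [hK₂]; field_simp
        linarith
    have h5 : 2 * K₂ / c₁ * (r ^ 2 * m ^ 2 * (X * -(c₁ * r ^ 2))) = -(2 * K₂) * r ^ 4 * m ^ 2 * X := by
      field_simp
    rw [h5]
    have h6 : k * r ^ 2 * q.energy ε r (v t) (h t) (y t) ≤ c / 4 * r ^ 2 * N := by
      calc _ ≤ c / (4 * (2 + q.μ)) * r ^ 2 * ((2 + q.μ) * N) := by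
            have := (hb t).2
            have h7 : 0 ≤ q.energy ε r (v t) (h t) (y t) :=
              le_trans (by positivity) (hb t).1
            gcongr
            exact min_le_left _ _
        _ = _ := by field_simp
    have h8 : k * r ^ 2 * (2 * K₂ / c₁ * (r ^ 2 * m ^ 2 * X)) ≤ K₂ * r ^ 4 * m ^ 2 * X := by
      calc _ ≤ c₁ / 2 * r ^ 2 * (2 * K₂ / c₁ * (r ^ 2 * m ^ 2 * X)) := by
            gcongr
            exact min_le_right _ _
        _ = _ := by field_simp
    have h9 : 0 ≤ K₂ * r ^ 4 * m ^ 2 * X := by positivity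
    linarith) ht
  have hx : 0 ≤ 2 * K₂ / c₁ * (r ^ 2 * m ^ 2 * Real.exp (-(c₁ * r ^ 2 * t))) := by positivity
  have hy : q.energy ε r (v 0) (h 0) (y 0) ≤ (2 + q.μ) * (r ^ 2 * m ^ 2) :=
    (hb 0).2.trans (by gcongr)
  rw [div_mul_eq_mul_div, div_mul_eq_mul_div, div_mul_eq_mul_div, le_div_iff₀ hm]
  calc _ = min (1 / 2) q.μ * (‖v t‖ ^ 2 + ‖h t‖ ^ 2 + ‖y t‖ ^ 2) := by ring
    _ ≤ q.energy ε r (v t) (h t) (y t) := (hb t).1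
    _ ≤ q.energy ε r (v t) (h t) (y t) +
      2 * K₂ / c₁ * (r ^ 2 * m ^ 2 * Real.exp (-(c₁ * r ^ 2 * t))) := le_add_of_nonneg_right hx
    _ ≤ Real.exp (-(k * r ^ 2 * t)) * ((2 + q.μ) * (r ^ 2 * m ^ 2) +
      2 * K₂ / c₁ * (r ^ 2 * m ^ 2 * 1)) := by
      refine h1.trans ?_
      rw [mul_zero, neg_zero, Real.exp_zero]
      gcongr
    _ = _ := by ring

end DampedWave

/-! ### Matrix exponentials, their time integrals and the multipliers they define. -/

/-- The symbol `r B₁ + r² B₂`. -/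
noncomputable def symbolOf (B₁ B₂ : (Fin 3 → ℂ) →L[ℂ] (Fin 3 → ℂ)) (r : ℝ) :
    (Fin 3 → ℂ) →L[ℂ] (Fin 3 → ℂ) := r • B₁ + r ^ 2 • B₂

/-- The propagator of `x' = (r B₁ + r² B₂) x`. -/
noncomputable def propagator (B₁ B₂ : (Fin 3 → ℂ) →L[ℂ] (Fin 3 → ℂ)) (t r : ℝ) :
    (Fin 3 → ℂ) →L[ℂ] (Fin 3 → ℂ) := NormedSpace.exp (t • symbolOf B₁ B₂ r)

/-- The time integral of the propagator. -/
noncomputable def propagatorIntegral (B₁ B₂ : (Fin 3 → ℂ) →L[ℂ] (Fin 3 → ℂ)) (t r : ℝ) :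
    (Fin 3 → ℂ) →L[ℂ] (Fin 3 → ℂ) := ∫ τ in (0 : ℝ)..t, propagator B₁ B₂ τ r

section Propagator

variable (B₁ B₂ : (Fin 3 → ℂ) →L[ℂ] (Fin 3 → ℂ))

theorem continuous_symbolOf : Continuous (symbolOf B₁ B₂) := by
  unfold symbolOf; fun_prop

theorem norm_symbolOf_le (r : ℝ) :
    ‖symbolOf B₁ B₂ r‖ ≤ (‖B₁‖ + ‖B₂‖) * (1 + r ^ 2) := by
  have h1 : |r| ≤ 1 + r ^ 2 := by
    rw [← sq_abs]; nlinarith [sq_nonneg (|r| - 1), abs_nonneg r]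
  calc ‖symbolOf B₁ B₂ r‖ ≤ ‖r • B₁‖ + ‖r ^ 2 • B₂‖ := norm_add_le _ _
    _ = |r| * ‖B₁‖ + r ^ 2 * ‖B₂‖ := by
      rw [norm_smul, norm_smul, Real.norm_eq_abs, Real.norm_of_nonneg (sq_nonneg r)]
    _ ≤ (1 + r ^ 2) * ‖B₁‖ + (1 + r ^ 2) * ‖B₂‖ := by gcongr; linarith
    _ = _ := by ring

theorem continuous_propagator :
    Continuous (fun p : ℝ × ℝ => propagator B₁ B₂ p.1 p.2) := by
  have h := continuous_symbolOf B₁ B₂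
  have h2 : Continuous (fun p : ℝ × ℝ => p.1 • symbolOf B₁ B₂ p.2) := by fun_prop
  have h3 : Continuous (NormedSpace.exp :
      ((Fin 3 → ℂ) →L[ℂ] (Fin 3 → ℂ)) → ((Fin 3 → ℂ) →L[ℂ] (Fin 3 → ℂ))) :=
    letI : NormedAlgebra ℚ ((Fin 3 → ℂ) →L[ℂ] (Fin 3 → ℂ)) := .restrictScalars ℚ ℂ _
    NormedSpace.exp_continuous
  exact h3.comp h2

theorem hasDerivAt_propagator (t r : ℝ) :
    HasDerivAt (fun t => propagator B₁ B₂ t r) (symbolOf B₁ B₂ r * propagator B₁ B₂ t r) t :=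
  hasDerivAt_exp_smul_const' (symbolOf B₁ B₂ r) t

@[simp]
theorem propagator_zero (r : ℝ) : propagator B₁ B₂ 0 r = 1 := by
  rw [propagator, zero_smul ℝ (symbolOf B₁ B₂ r), NormedSpace.exp_zero]

theorem hasDerivAt_propagator_apply (r : ℝ) (x : Fin 3 → ℂ) (t : ℝ) :
    HasDerivAt (fun t => propagator B₁ B₂ t r x)
      (symbolOf B₁ B₂ r (propagator B₁ B₂ t r x)) t :=
  ((ContinuousLinearMap.apply ℂ (Fin 3 → ℂ) x).restrictScalars ℝ).hasFDerivAt.comp_hasDerivAt t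
    (hasDerivAt_propagator B₁ B₂ t r)

theorem continuous_propagatorIntegral (t : ℝ) :
    Continuous (fun r => propagatorIntegral B₁ B₂ t r) :=
  intervalIntegral.continuous_parametric_intervalIntegral_of_continuous'
    (f := fun r τ => propagator B₁ B₂ τ r)
    ((continuous_propagator B₁ B₂).comp continuous_swap) 0 t

theorem hasDerivAt_propagatorIntegral (t r : ℝ) :
    HasDerivAt (fun t => propagatorIntegral B₁ B₂ t r) (propagator B₁ B₂ t r) t := by
  have hc : Continuous (fun t => propagator B₁ B₂ t r) :=
    (continuous_propagator B₁ B₂).comp (by fun_prop : Continuous fun t : ℝ => (t, r))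
  exact intervalIntegral.integral_hasDerivAt_right (hc.intervalIntegrable 0 t)
    (hc.stronglyMeasurableAtFilter volume (𝓝 t)) hc.continuousAt

/-- The integrated form of the ODE. It expresses the change of `|D|φ` through the time integral of
the flow, which is needed to identify `|D|φ(t)`. -/
theorem propagator_sub_one (t r : ℝ) :
    propagator B₁ B₂ t r - 1 = symbolOf B₁ B₂ r * propagatorIntegral B₁ B₂ t r := by
  have hc : Continuous (fun t => propagator B₁ B₂ t r) :=
    (continuous_propagator B₁ B₂).comp (by fun_prop : Continuous fun t : ℝ => (t, r))
  have h := intervalIntegral.integral_eq_sub_of_hasDerivAt (a := 0) (b := t)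
    (fun τ _ => hasDerivAt_propagator B₁ B₂ τ r)
    ((continuous_const.mul hc).intervalIntegrable 0 t)
  rw [propagator_zero] at h
  rw [← h]
  exact (ContinuousLinearMap.compL ℂ (Fin 3 → ℂ) (Fin 3 → ℂ) (Fin 3 → ℂ)
    (symbolOf B₁ B₂ r)).intervalIntegral_comp_comm (hc.intervalIntegrable 0 t)

variable {B₁ B₂}

theorem norm_propagatorIntegral_le {C : ℝ}
    (hC : ∀ t r, 0 ≤ t → 0 ≤ r → ‖propagator B₁ B₂ t r‖ ≤ C) {t r : ℝ} (ht : 0 ≤ t) (hr : 0 ≤ r) :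
    ‖propagatorIntegral B₁ B₂ t r‖ ≤ C * t := by
  have := intervalIntegral.norm_integral_le_of_norm_le_const (a := 0) (b := t) (C := C)
    (f := fun τ => propagator B₁ B₂ τ r) fun τ hτ => by
      rw [uIoc_of_le ht] at hτ
      exact hC τ r hτ.1.le hr
  rwa [sub_zero, abs_of_nonneg ht] at this

variable {n : ℕ}

/-- The solution operator of `F_t = (B₁ |D| + B₂ |D|²) F`. -/
noncomputable def evolution (B₁ B₂ : (Fin 3 → ℂ) →L[ℂ] (Fin 3 → ℂ)) (F₀ : Fin 3 → L2 n) (t : ℝ) :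
    Fin 3 → L2 n := applySymbol (fun ξ => propagator B₁ B₂ t (2 * Real.pi * ‖ξ‖)) F₀

theorem continuous_frequency : Continuous (fun ξ : Rn n => 2 * Real.pi * ‖ξ‖) := by fun_prop

theorem hat_evolution_ae {C : ℝ} (hC : ∀ t r, 0 ≤ t → 0 ≤ r → ‖propagator B₁ B₂ t r‖ ≤ C)
    (F₀ : Fin 3 → L2 n) {t : ℝ} (ht : 0 ≤ t) :
    ∀ᵐ ξ, hat (evolution B₁ B₂ F₀ t) ξ = propagator B₁ B₂ t (2 * Real.pi * ‖ξ‖) (hat F₀ ξ) :=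
  hat_applySymbol_ae ((continuous_propagator B₁ B₂).comp
    (by fun_prop : Continuous fun ξ : Rn n => (t, 2 * Real.pi * ‖ξ‖)))
    (fun _ => hC _ _ ht (by positivity)) F₀

theorem evolution_zero {C : ℝ} (hC : ∀ t r, 0 ≤ t → 0 ≤ r → ‖propagator B₁ B₂ t r‖ ≤ C)
    (F₀ : Fin 3 → L2 n) : evolution B₁ B₂ F₀ 0 = F₀ := by
  refine eq_of_hat_ae_eq ?_
  filter_upwards [hat_evolution_ae hC F₀ le_rfl] with ξ hξ
  rw [hξ, propagator_zero]
  rfl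

theorem continuousInSobolev_evolution {C s : ℝ} (hs : 0 ≤ s)
    (hC : ∀ t r, 0 ≤ t → 0 ≤ r → ‖propagator B₁ B₂ t r‖ ≤ C)
    {F₀ : Fin 3 → L2 n} (hF : InSobolev s F₀) : ContinuousInSobolev s (evolution B₁ B₂ F₀) :=
  continuousInSobolev_of_symbol hs hF (K := fun t ξ => propagator B₁ B₂ t (2 * Real.pi * ‖ξ‖))
    (fun t ht ξ => hC t _ ht (by positivity))
    (fun ξ => (continuous_propagator B₁ B₂).comp
      (by fun_prop : Continuous fun t : ℝ => (t, 2 * Real.pi * ‖ξ‖)))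
    (fun _ ht => hat_evolution_ae hC F₀ ht)

theorem one_add_frequency_sq_le (ξ : Rn n) :
    1 + (2 * Real.pi * ‖ξ‖) ^ 2 ≤ (2 * Real.pi) ^ 2 * (1 + ‖ξ‖ ^ 2) := by
  have hpi : 1 ≤ (2 * Real.pi) ^ 2 := by nlinarith [Real.pi_gt_three]
  rw [mul_pow]; linarith

theorem hasDerivAt_evolution_pairing {C : ℝ}
    (hC : ∀ t r, 0 ≤ t → 0 ≤ r → ‖propagator B₁ B₂ t r‖ ≤ C)
    (F₀ : Fin 3 → L2 n) {t : ℝ} (ht : 0 < t) (i : Fin 3) (ψ : 𝓢(Rn n, ℂ)) :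
    HasDerivAt (fun τ => ∫ ξ, (𝓕 (evolution B₁ B₂ F₀ τ i) : L2 n) ξ * ψ ξ)
      (∫ ξ, symbolOf B₁ B₂ (2 * Real.pi * ‖ξ‖) (hat (evolution B₁ B₂ F₀ t) ξ) i * ψ ξ) t := by
  have hC0 : 0 ≤ C := (norm_nonneg _).trans (hC 0 0 le_rfl le_rfl)
  have hsym : ∀ ξ : Rn n, ‖symbolOf B₁ B₂ (2 * Real.pi * ‖ξ‖)‖ ≤
      (‖B₁‖ + ‖B₂‖) * ((2 * Real.pi) ^ 2 * (1 + ‖ξ‖ ^ 2)) := fun ξ =>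
    (norm_symbolOf_le B₁ B₂ _).trans (by gcongr; exact one_add_frequency_sq_le ξ)
  set C' := C + (‖B₁‖ + ‖B₂‖) * (2 * Real.pi) ^ 2 * C with hC'
  have h2 : ∀ τ, Continuous fun ξ : Rn n => propagator B₁ B₂ τ (2 * Real.pi * ‖ξ‖) := fun τ =>
    (continuous_propagator B₁ B₂).comp
      (by fun_prop : Continuous fun ξ : Rn n => (τ, 2 * Real.pi * ‖ξ‖))
  have h3 : Continuous fun ξ : Rn n => symbolOf B₁ B₂ (2 * Real.pi * ‖ξ‖) :=
    (continuous_symbolOf B₁ B₂).comp continuous_frequency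
  have h := hasDerivAt_symbol_pairing (C := C') ht (lt_add_one t)
    (K := fun t ξ => propagator B₁ B₂ t (2 * Real.pi * ‖ξ‖))
    (K' := fun t ξ => symbolOf B₁ B₂ (2 * Real.pi * ‖ξ‖) * propagator B₁ B₂ t (2 * Real.pi * ‖ξ‖))
    h2 (fun τ => h3.mul (h2 τ)) (fun τ _ ξ => hasDerivAt_propagator B₁ B₂ τ _)
    (fun τ hτ ξ => by
      refine (hC τ _ hτ.1.le (by positivity)).trans ?_
      have h1 : C ≤ C' := le_add_of_nonneg_right (by positivity)
      have h2 : 0 ≤ C' := hC0.trans h1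
      nlinarith [mul_nonneg h2 (sq_nonneg ‖ξ‖)])
    (fun τ hτ ξ => by
      refine (norm_mul_le _ _).trans ?_
      calc _ ≤ (‖B₁‖ + ‖B₂‖) * ((2 * Real.pi) ^ 2 * (1 + ‖ξ‖ ^ 2)) * C := by
            gcongr
            · exact hsym ξ
            · exact hC τ _ hτ.1.le (by positivity)
        _ = (‖B₁‖ + ‖B₂‖) * (2 * Real.pi) ^ 2 * C * (1 + ‖ξ‖ ^ 2) := by ring
        _ ≤ _ := by
          gcongr
          exact le_add_of_nonneg_left hC0)
    (fun τ hτ => hat_evolution_ae hC F₀ hτ) i ψ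
  convert h using 1
  refine integral_congr_ae ?_
  filter_upwards [hat_evolution_ae hC F₀ ht.le] with ξ hξ
  rw [hξ]
  rfl

/-- The time integral of the evolution. -/
noncomputable def evolutionIntegral (B₁ B₂ : (Fin 3 → ℂ) →L[ℂ] (Fin 3 → ℂ)) (F₀ : Fin 3 → L2 n)
    (t : ℝ) : Fin 3 → L2 n :=
  applySymbol (fun ξ => propagatorIntegral B₁ B₂ t (2 * Real.pi * ‖ξ‖)) F₀

theorem hat_evolutionIntegral_ae {C : ℝ}
    (hC : ∀ t r, 0 ≤ t → 0 ≤ r → ‖propagator B₁ B₂ t r‖ ≤ C)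
    (F₀ : Fin 3 → L2 n) {t : ℝ} (ht : 0 ≤ t) :
    ∀ᵐ ξ, hat (evolutionIntegral B₁ B₂ F₀ t) ξ
      = propagatorIntegral B₁ B₂ t (2 * Real.pi * ‖ξ‖) (hat F₀ ξ) :=
  hat_applySymbol_ae ((continuous_propagatorIntegral B₁ B₂ t).comp continuous_frequency)
    (fun _ => norm_propagatorIntegral_le hC ht (by positivity)) F₀

theorem evolutionIntegral_zero {C : ℝ}
    (hC : ∀ t r, 0 ≤ t → 0 ≤ r → ‖propagator B₁ B₂ t r‖ ≤ C) (F₀ : Fin 3 → L2 n) :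
    evolutionIntegral B₁ B₂ F₀ 0 = 0 := by
  refine eq_of_hat_ae_eq ?_
  filter_upwards [hat_evolutionIntegral_ae hC F₀ le_rfl,
    hat_sub_ae (0 : Fin 3 → L2 n) 0] with ξ hξ h2
  rw [sub_zero, sub_self] at h2
  rw [hξ, h2]
  simp [propagatorIntegral]

theorem hasDerivAt_evolutionIntegral_pairing {C : ℝ}
    (hC : ∀ t r, 0 ≤ t → 0 ≤ r → ‖propagator B₁ B₂ t r‖ ≤ C)
    (F₀ : Fin 3 → L2 n) {t : ℝ} (ht : 0 < t) (i : Fin 3) (ψ : 𝓢(Rn n, ℂ)) :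
    HasDerivAt (fun τ => ∫ ξ, (𝓕 (evolutionIntegral B₁ B₂ F₀ τ i) : L2 n) ξ * ψ ξ)
      (∫ ξ, (𝓕 (evolution B₁ B₂ F₀ t i) : L2 n) ξ * ψ ξ) t := by
  have hC0 : 0 ≤ C := (norm_nonneg _).trans (hC 0 0 le_rfl le_rfl)
  have h2 : ∀ τ, Continuous fun ξ : Rn n => propagator B₁ B₂ τ (2 * Real.pi * ‖ξ‖) := fun τ =>
    (continuous_propagator B₁ B₂).comp
      (by fun_prop : Continuous fun ξ : Rn n => (τ, 2 * Real.pi * ‖ξ‖))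
  have h := hasDerivAt_symbol_pairing (C := C * (t + 2)) ht (lt_add_one t)
    (K := fun t ξ => propagatorIntegral B₁ B₂ t (2 * Real.pi * ‖ξ‖))
    (K' := fun t ξ => propagator B₁ B₂ t (2 * Real.pi * ‖ξ‖))
    (fun τ => (continuous_propagatorIntegral B₁ B₂ τ).comp continuous_frequency) h2
    (fun τ _ ξ => hasDerivAt_propagatorIntegral B₁ B₂ τ _)
    (fun τ hτ ξ => by
      refine (norm_propagatorIntegral_le hC hτ.1.le (by positivity)).trans ?_
      calc C * τ ≤ C * (t + 2) * 1 := by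
            rw [mul_one]; gcongr; linarith [hτ.2]
        _ ≤ _ := by gcongr; nlinarith [sq_nonneg ‖ξ‖])
    (fun τ hτ ξ => by
      refine (hC τ _ hτ.1.le (by positivity)).trans ?_
      calc C = C * 1 * 1 := by ring
        _ ≤ _ := by gcongr <;> nlinarith [sq_nonneg ‖ξ‖])
    (fun τ hτ => hat_evolutionIntegral_ae hC F₀ hτ) i ψ
  convert h using 1
  refine integral_congr_ae ?_
  filter_upwards [hat_evolution_ae hC F₀ ht.le] with ξ hξ
  rw [← hξ]
  rfl

/-- The integrated propagator grows linearly in time. Freezing the time at `T` makes it uniformly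
bounded, so that `continuousInSobolev_of_symbol` applies. -/
theorem continuousOn_evolutionIntegral {C s : ℝ} (hs : 0 ≤ s)
    (hC : ∀ t r, 0 ≤ t → 0 ≤ r → ‖propagator B₁ B₂ t r‖ ≤ C)
    {F₀ : Fin 3 → L2 n} (hF : InSobolev s F₀) {T : ℝ} (hT : 0 ≤ T) (i : Fin 3) :
    ContinuousOn (fun t => evolutionIntegral B₁ B₂ F₀ t i) (Icc 0 T) := by
  have hC0 : 0 ≤ C := (norm_nonneg _).trans (hC 0 0 le_rfl le_rfl)
  have hcont : ContinuousInSobolev s (fun t => evolutionIntegral B₁ B₂ F₀ (min t T)) := by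
    refine continuousInSobolev_of_symbol hs hF (C := C * T)
      (K := fun t ξ => propagatorIntegral B₁ B₂ (min t T) (2 * Real.pi * ‖ξ‖))
      (fun t ht ξ => ?_) (fun ξ => ?_)
      (fun t ht => hat_evolutionIntegral_ae hC F₀ (le_min ht hT))
    · refine (norm_propagatorIntegral_le hC (le_min ht hT) (by positivity)).trans ?_
      gcongr
      exact min_le_right _ _
    · have h1 : Continuous fun t => propagatorIntegral B₁ B₂ t (2 * Real.pi * ‖ξ‖) :=
        continuous_iff_continuousAt.mpr fun t =>
          (hasDerivAt_propagatorIntegral B₁ B₂ t _).continuousAt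
      exact h1.comp (by fun_prop)
  refine ((hcont.continuousOn hs i).mono Icc_subset_Ici_self).congr fun t ht => ?_
  simp only [min_eq_left ht.2]

end Propagator

theorem propagator_zero_apply (B₁ B₂ : (Fin 3 → ℂ) →L[ℂ] (Fin 3 → ℂ)) (r : ℝ) (x : Fin 3 → ℂ) :
    propagator B₁ B₂ 0 r x = x := by
  rw [propagator_zero]; rfl

/-! ### The acoustic system in velocity, potential and entropy coordinates. -/

namespace AcousticParams

variable (p : AcousticParams)

/-- The viscosity coefficient `(1 + β) ν₀`. -/
noncomputable def visc : ℝ := (1 + p.β) * p.ν0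

/-- The coefficient `α_p γ c₀² D_th` of the heat flux in the momentum equation. -/
noncomputable def flux : ℝ := p.αp * p.speed ^ 2 * p.Dth

/-- The coefficient `ε` for which `T + ε φ_t` is conserved to leading order. -/
noncomputable def entropyCoeff : ℝ := (p.γ - 1) / (p.αp * p.speed ^ 2)

theorem γ_pos : 0 < p.γ := by linarith [p.γ_gt]

theorem speed_pos : 0 < p.speed := mul_pos (Real.sqrt_pos.mpr p.γ_pos) p.c0_pos

theorem speed_sq : p.speed ^ 2 = p.γ * p.c0 ^ 2 := by
  rw [speed, mul_pow, Real.sq_sqrt p.γ_pos.le]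

theorem visc_pos : 0 < p.visc := mul_pos (by linarith [p.β_gt]) p.ν0_pos

theorem flux_pos : 0 < p.flux :=
  mul_pos (mul_pos p.αp_pos (pow_pos p.speed_pos 2)) p.Dth_pos

theorem entropyCoeff_pos : 0 < p.entropyCoeff :=
  div_pos (by linarith [p.γ_gt]) (mul_pos p.αp_pos (pow_pos p.speed_pos 2))

theorem entropyCoeff_mul_speed_sq : p.entropyCoeff * p.speed ^ 2 = (p.γ - 1) / p.αp := by
  have := p.speed_pos.ne'
  have := p.αp_pos.ne'
  rw [entropyCoeff]; field_simp

theorem flux_mul_entropyCoeff : p.flux * p.entropyCoeff = (p.γ - 1) * p.Dth := by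
  have := p.speed_pos.ne'
  have := p.αp_pos.ne'
  rw [entropyCoeff, flux]; field_simp

theorem two_mul_Γ0 : 2 * p.Γ0 = p.visc + p.flux * p.entropyCoeff := by
  rw [flux_mul_entropyCoeff, Γ0, visc]; ring

/-- This relation fits `U₁` to the entropy coordinate: in `T + ε φ_t` the contributions of the two
acoustic modes cancel, leaving only the thermal mode (`entropyCoord_U1`). -/
theorem κ_mul_entropyCoeff : p.κ * p.entropyCoeff = -2 := by
  have := p.c0_pos.ne'
  have := p.γ_pos.ne'
  have := p.αp_pos.ne'
  have : p.γ - 1 ≠ 0 := by linarith [p.γ_gt]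
  rw [entropyCoeff, κ, speed_sq]; field_simp

theorem κ_ne_zero : p.κ ≠ 0 := by
  intro h
  have := p.κ_mul_entropyCoeff
  rw [h] at this
  norm_num at this

theorem Γ0_pos : 0 < p.Γ0 := by
  have := p.two_mul_Γ0
  have := p.visc_pos
  have := mul_pos p.flux_pos p.entropyCoeff_pos
  linarith

/-- The system at a fixed frequency, in the variables (velocity, potential, entropy). -/
noncomputable def dampedWave : DampedWave where
  a := p.speed
  Γ := p.Γ0
  e := p.flux
  D := p.Dth
  δ := p.entropyCoeff * (p.visc - p.Dth)
  -- With this weight `e - μ δ` equals `2 flux Dth / (visc + Dth)`, and the discriminant condition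
  -- becomes `(γ-1) Dth² < (visc + (γ-1) Dth)(visc + Dth)`, which holds for positive `visc` and
  -- `Dth` and `γ > 1`.
  μ := p.flux / (p.entropyCoeff * (p.visc + p.Dth))
  a_pos := p.speed_pos
  Γ_pos := p.Γ0_pos
  D_pos := p.Dth_pos
  μ_pos := div_pos p.flux_pos (mul_pos p.entropyCoeff_pos (add_pos p.visc_pos p.Dth_pos))
  discr := by
    have hb := p.visc_pos
    have hD := p.Dth_pos
    have hk := p.entropyCoeff_pos
    have he := p.flux_pos
    have hγ := p.γ_gt
    have h1 : p.flux - p.flux / (p.entropyCoeff * (p.visc + p.Dth)) *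
        (p.entropyCoeff * (p.visc - p.Dth)) = p.flux * (2 * p.Dth / (p.visc + p.Dth)) := by
      field_simp; ring
    have h2 : 8 * p.Γ0 * p.Dth * (p.flux / (p.entropyCoeff * (p.visc + p.Dth)))
        = 4 * (p.visc + (p.γ - 1) * p.Dth) * p.Dth * p.flux /
          (p.entropyCoeff * (p.visc + p.Dth)) := by
      rw [← p.flux_mul_entropyCoeff, ← p.two_mul_Γ0]; ring
    rw [h1, h2, lt_div_iff₀ (by positivity)]
    have h3 : (p.flux * (2 * p.Dth / (p.visc + p.Dth))) ^ 2 *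
        (p.entropyCoeff * (p.visc + p.Dth)) =
        (p.flux * p.entropyCoeff) * p.flux * (4 * p.Dth ^ 2) / (p.visc + p.Dth) := by
      field_simp; ring
    rw [h3, p.flux_mul_entropyCoeff, div_lt_iff₀ (by positivity)]
    have h4 : (p.γ - 1) * p.Dth ^ 2 < (p.visc + (p.γ - 1) * p.Dth) * (p.visc + p.Dth) := by
      nlinarith [mul_pos hb hb, mul_pos hb hD, mul_pos (mul_pos (sub_pos.mpr hγ) hD) hb]
    calc _ = 4 * p.Dth * p.flux * ((p.γ - 1) * p.Dth ^ 2) := by ring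
      _ < 4 * p.Dth * p.flux * ((p.visc + (p.γ - 1) * p.Dth) * (p.visc + p.Dth)) := by gcongr
      _ = _ := by ring

/-- The operator on `ℂ³` given by a matrix. -/
noncomputable def _root_.matrixCLM (A : Matrix (Fin 3) (Fin 3) ℂ) :
    (Fin 3 → ℂ) →L[ℂ] (Fin 3 → ℂ) := (Matrix.toLin' A).toContinuousLinearMap

theorem _root_.matrixCLM_apply (A : Matrix (Fin 3) (Fin 3) ℂ) (x : Fin 3 → ℂ) :
    matrixCLM A x = A.mulVec x := rfl

/-- First-order part of the symbol of the energy system. -/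
noncomputable def waveSymbol : (Fin 3 → ℂ) →L[ℂ] (Fin 3 → ℂ) :=
  matrixCLM !![Complex.I * (p.speed : ℂ), 0, 0; 0, -(Complex.I * (p.speed : ℂ)), 0;
    -(Complex.I * ((p.entropyCoeff * p.speed / 2 : ℝ) : ℂ)),
    Complex.I * ((p.entropyCoeff * p.speed / 2 : ℝ) : ℂ), 0]

/-- Second-order part of the symbol of the energy system. -/
noncomputable def dampSymbol : (Fin 3 → ℂ) →L[ℂ] (Fin 3 → ℂ) :=
  matrixCLM !![-((p.visc / 2 : ℝ) : ℂ), -((p.visc / 2 : ℝ) : ℂ), (p.flux : ℂ);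
    -((p.visc / 2 : ℝ) : ℂ), -((p.visc / 2 : ℝ) : ℂ), (p.flux : ℂ);
    0, 0, -((p.γ * p.Dth : ℝ) : ℂ)]

/-- First-order part of the symbol of the reference system. -/
noncomputable def refWaveSymbol : (Fin 3 → ℂ) →L[ℂ] (Fin 3 → ℂ) :=
  matrixCLM (Matrix.diagonal fun j => -p.waveCoeff j)

/-- Second-order part of the symbol of the reference system. -/
noncomputable def refDampSymbol : (Fin 3 → ℂ) →L[ℂ] (Fin 3 → ℂ) :=
  matrixCLM (Matrix.diagonal fun j => -p.diffCoeff j)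

theorem symbol_apply_zero (r : ℝ) (x : Fin 3 → ℂ) :
    symbolOf p.waveSymbol p.dampSymbol r x 0 = Complex.I * p.speed * r * x 0 -
      (p.visc / 2) * r ^ 2 * (x 0 + x 1) + p.flux * r ^ 2 * x 2 := by
  simp [symbolOf, waveSymbol, dampSymbol, matrixCLM_apply, dotProduct,
    Fin.sum_univ_three]
  ring

theorem symbol_apply_one (r : ℝ) (x : Fin 3 → ℂ) :
    symbolOf p.waveSymbol p.dampSymbol r x 1 = -Complex.I * p.speed * r * x 1 -
      (p.visc / 2) * r ^ 2 * (x 0 + x 1) + p.flux * r ^ 2 * x 2 := by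
  simp [symbolOf, waveSymbol, dampSymbol, matrixCLM_apply, dotProduct,
    Fin.sum_univ_three]
  ring

theorem symbol_apply_two (r : ℝ) (x : Fin 3 → ℂ) :
    symbolOf p.waveSymbol p.dampSymbol r x 2 =
      -Complex.I * (p.entropyCoeff * p.speed / 2) * r * (x 0 - x 1) -
      p.γ * p.Dth * r ^ 2 * x 2 := by
  simp [symbolOf, waveSymbol, dampSymbol, matrixCLM_apply, dotProduct,
    Fin.sum_univ_three]
  ring

theorem refSymbol_apply (r : ℝ) (x : Fin 3 → ℂ) (j : Fin 3) :
    symbolOf p.refWaveSymbol p.refDampSymbol r x j =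
      -(p.waveCoeff j * r + p.diffCoeff j * r ^ 2) * x j := by
  simp [symbolOf, refWaveSymbol, refDampSymbol, matrixCLM_apply, Matrix.mulVec_diagonal]
  ring

/-- The velocity component. -/
noncomputable def _root_.velocityCoord (x : Fin 3 → ℂ) : ℂ := (x 0 + x 1) / 2

/-- The potential component. -/
noncomputable def _root_.potentialCoord (x : Fin 3 → ℂ) : ℂ := -Complex.I * (x 0 - x 1) / 2

/-- The entropy component. -/
noncomputable def entropyCoord (x : Fin 3 → ℂ) : ℂ := x 2 + p.entropyCoeff * velocityCoord x

theorem eq_coords (x : Fin 3 → ℂ) : x =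
    ![velocityCoord x + Complex.I * potentialCoord x, velocityCoord x - Complex.I * potentialCoord x,
      p.entropyCoord x - p.entropyCoeff * velocityCoord x] := by
  ext i
  fin_cases i
  · simp [velocityCoord, potentialCoord]
    linear_combination (x 0 - x 1) / 2 * Complex.I_sq
  · simp [velocityCoord, potentialCoord]
    linear_combination -(x 0 - x 1) / 2 * Complex.I_sq
  · simp [entropyCoord]

theorem norm_velocityCoord_le (x : Fin 3 → ℂ) : ‖velocityCoord x‖ ≤ ‖x‖ := by
  have h0 := norm_le_pi_norm x 0
  have h1 := norm_le_pi_norm x 1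
  have := norm_add_le (x 0) (x 1)
  rw [velocityCoord, norm_div, Complex.norm_ofNat]
  linarith

theorem norm_potentialCoord_le (x : Fin 3 → ℂ) : ‖potentialCoord x‖ ≤ ‖x‖ := by
  have h0 := norm_le_pi_norm x 0
  have h1 := norm_le_pi_norm x 1
  have := norm_sub_le (x 0) (x 1)
  rw [potentialCoord, norm_div, Complex.norm_ofNat, norm_mul, norm_neg, Complex.norm_I, one_mul]
  linarith

theorem norm_entropyCoord_le (x : Fin 3 → ℂ) :
    ‖p.entropyCoord x‖ ≤ (1 + p.entropyCoeff) * ‖x‖ := by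
  have hk := p.entropyCoeff_pos
  have h2 := norm_le_pi_norm x 2
  calc ‖p.entropyCoord x‖ ≤ ‖x 2‖ + ‖(p.entropyCoeff : ℂ) * velocityCoord x‖ := norm_add_le _ _
    _ = ‖x 2‖ + p.entropyCoeff * ‖velocityCoord x‖ := by
      rw [norm_mul, Complex.norm_real, Real.norm_of_nonneg hk.le]
    _ ≤ ‖x‖ + p.entropyCoeff * ‖x‖ := by gcongr; exact norm_velocityCoord_le x
    _ = _ := by ring

theorem norm_le_coords (x : Fin 3 → ℂ) :
    ‖x‖ ≤ (1 + p.entropyCoeff) *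
      (‖velocityCoord x‖ + ‖potentialCoord x‖ + ‖p.entropyCoord x‖) := by
  have hk := p.entropyCoeff_pos
  have n1 := norm_nonneg (velocityCoord x)
  have n2 := norm_nonneg (potentialCoord x)
  have n3 := norm_nonneg (p.entropyCoord x)
  have m1 := mul_nonneg hk.le n1
  have m2 := mul_nonneg hk.le n2
  have m3 := mul_nonneg hk.le n3
  refine (pi_norm_le_iff_of_nonneg (by positivity)).mpr fun i => ?_
  have hx := congrFun (p.eq_coords x) i
  rw [hx]
  fin_cases i
  · refine (norm_add_le _ _).trans ?_
    rw [norm_mul, Complex.norm_I, one_mul]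
    linarith
  · refine (norm_sub_le _ _).trans ?_
    rw [norm_mul, Complex.norm_I, one_mul]
    linarith
  · refine (norm_sub_le _ _).trans ?_
    rw [norm_mul, Complex.norm_real, Real.norm_of_nonneg hk.le]
    linarith

theorem hasDerivAt_component {B₁ B₂ : (Fin 3 → ℂ) →L[ℂ] (Fin 3 → ℂ)} (r : ℝ) (x : Fin 3 → ℂ)
    (t : ℝ) (i : Fin 3) : HasDerivAt (fun t => propagator B₁ B₂ t r x i)
      (symbolOf B₁ B₂ r (propagator B₁ B₂ t r x) i) t :=
  hasDerivAt_pi.mp (hasDerivAt_propagator_apply B₁ B₂ r x t) i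

/-- Adding `ε φ_t` to `T` removes the terms of order `r` from the temperature equation. Together
with `ε · flux = (γ-1) Dth` this gives the diffusion coefficient `Dth` in place of `γ Dth`. -/
theorem isSolution_propagator (r : ℝ) (x : Fin 3 → ℂ) :
    p.dampedWave.IsSolution r 0 0 0
      (fun t => velocityCoord (propagator p.waveSymbol p.dampSymbol t r x))
      (fun t => potentialCoord (propagator p.waveSymbol p.dampSymbol t r x))
      (fun t => p.entropyCoord (propagator p.waveSymbol p.dampSymbol t r x)) := by
  have hd := hasDerivAt_component (B₁ := p.waveSymbol) (B₂ := p.dampSymbol) r x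
  have hΓ : (2 * p.Γ0 : ℂ) = p.visc + p.flux * p.entropyCoeff := by exact_mod_cast p.two_mul_Γ0
  have he : (p.flux * p.entropyCoeff : ℂ) = (p.γ - 1) * p.Dth := by
    exact_mod_cast p.flux_mul_entropyCoeff
  have hV : ∀ t, HasDerivAt (fun t => velocityCoord (propagator p.waveSymbol p.dampSymbol t r x)) _ t :=
    fun t => ((hd t 0).add (hd t 1)).div_const 2
  have hI := Complex.I_sq
  refine ⟨fun t => ?_, fun t => ?_, fun t => ?_⟩
  · refine (hV t).congr_deriv ?_
    rw [symbol_apply_zero, symbol_apply_one]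
    simp only [dampedWave, entropyCoord, velocityCoord, potentialCoord, Pi.zero_apply]
    push_cast
    set X := propagator p.waveSymbol p.dampSymbol t r x
    linear_combination (r : ℂ) ^ 2 * (X 0 + X 1) / 2 * hΓ
  · refine ((((hd t 0).sub (hd t 1)).const_mul (-Complex.I)).div_const 2).congr_deriv ?_
    rw [symbol_apply_zero, symbol_apply_one]
    simp only [dampedWave, velocityCoord, Pi.zero_apply]
    push_cast
    set X := propagator p.waveSymbol p.dampSymbol t r x
    linear_combination -(p.speed : ℂ) * r * (X 0 + X 1) / 2 * hI
  · refine ((hd t 2).add ((hV t).const_mul (p.entropyCoeff : ℂ))).congr_deriv ?_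
    rw [symbol_apply_zero, symbol_apply_one, symbol_apply_two]
    simp only [dampedWave, entropyCoord, velocityCoord, Pi.zero_apply]
    push_cast
    set X := propagator p.waveSymbol p.dampSymbol t r x
    linear_combination (r : ℂ) ^ 2 * X 2 * he

theorem exists_propagator_decay : ∃ c C : ℝ, 0 < c ∧ 0 < C ∧ ∀ t r, 0 ≤ t → 0 ≤ r →
    ∀ x : Fin 3 → ℂ, ‖propagator p.waveSymbol p.dampSymbol t r x‖ ≤
      C * Real.exp (-(c * (r ^ 2 / (1 + r ^ 2)) * t)) * ‖x‖ := by
  obtain ⟨c, C, hc, hC, h⟩ := p.dampedWave.exists_decay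
  have hk := p.entropyCoeff_pos
  set k := 1 + p.entropyCoeff with hkd
  have hk1 : 1 ≤ k := by linarith
  -- The decay estimate is for squares, so its rate is halved; `1 + C` serves as an upper bound for
  -- the square root of `C`.
  refine ⟨c / 2, 3 * k ^ 2 * (1 + C), by positivity, by positivity, fun t r ht hr x => ?_⟩
  have h1 := h r _ _ _ hr (p.isSolution_propagator r x) t ht
  simp only [propagator_zero_apply] at h1
  set X := propagator p.waveSymbol p.dampSymbol t r x
  set ρ := r ^ 2 / (1 + r ^ 2) with hρ
  have hexp : Real.exp (-(c * ρ * t)) = Real.exp (-(c / 2 * ρ * t)) ^ 2 := by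
    rw [← Real.exp_nat_mul]; congr 1; push_cast; ring
  set ex := Real.exp (-(c / 2 * ρ * t))
  have hex : 0 < ex := Real.exp_pos _
  have a1 : ‖velocityCoord x‖ ≤ k * ‖x‖ := (norm_velocityCoord_le x).trans
    (le_mul_of_one_le_left (norm_nonneg _) hk1)
  have a2 : ‖potentialCoord x‖ ≤ k * ‖x‖ := (norm_potentialCoord_le x).trans
    (le_mul_of_one_le_left (norm_nonneg _) hk1)
  have a3 := p.norm_entropyCoord_le x
  have h2 : ‖velocityCoord x‖ ^ 2 + ‖potentialCoord x‖ ^ 2 + ‖p.entropyCoord x‖ ^ 2 ≤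
      3 * (k * ‖x‖) ^ 2 := by
    calc _ ≤ (k * ‖x‖) ^ 2 + (k * ‖x‖) ^ 2 + (k * ‖x‖) ^ 2 := by gcongr
      _ = _ := by ring
  have h3 := p.norm_le_coords X
  have h4 : (‖velocityCoord X‖ + ‖potentialCoord X‖ + ‖p.entropyCoord X‖) ^ 2 ≤
      (3 * k * (1 + C) * ex * ‖x‖) ^ 2 := by
    calc _ ≤ 3 * (‖velocityCoord X‖ ^ 2 + ‖potentialCoord X‖ ^ 2 + ‖p.entropyCoord X‖ ^ 2) := by
          nlinarith [sq_nonneg (‖velocityCoord X‖ - ‖potentialCoord X‖),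
            sq_nonneg (‖velocityCoord X‖ - ‖p.entropyCoord X‖),
            sq_nonneg (‖potentialCoord X‖ - ‖p.entropyCoord X‖)]
      _ ≤ 3 * (C * ex ^ 2 * (3 * (k * ‖x‖) ^ 2)) := by
          rw [← hexp]
          gcongr
          exact h1.trans (by gcongr)
      _ = C * (3 * k * ex * ‖x‖) ^ 2 := by ring
      _ ≤ (1 + C) ^ 2 * (3 * k * ex * ‖x‖) ^ 2 := by
          gcongr; nlinarith
      _ = _ := by ring
  have h5 := le_of_sq_le_sq h4 (by positivity)
  calc ‖X‖ ≤ k * (3 * k * (1 + C) * ex * ‖x‖) := h3.trans (by gcongr)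
    _ = _ := by ring

theorem exists_propagator_bound : ∃ C : ℝ, ∀ t r, 0 ≤ t → 0 ≤ r →
    ‖propagator p.waveSymbol p.dampSymbol t r‖ ≤ C := by
  obtain ⟨c, C, hc, hC, h⟩ := p.exists_propagator_decay
  refine ⟨C, fun t r ht hr => ContinuousLinearMap.opNorm_le_bound _ hC.le fun x => ?_⟩
  refine (h t r ht hr x).trans ?_
  gcongr
  refine mul_le_of_le_one_right hC.le (Real.exp_le_one_iff.mpr ?_)
  have : 0 ≤ c * (r ^ 2 / (1 + r ^ 2)) * t := by positivity
  linarith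

theorem diffCoeff_eq (j : Fin 3) : p.diffCoeff j = ((p.diffCoeff j).re : ℂ) := by
  fin_cases j <;> simp [diffCoeff]

theorem waveCoeff_re (j : Fin 3) : (p.waveCoeff j).re = 0 := by
  fin_cases j <;> simp [waveCoeff]

/-- The wave coefficients are purely imaginary, so they do not affect the modulus and `|x_j|²`
solves a scalar linear equation. The equality comes from applying `le_exp_mul_of_deriv_le` to
`|x_j|²` and to `-|x_j|²`. -/
theorem norm_refPropagator_sq {t r : ℝ} (ht : 0 ≤ t) (x : Fin 3 → ℂ) (j : Fin 3) :
    ‖propagator p.refWaveSymbol p.refDampSymbol t r x j‖ ^ 2 =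
      Real.exp (-(2 * (p.diffCoeff j).re * r ^ 2 * t)) * ‖x j‖ ^ 2 := by
  have hd := fun t => hasDerivAt_component (B₁ := p.refWaveSymbol) (B₂ := p.refDampSymbol) r x t j
  have h1 : ∀ t, HasDerivAt (fun t => ‖propagator p.refWaveSymbol p.refDampSymbol t r x j‖ ^ 2)
      (-(2 * (p.diffCoeff j).re * r ^ 2) *
        ‖propagator p.refWaveSymbol p.refDampSymbol t r x j‖ ^ 2) t := by
    intro t
    refine ((hd t).norm_sq).congr_deriv ?_
    rw [refSymbol_apply]
    set z := propagator p.refWaveSymbol p.refDampSymbol t r x j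
    rw [Complex.inner, mul_assoc, Complex.mul_conj, Complex.re_mul_ofReal, Complex.normSq_eq_norm_sq]
    have hi : (p.diffCoeff j).im = 0 := by rw [diffCoeff_eq]; simp
    simp [waveCoeff_re, ← Complex.ofReal_pow]
    ring
  refine le_antisymm ?_ ?_
  · have := le_exp_mul_of_deriv_le (k := 2 * (p.diffCoeff j).re * r ^ 2) h1 (fun t _ => le_rfl) ht
    simpa [propagator_zero_apply] using this
  · have := le_exp_mul_of_deriv_le (k := 2 * (p.diffCoeff j).re * r ^ 2)
      (fun t => (h1 t).neg) (fun t _ => le_of_eq (by simp only [Pi.neg_apply]; ring)) ht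
    simp only [Pi.neg_apply, propagator_zero_apply] at this
    linarith

/-- The smaller one of the two diffusion constants. -/
noncomputable def minDiff : ℝ := min p.Dth p.Γ0

theorem minDiff_pos : 0 < p.minDiff := lt_min p.Dth_pos p.Γ0_pos

theorem minDiff_le (j : Fin 3) : p.minDiff ≤ (p.diffCoeff j).re := by
  fin_cases j
  · simp [diffCoeff, minDiff]
  · simp [diffCoeff, minDiff]
  · simp [diffCoeff, minDiff]

theorem norm_refPropagator_apply_le {t r : ℝ} (ht : 0 ≤ t) (x : Fin 3 → ℂ) (j : Fin 3) :
    ‖propagator p.refWaveSymbol p.refDampSymbol t r x j‖ ≤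
      Real.exp (-(p.minDiff * r ^ 2 * t)) * ‖x j‖ := by
  refine le_of_sq_le_sq ?_ (by positivity)
  rw [norm_refPropagator_sq p ht, mul_pow, ← Real.exp_nat_mul]
  gcongr
  have := mul_le_mul_of_nonneg_right (p.minDiff_le j) (by positivity : 0 ≤ r ^ 2 * t)
  push_cast
  linarith

theorem norm_refPropagator_le {t r : ℝ} (ht : 0 ≤ t) (x : Fin 3 → ℂ) :
    ‖propagator p.refWaveSymbol p.refDampSymbol t r x‖ ≤
      Real.exp (-(p.minDiff * r ^ 2 * t)) * ‖x‖ :=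
  (pi_norm_le_iff_of_nonneg (by positivity)).mpr fun j =>
    (p.norm_refPropagator_apply_le ht x j).trans (by gcongr; exact norm_le_pi_norm x j)

theorem refPropagator_bound : ∀ t r, 0 ≤ t → 0 ≤ r →
    ‖propagator p.refWaveSymbol p.refDampSymbol t r‖ ≤ 1 := fun t r ht _ =>
  ContinuousLinearMap.opNorm_le_bound _ zero_le_one fun x => by
    refine (p.norm_refPropagator_le ht x).trans ?_
    gcongr
    refine Real.exp_le_one_iff.mpr ?_
    have := p.minDiff_pos
    have : 0 ≤ p.minDiff * r ^ 2 * t := by positivity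
    linarith

end AcousticParams

/-! ### Comparison of the solution with the reference profile. -/

theorem DampedWave.IsSolution.sub {q : DampedWave} {r : ℝ}
    {fv fh fy v h y gv gh gy v' h' y' : ℝ → ℂ} (hs : q.IsSolution r fv fh fy v h y)
    (hs' : q.IsSolution r gv gh gy v' h' y') :
    q.IsSolution r (fv - gv) (fh - gh) (fy - gy) (v - v') (h - h') (y - y') where
  deriv_v t := ((hs.deriv_v t).sub (hs'.deriv_v t)).congr_deriv (by simp only [Pi.sub_apply]; ring)
  deriv_h t := ((hs.deriv_h t).sub (hs'.deriv_h t)).congr_deriv (by simp only [Pi.sub_apply]; ring)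
  deriv_y t := ((hs.deriv_y t).sub (hs'.deriv_y t)).congr_deriv (by simp only [Pi.sub_apply]; ring)

namespace AcousticParams

variable (p : AcousticParams)

theorem U1_det : p.U1.det = -(p.κ : ℂ) ^ 2 := by
  simp [U1, Matrix.det_fin_three]; ring

theorem U1_isUnit_det : IsUnit p.U1.det := by
  rw [U1_det, isUnit_iff_ne_zero, neg_ne_zero]
  exact pow_ne_zero 2 (by exact_mod_cast p.κ_ne_zero)

theorem U1_mulVec_inv (x : Fin 3 → ℂ) : p.U1.mulVec (p.U1⁻¹.mulVec x) = x := by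
  rw [Matrix.mulVec_mulVec, Matrix.mul_nonsing_inv _ p.U1_isUnit_det, Matrix.one_mulVec]

theorem U1_inv_mulVec (x : Fin 3 → ℂ) : p.U1⁻¹.mulVec (p.U1.mulVec x) = x := by
  rw [Matrix.mulVec_mulVec, Matrix.nonsing_inv_mul _ p.U1_isUnit_det, Matrix.one_mulVec]

theorem velocityCoord_U1 (z : Fin 3 → ℂ) :
    velocityCoord (p.U1.mulVec z) = p.κ * (z 2 + z 1) / 2 := by
  simp [velocityCoord, U1, dotProduct, Fin.sum_univ_three]; ring

theorem potentialCoord_U1 (z : Fin 3 → ℂ) :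
    potentialCoord (p.U1.mulVec z) = -Complex.I * p.κ * (z 2 - z 1) / 2 := by
  simp [potentialCoord, U1, dotProduct, Fin.sum_univ_three]; ring

theorem entropyCoord_U1 (z : Fin 3 → ℂ) : p.entropyCoord (p.U1.mulVec z) = z 0 := by
  have h : (p.κ : ℂ) * p.entropyCoeff = -2 := by exact_mod_cast p.κ_mul_entropyCoeff
  rw [entropyCoord, velocityCoord_U1]
  simp [U1, dotProduct, Fin.sum_univ_three]
  linear_combination (z 2 + z 1) / 2 * h

/-- The reference profile, with a first-order corrector, solves the full system up to `O(r³)`. -/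
theorem isSolution_corrected_profile {r : ℝ} {V H Y : ℝ → ℂ}
    (hV : ∀ t, HasDerivAt V (-(p.Γ0 : ℂ) * r ^ 2 * V t - p.speed * r * H t) t)
    (hH : ∀ t, HasDerivAt H (p.speed * r * V t - (p.Γ0 : ℂ) * r ^ 2 * H t) t)
    (hY : ∀ t, HasDerivAt Y (-(p.Dth : ℂ) * r ^ 2 * Y t) t) :
    p.dampedWave.IsSolution r
      (fun t => (r : ℂ) ^ 3 * ((p.dampedWave.e * p.dampedWave.δ / p.speed : ℝ) * H t))
      (fun t => (r : ℂ) ^ 3 * ((p.Γ0 ^ 2 / p.speed : ℝ) * V t -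
        (p.dampedWave.e * p.Dth / p.speed : ℝ) * Y t))
      (fun t => (r : ℂ) ^ 3 * ((p.dampedWave.δ * (p.Γ0 - p.Dth) / p.speed : ℝ) * H t))
      V
      (fun t => H t + r * ((-(p.Γ0 / p.speed) : ℝ) * V t + (p.dampedWave.e / p.speed : ℝ) * Y t))
      (fun t => Y t - r * ((p.dampedWave.δ / p.speed : ℝ) * H t)) := by
  have ha : (p.speed : ℂ) ≠ 0 := by exact_mod_cast p.speed_pos.ne'
  set e := p.dampedWave.e
  set δ := p.dampedWave.δ
  have h1 : p.dampedWave.a = p.speed := rfl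
  have h2 : p.dampedWave.Γ = p.Γ0 := rfl
  have h3 : p.dampedWave.D = p.Dth := rfl
  refine ⟨fun t => ?_, fun t => ?_, fun t => ?_⟩
  -- The corrected potential adds `Γ₀ r² V - e r² Y` to the velocity equation: this halves the
  -- damping `2Γ₀` and removes the entropy coupling. The corrections of the other two equations
  -- follow the same pattern, and what is left over is the forcing of size `r³`.
  · refine (hV t).congr_deriv ?_
    rw [h1, h2]
    push_cast
    field_simp
    ring
  · refine ((hH t).add ((((hV t).const_mul _).add ((hY t).const_mul _)).const_mul _)).congr_deriv ?_
    rw [h1]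
    push_cast
    field_simp
    ring
  · refine ((hY t).sub (((hH t).const_mul _).const_mul _)).congr_deriv ?_
    rw [h3]
    push_cast
    field_simp
    ring

theorem hasDerivAt_refCoords (r : ℝ) (z : Fin 3 → ℂ) (t : ℝ) :
    HasDerivAt (fun t => velocityCoord (p.U1.mulVec
        (propagator p.refWaveSymbol p.refDampSymbol t r z)))
      (-(p.Γ0 : ℂ) * r ^ 2 * velocityCoord (p.U1.mulVec
        (propagator p.refWaveSymbol p.refDampSymbol t r z)) - p.speed * r *
        potentialCoord (p.U1.mulVec (propagator p.refWaveSymbol p.refDampSymbol t r z))) t ∧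
    HasDerivAt (fun t => potentialCoord (p.U1.mulVec
        (propagator p.refWaveSymbol p.refDampSymbol t r z)))
      (p.speed * r * velocityCoord (p.U1.mulVec
        (propagator p.refWaveSymbol p.refDampSymbol t r z)) - (p.Γ0 : ℂ) * r ^ 2 *
        potentialCoord (p.U1.mulVec (propagator p.refWaveSymbol p.refDampSymbol t r z))) t ∧
    HasDerivAt (fun t => p.entropyCoord (p.U1.mulVec
        (propagator p.refWaveSymbol p.refDampSymbol t r z)))
      (-(p.Dth : ℂ) * r ^ 2 * p.entropyCoord (p.U1.mulVec
        (propagator p.refWaveSymbol p.refDampSymbol t r z))) t := by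
  have hd := hasDerivAt_component (B₁ := p.refWaveSymbol) (B₂ := p.refDampSymbol) r z t
  simp only [velocityCoord_U1, potentialCoord_U1, entropyCoord_U1]
  have hI := Complex.I_sq
  refine ⟨?_, ?_, ?_⟩
  · refine ((((hd 2).add (hd 1)).const_mul (p.κ : ℂ)).div_const 2).congr_deriv ?_
    rw [refSymbol_apply, refSymbol_apply]
    simp [waveCoeff, diffCoeff]
    ring
  · refine ((((hd 2).sub (hd 1)).const_mul (-Complex.I * (p.κ : ℂ))).div_const 2).congr_deriv ?_
    rw [refSymbol_apply, refSymbol_apply]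
    simp [waveCoeff, diffCoeff]
    set X := propagator p.refWaveSymbol p.refDampSymbol t r z
    linear_combination -(p.κ : ℂ) * p.speed * r * (X 2 + X 1) / 2 * hI
  · refine (hd 0).congr_deriv ?_
    rw [refSymbol_apply]
    simp [waveCoeff, diffCoeff]

theorem norm_coords_le (x : Fin 3 → ℂ) :
    ‖velocityCoord x‖ + ‖potentialCoord x‖ + ‖p.entropyCoord x‖ ≤
      (3 + p.entropyCoeff) * ‖x‖ := by
  linarith [norm_velocityCoord_le x, norm_potentialCoord_le x, p.norm_entropyCoord_le x]

/-- Bounds for the corrector and the residual of the corrected profile. -/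
theorem exists_corrector_bound : ∃ L : ℝ, 0 < L ∧ ∀ (r : ℝ) (V H Y : ℂ), 0 ≤ r →
    ‖(r : ℂ) * ((-(p.Γ0 / p.speed) : ℝ) * V + (p.dampedWave.e / p.speed : ℝ) * Y)‖ +
      ‖(r : ℂ) * ((p.dampedWave.δ / p.speed : ℝ) * H)‖ ≤ r * (L * (‖V‖ + ‖H‖ + ‖Y‖)) ∧
    ‖(r : ℂ) ^ 3 * ((p.dampedWave.e * p.dampedWave.δ / p.speed : ℝ) * H)‖ +
      ‖(r : ℂ) ^ 3 * ((p.Γ0 ^ 2 / p.speed : ℝ) * V - (p.dampedWave.e * p.Dth / p.speed : ℝ) * Y)‖ +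
      ‖(r : ℂ) ^ 3 * ((p.dampedWave.δ * (p.Γ0 - p.Dth) / p.speed : ℝ) * H)‖ ≤
      r ^ 3 * (L * (‖V‖ + ‖H‖ + ‖Y‖)) := by
  generalize p.Γ0 ^ 2 / p.speed = a₁
  generalize p.Γ0 / p.speed = a₂
  generalize p.dampedWave.e * p.dampedWave.δ / p.speed = a₃
  generalize p.dampedWave.δ * (p.Γ0 - p.Dth) / p.speed = a₄
  generalize p.dampedWave.e * p.Dth / p.speed = a₅
  generalize p.dampedWave.e / p.speed = a₆
  generalize p.dampedWave.δ / p.speed = a₇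
  refine ⟨1 + |a₁| + |a₂| + |a₃| + |a₄| + |a₅| + |a₆| + |a₇|, by positivity,
    fun r V H Y hr => ?_⟩
  have hnr : ‖(r : ℂ)‖ = r := by rw [Complex.norm_real, Real.norm_of_nonneg hr]
  have n1 := norm_nonneg V
  have n2 := norm_nonneg H
  have n3 := norm_nonneg Y
  constructor
  · rw [norm_mul, norm_mul (r : ℂ), hnr, ← mul_add]
    gcongr
    have t1 := norm_add_le (((-a₂ : ℝ) : ℂ) * V) ((a₆ : ℝ) * Y)
    simp only [norm_mul, Complex.norm_real, Real.norm_eq_abs, abs_neg] at t1 ⊢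
    have : 0 ≤ (1 + |a₁| + |a₂| + |a₃| + |a₄| + |a₅| + |a₆| + |a₇|) * (‖V‖ + ‖H‖ + ‖Y‖) -
        (|a₂| * ‖V‖ + |a₆| * ‖Y‖ + |a₇| * ‖H‖) := by
      ring_nf; positivity
    linarith
  · rw [norm_mul, norm_mul ((r : ℂ) ^ 3), norm_mul ((r : ℂ) ^ 3), norm_pow, hnr, ← mul_add,
      ← mul_add]
    gcongr
    have t1 := norm_sub_le ((a₁ : ℂ) * V) ((a₅ : ℝ) * Y)
    simp only [norm_mul, Complex.norm_real, Real.norm_eq_abs] at t1 ⊢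
    have : 0 ≤ (1 + |a₁| + |a₂| + |a₃| + |a₄| + |a₅| + |a₆| + |a₇|) * (‖V‖ + ‖H‖ + ‖Y‖) -
        (|a₃| * ‖H‖ + (|a₁| * ‖V‖ + |a₅| * ‖Y‖) + |a₄| * ‖H‖) := by
      ring_nf; positivity
    linarith

theorem exists_refCoords_bound : ∃ M : ℝ, 0 < M ∧ ∀ (t r : ℝ) (x : Fin 3 → ℂ), 0 ≤ t →
    ‖velocityCoord (p.U1.mulVec
        (propagator p.refWaveSymbol p.refDampSymbol t r (p.U1⁻¹.mulVec x)))‖ +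
      ‖potentialCoord (p.U1.mulVec
        (propagator p.refWaveSymbol p.refDampSymbol t r (p.U1⁻¹.mulVec x)))‖ +
      ‖p.entropyCoord (p.U1.mulVec
        (propagator p.refWaveSymbol p.refDampSymbol t r (p.U1⁻¹.mulVec x)))‖ ≤
      M * (Real.exp (-(p.minDiff * r ^ 2 * t)) * ‖x‖) := by
  have hk := p.entropyCoeff_pos
  refine ⟨(3 + p.entropyCoeff) * (‖matrixCLM p.U1‖ * ‖matrixCLM p.U1⁻¹‖ + 1), by positivity,
    fun t r x ht => ?_⟩
  refine (p.norm_coords_le _).trans ?_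
  rw [mul_assoc]
  refine mul_le_mul_of_nonneg_left ?_ (by positivity)
  have h1 : ‖p.U1⁻¹.mulVec x‖ ≤ ‖matrixCLM p.U1⁻¹‖ * ‖x‖ := (matrixCLM p.U1⁻¹).le_opNorm _
  have h2 := p.norm_refPropagator_le (r := r) ht (p.U1⁻¹.mulVec x)
  calc _ ≤ ‖matrixCLM p.U1‖ *
        ‖propagator p.refWaveSymbol p.refDampSymbol t r (p.U1⁻¹.mulVec x)‖ :=
        (matrixCLM p.U1).le_opNorm _
    _ ≤ ‖matrixCLM p.U1‖ * (Real.exp (-(p.minDiff * r ^ 2 * t)) *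
        (‖matrixCLM p.U1⁻¹‖ * ‖x‖)) :=
      mul_le_mul_of_nonneg_left (h2.trans (mul_le_mul_of_nonneg_left h1 (Real.exp_pos _).le))
        (norm_nonneg _)
    _ = ‖matrixCLM p.U1‖ * ‖matrixCLM p.U1⁻¹‖ * (Real.exp (-(p.minDiff * r ^ 2 * t)) * ‖x‖) := by
      ring
    _ ≤ _ := mul_le_mul_of_nonneg_right (by linarith) (by positivity)

/-- The difference of the solution and the corrected profile is small initially and has small
forcing, so `exists_forced_decay` applies. The corrector stays explicit here and is estimated
separately. -/
theorem exists_low_frequency_coords : ∃ c C : ℝ, 0 < c ∧ 0 < C ∧ ∀ (r : ℝ) (x : Fin 3 → ℂ),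
    0 ≤ r → r ≤ 1 → ∀ t, 0 ≤ t → ∃ v h y : ℂ, ∀ X Z : Fin 3 → ℂ,
    X = propagator p.waveSymbol p.dampSymbol t r x →
    Z = p.U1.mulVec (propagator p.refWaveSymbol p.refDampSymbol t r (p.U1⁻¹.mulVec x)) →
    velocityCoord X - velocityCoord Z = v ∧
    potentialCoord X - potentialCoord Z = h + r * ((-(p.Γ0 / p.speed) : ℝ) * velocityCoord Z +
      (p.dampedWave.e / p.speed : ℝ) * p.entropyCoord Z) ∧
    p.entropyCoord X - p.entropyCoord Z = y - r * ((p.dampedWave.δ / p.speed : ℝ) *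
      potentialCoord Z) ∧
    ‖v‖ ^ 2 + ‖h‖ ^ 2 + ‖y‖ ^ 2 ≤ C * r ^ 2 * ‖x‖ ^ 2 * Real.exp (-(c * r ^ 2 * t)) := by
  have hd0 := p.minDiff_pos
  obtain ⟨c, C, hc, hC, h⟩ := p.dampedWave.exists_forced_decay (c₁ := 2 * p.minDiff) (by positivity)
  obtain ⟨L, hL0, hL⟩ := p.exists_corrector_bound
  obtain ⟨M, hM0, hM⟩ := p.exists_refCoords_bound
  refine ⟨c, C * (L * M) ^ 2, hc, by positivity, fun r x hr hr1 t ht => ?_⟩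
  obtain ⟨z, hz⟩ : ∃ z, z = p.U1⁻¹.mulVec x := ⟨_, rfl⟩
  have hU : p.U1.mulVec z = x := by rw [hz, U1_mulVec_inv]
  have hW := p.isSolution_corrected_profile (r := r)
    (fun t => (p.hasDerivAt_refCoords r z t).1) (fun t => (p.hasDerivAt_refCoords r z t).2.1)
    (fun t => (p.hasDerivAt_refCoords r z t).2.2)
  have hsub := (p.isSolution_propagator r x).sub hW
  have hLM := fun (t : ℝ) (ht : 0 ≤ t) => mul_le_mul_of_nonneg_left (hM t r x ht) hL0.le
  simp only [← hz] at hLM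
  -- The residual has size `r³ L M ‖x‖ exp(-minDiff r² t)`. Its square carries the rate `2 *
  -- minDiff`, chosen as `c₁` above.
  have hmain := h r (L * M * ‖x‖) _ _ _ _ _ _ hr hr1 hsub (fun t ht => by
    simp only [Pi.sub_apply, Pi.zero_apply, zero_sub, norm_neg]
    have hexp : Real.exp (-(2 * p.minDiff * r ^ 2 * t)) =
        Real.exp (-(p.minDiff * r ^ 2 * t)) ^ 2 := by
      rw [← Real.exp_nat_mul]; congr 1; push_cast; ring
    rw [hexp]
    have h1 := ((hL r _ _ _ hr).2).trans (mul_le_mul_of_nonneg_left (hLM t ht)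
      (pow_nonneg hr 3))
    refine (pow_le_pow_left₀ (by positivity) h1 2).trans (le_of_eq ?_)
    ring) (by
    -- At time `0` the profile equals the solution, since `U₁ U₁⁻¹ x = x`; only the corrector, of
    -- size `r`, survives.
    simp only [Pi.sub_apply, propagator_zero_apply, hU]
    have t1 := ((hL r _ _ _ hr).1).trans (mul_le_mul_of_nonneg_left (hLM 0 le_rfl) hr)
    simp only [mul_zero, neg_zero, Real.exp_zero, one_mul, propagator_zero_apply, hU] at t1
    rw [sub_self, norm_zero, sub_add_cancel_left, norm_neg, sub_sub_cancel]
    refine le_trans ?_ ((pow_le_pow_left₀ (by positivity) t1 2).trans (le_of_eq (by ring)))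
    have n1 := norm_nonneg ((r : ℂ) * ((-(p.Γ0 / p.speed) : ℝ) * velocityCoord x +
      (p.dampedWave.e / p.speed : ℝ) * p.entropyCoord x))
    have n2 := norm_nonneg ((r : ℂ) * ((p.dampedWave.δ / p.speed : ℝ) * potentialCoord x))
    nlinarith) t ht
  refine ⟨_, _, _, fun X Z hX hZ => ⟨by rw [hX, hZ, ← hz]; rfl, ?_, ?_, hmain.trans (le_of_eq (by ring))⟩⟩
  · rw [hX, hZ, ← hz]
    simp only [Pi.sub_apply]
    ring
  · rw [hX, hZ, ← hz]
    simp only [Pi.sub_apply]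
    ring

/-- At low frequency the reference profile approximates the solution to first order. -/
theorem exists_low_frequency_profile : ∃ c C : ℝ, 0 < c ∧ 0 < C ∧ ∀ t r, 0 ≤ t → 0 ≤ r → r ≤ 1 →
    ∀ x : Fin 3 → ℂ, ‖propagator p.waveSymbol p.dampSymbol t r x - p.U1.mulVec
      (propagator p.refWaveSymbol p.refDampSymbol t r (p.U1⁻¹.mulVec x))‖ ≤
      C * r * Real.exp (-(c * r ^ 2 * t)) * ‖x‖ := by
  have hd0 := p.minDiff_pos
  have hk0 := p.entropyCoeff_pos
  obtain ⟨c, C, hc, hC, h⟩ := p.exists_low_frequency_coords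
  obtain ⟨L, hL0, hL⟩ := p.exists_corrector_bound
  obtain ⟨M, hM0, hM⟩ := p.exists_refCoords_bound
  -- The rate `c / 2` belongs to the corrected difference, known through its square; `minDiff` is
  -- the rate of the corrector, which is built from the profile.
  refine ⟨min (c / 2) p.minDiff, (1 + p.entropyCoeff) * (3 * (1 + C) + L * M),
    lt_min (by positivity) hd0, by positivity, fun t r ht hr hr1 x => ?_⟩
  obtain ⟨v, hh, y, hxyz⟩ := h r x hr hr1 t ht
  have hMt := hM t r x ht
  obtain ⟨X, hX⟩ : ∃ X, X = propagator p.waveSymbol p.dampSymbol t r x := ⟨_, rfl⟩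
  obtain ⟨Z, hZ⟩ : ∃ Z, Z = p.U1.mulVec
    (propagator p.refWaveSymbol p.refDampSymbol t r (p.U1⁻¹.mulVec x)) := ⟨_, rfl⟩
  obtain ⟨c1, c2, c3, hsq⟩ := hxyz X Z hX hZ
  have t1 := (hL r (velocityCoord Z) (potentialCoord Z) (p.entropyCoord Z) hr).1
  rw [← hX, ← hZ]
  rw [← hZ] at hMt
  clear hxyz hX hZ h hL hM
  obtain ⟨ex, hex⟩ : ∃ ex, ex = Real.exp (-(min (c / 2) p.minDiff * r ^ 2 * t)) := ⟨_, rfl⟩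
  have hex0 : 0 < ex := hex ▸ Real.exp_pos _
  have hexp : Real.exp (-(c * r ^ 2 * t)) ≤ ex ^ 2 := by
    rw [hex, ← Real.exp_nat_mul]
    refine Real.exp_le_exp.mpr ?_
    have := mul_le_mul_of_nonneg_right (min_le_left (c / 2) p.minDiff)
      (by positivity : 0 ≤ r ^ 2 * t)
    push_cast
    linarith
  have hexp2 : Real.exp (-(p.minDiff * r ^ 2 * t)) ≤ ex := by
    rw [hex]
    gcongr
    exact min_le_right _ _
  rw [← hex]
  have hsum : ‖v‖ + ‖hh‖ + ‖y‖ ≤ 3 * (1 + C) * r * ex * ‖x‖ := by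
    refine le_of_sq_le_sq ?_ (by positivity)
    calc (‖v‖ + ‖hh‖ + ‖y‖) ^ 2 ≤ 3 * (‖v‖ ^ 2 + ‖hh‖ ^ 2 + ‖y‖ ^ 2) := by
          nlinarith [sq_nonneg (‖v‖ - ‖hh‖), sq_nonneg (‖v‖ - ‖y‖), sq_nonneg (‖hh‖ - ‖y‖)]
      _ ≤ 3 * (C * r ^ 2 * ‖x‖ ^ 2 * ex ^ 2) :=
          mul_le_mul_of_nonneg_left (hsq.trans (mul_le_mul_of_nonneg_left hexp (by positivity)))
            (by norm_num)
      _ = 3 * C * (r * ex * ‖x‖) ^ 2 := by ring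
      _ ≤ 9 * (1 + C) ^ 2 * (r * ex * ‖x‖) ^ 2 :=
          mul_le_mul_of_nonneg_right (by nlinarith) (sq_nonneg _)
      _ = _ := by ring
  have t2 : r * (L * (‖velocityCoord Z‖ + ‖potentialCoord Z‖ + ‖p.entropyCoord Z‖)) ≤
      L * M * r * ex * ‖x‖ := by
    calc _ ≤ r * (L * (M * (ex * ‖x‖))) := by
          refine mul_le_mul_of_nonneg_left (mul_le_mul_of_nonneg_left (hMt.trans ?_) hL0.le) hr
          gcongr
      _ = _ := by ring
  have d1 : velocityCoord (X - Z) = v := by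
    rw [← c1]; simp only [velocityCoord, Pi.sub_apply]; ring
  have d2 : potentialCoord (X - Z) = potentialCoord X - potentialCoord Z := by
    simp only [potentialCoord, Pi.sub_apply]; ring
  have d3 : p.entropyCoord (X - Z) = p.entropyCoord X - p.entropyCoord Z := by
    simp only [entropyCoord, velocityCoord, Pi.sub_apply]; ring
  refine (p.norm_le_coords _).trans ?_
  rw [d1, d2, d3, c2, c3]
  have s1 := norm_add_le hh (r * ((-(p.Γ0 / p.speed) : ℝ) * velocityCoord Z +
      (p.dampedWave.e / p.speed : ℝ) * p.entropyCoord Z))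
  have s2 := norm_sub_le y (r * ((p.dampedWave.δ / p.speed : ℝ) * potentialCoord Z))
  calc _ ≤ (1 + p.entropyCoeff) * (3 * (1 + C) * r * ex * ‖x‖ + L * M * r * ex * ‖x‖) :=
        mul_le_mul_of_nonneg_left (by linarith) (by positivity)
    _ = _ := by ring

/-- The reference profile approximates the solution, with a gain of one power of the frequency. -/
theorem exists_profile_estimate : ∃ c C : ℝ, 0 < c ∧ 0 < C ∧ ∀ t r, 0 ≤ t → 0 ≤ r →
    ∀ x : Fin 3 → ℂ, ‖propagator p.waveSymbol p.dampSymbol t r x - p.U1.mulVec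
      (propagator p.refWaveSymbol p.refDampSymbol t r (p.U1⁻¹.mulVec x))‖ ≤
      C * min r 1 * Real.exp (-(c * (r ^ 2 / (1 + r ^ 2)) * t)) * ‖x‖ := by
  obtain ⟨c₁, C₁, hc₁, hC₁, h₁⟩ := p.exists_low_frequency_profile
  obtain ⟨c₂, C₂, hc₂, hC₂, h₂⟩ := p.exists_propagator_decay
  have hd0 := p.minDiff_pos
  set N := ‖matrixCLM p.U1‖ * ‖matrixCLM p.U1⁻¹‖ with hN
  have hN0 : 0 ≤ N := by positivity
  refine ⟨min c₁ (min c₂ p.minDiff), C₁ + C₂ + N, lt_min hc₁ (lt_min hc₂ hd0), by positivity,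
    fun t r ht hr x => ?_⟩
  set c := min c₁ (min c₂ p.minDiff) with hc
  set ρ := r ^ 2 / (1 + r ^ 2) with hρ
  have hρ0 : 0 ≤ ρ := by positivity
  have hρr : ρ ≤ r ^ 2 := div_le_self (by positivity) (by nlinarith [sq_nonneg r])
  set ex := Real.exp (-(c * ρ * t)) with hex
  have hex0 : 0 < ex := Real.exp_pos _
  -- For `r ≥ 1` no comparison is needed: both flows decay at least like `exp(-c ρ t)` because `ρ ≤
  -- r²`.
  rcases le_total r 1 with hr1 | hr1
  · rw [min_eq_left hr1]
    refine (h₁ t r ht hr hr1 x).trans ?_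
    have : Real.exp (-(c₁ * r ^ 2 * t)) ≤ ex := by
      rw [hex]
      gcongr
      exact min_le_left _ _
    gcongr
    linarith
  · rw [min_eq_right hr1, mul_one]
    have e1 : Real.exp (-(c₂ * ρ * t)) ≤ ex := by
      rw [hex]
      gcongr
      exact (min_le_right _ _).trans (min_le_left _ _)
    have e2 : Real.exp (-(p.minDiff * r ^ 2 * t)) ≤ ex := by
      rw [hex]
      gcongr
      exact (min_le_right _ _).trans (min_le_right _ _)
    have b1 := h₂ t r ht hr x
    have b2 : ‖p.U1.mulVec (propagator p.refWaveSymbol p.refDampSymbol t r (p.U1⁻¹.mulVec x))‖ ≤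
        N * (ex * ‖x‖) := by
      calc _ ≤ ‖matrixCLM p.U1‖ *
            ‖propagator p.refWaveSymbol p.refDampSymbol t r (p.U1⁻¹.mulVec x)‖ :=
            (matrixCLM p.U1).le_opNorm _
        _ ≤ ‖matrixCLM p.U1‖ * (ex * (‖matrixCLM p.U1⁻¹‖ * ‖x‖)) := by
          gcongr
          refine (p.norm_refPropagator_le ht _).trans ?_
          gcongr
          exact (matrixCLM p.U1⁻¹).le_opNorm _
        _ = _ := by rw [hN]; ring
    calc _ ≤ _ := norm_sub_le _ _
      _ ≤ C₂ * ex * ‖x‖ + N * (ex * ‖x‖) := by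
        gcongr
        exact b1.trans (by gcongr)
      _ = (C₂ + N) * ex * ‖x‖ := by ring
      _ ≤ _ := by gcongr; linarith

end AcousticParams

/-! ### Integrable data, scaling, and decay rates in `Ḣ^s`. -/

/-- The Fourier transform on `L²` is given by the Fourier integral for integrable functions. -/
theorem fourier_ae_eq_of_integrable {n : ℕ} {f : L2 n} (hf : Integrable f volume) :
    (𝓕 f : L2 n) =ᵐ[volume] 𝓕 (f : Rn n → ℂ) := by
  have hcont : Continuous (𝓕 (f : Rn n → ℂ)) := by
    exact VectorFourier.fourierIntegral_continuous Real.continuous_fourierChar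
      (innerSL ℝ (E := Rn n)).continuous₂ hf
  refine ae_eq_of_pairing ((memLp_fourier f).locallyIntegrable (by norm_num))
    hcont.locallyIntegrable fun η => ?_
  rw [← toTD_apply_fourier, Lp.toTemperedDistribution_apply]
  have h := VectorFourier.integral_fourierIntegral_smul_eq_flip (L := innerₗ (Rn n))
    Real.continuous_fourierChar (innerSL ℝ (E := Rn n)).continuous₂ hf
    (𝓕⁻ η : 𝓢(Rn n, ℂ)).integrable (μ := volume) (ν := volume)
  have h2 : ∀ x, VectorFourier.fourierIntegral Real.fourierChar volume (innerₗ (Rn n)).flip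
      (𝓕⁻ η : 𝓢(Rn n, ℂ)) x = η x := by
    intro x
    rw [flip_innerₗ]
    have := congrArg (fun ψ : 𝓢(Rn n, ℂ) => ψ x) 
      (show 𝓕 (𝓕⁻ η : 𝓢(Rn n, ℂ)) = η from FourierTransform.fourier_fourierInv_eq η)
    simp only [SchwartzMap.fourier_coe] at this
    exact this
  simp only [h2, smul_eq_mul] at h
  simp only [smul_eq_mul]
  rw [show (∫ x, η x * f x) = ∫ x, f x * η x by simp only [mul_comm]]
  exact h.symm

theorem continuous_fourier_of_integrable {n : ℕ} {f : L2 n} (hf : Integrable f volume) :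
    Continuous (𝓕 (f : Rn n → ℂ)) :=
  VectorFourier.fourierIntegral_continuous Real.continuous_fourierChar
    (innerSL ℝ (E := Rn n)).continuous₂ hf

theorem fourier_apply_zero {n : ℕ} (f : Rn n → ℂ) : 𝓕 f 0 = ∫ x, f x := by
  simp [Real.fourier_eq]

theorem lOneNorm_nonneg {n k : ℕ} (F : Fin k → L2 n) : 0 ≤ lOneNorm F :=
  Finset.sum_nonneg fun _ _ => integral_nonneg fun _ => norm_nonneg _

theorem norm_hat_le_lOneNorm {n k : ℕ} {F : Fin k → L2 n} (hF : ∀ i, Integrable (F i) volume) :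
    ∀ᵐ ξ, ‖hat F ξ‖ ≤ lOneNorm F := by
  filter_upwards [ae_all_iff.2 fun i => fourier_ae_eq_of_integrable (hF i)] with ξ hξ
  refine (pi_norm_le_iff_of_nonneg (lOneNorm_nonneg F)).2 fun i => ?_
  rw [hat, hξ i]
  refine (?_ : _ ≤ ∫ x, ‖F i x‖).trans
    (Finset.single_le_sum (f := fun i => ∫ x, ‖F i x‖)
      (fun _ _ => integral_nonneg fun _ => norm_nonneg _) (Finset.mem_univ i))
  exact VectorFourier.norm_fourierIntegral_le_integral_norm _ _ _ _ _

/-- Apply `y ≤ exp y` to `y = x b / (q + 1)` and raise to the power `q`. The denominator `q + 1`,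
rather than `q`, admits `q = 0`. -/
theorem exists_rpow_le_exp {q b : ℝ} (hq : 0 ≤ q) (hb : 0 < b) :
    ∃ K : ℝ, 0 < K ∧ ∀ x : ℝ, 0 ≤ x → x ^ q ≤ K * Real.exp (b * x) := by
  refine ⟨((q + 1) / b) ^ q, by positivity, fun x hx => ?_⟩
  have h0 : 0 ≤ x * b / (q + 1) := by positivity
  have h1 : x = (q + 1) / b * (x * b / (q + 1)) := by field_simp
  have h2 : (x * b / (q + 1)) ^ q ≤ Real.exp (b * x) := by
    have : x * b / (q + 1) ≤ Real.exp (x * b / (q + 1)) := by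
      linarith [Real.add_one_le_exp (x * b / (q + 1))]
    refine (Real.rpow_le_rpow h0 this hq).trans ?_
    rw [← Real.exp_mul]
    refine Real.exp_le_exp.2 ?_
    rw [div_mul_eq_mul_div, div_le_iff₀ (by positivity)]
    nlinarith [mul_nonneg hx hb.le]
  calc x ^ q = ((q + 1) / b) ^ q * (x * b / (q + 1)) ^ q := by
        rw [← Real.mul_rpow (by positivity) h0, ← h1]
    _ ≤ _ := by gcongr

/-- The substitution `ξ ↦ √τ ξ`. It is the source of the exponent in both the upper bound, with a
Gaussian `φ`, and the lower bound, with the indicator of `r ≤ 1`. -/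
theorem integral_homWeight_comp_mul (n : ℕ) (q : ℝ) (φ : ℝ → ℝ) {τ : ℝ} (hτ : 0 < τ) :
    ∫ ξ : Rn n, (2 * Real.pi * ‖ξ‖) ^ (2 * q) * φ (Real.sqrt τ * (2 * Real.pi * ‖ξ‖))
      = τ ^ (-(n / 2 + q)) * ∫ ξ : Rn n, (2 * Real.pi * ‖ξ‖) ^ (2 * q) * φ (2 * Real.pi * ‖ξ‖) := by
  have h := Measure.integral_comp_smul (volume : Measure (Rn n))
    (fun ξ : Rn n => (2 * Real.pi * ‖ξ‖) ^ (2 * q) * φ (2 * Real.pi * ‖ξ‖)) (Real.sqrt τ)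
  have hs : 0 < Real.sqrt τ := Real.sqrt_pos.2 hτ
  have h1 : ∀ ξ : Rn n, (2 * Real.pi * ‖Real.sqrt τ • ξ‖) ^ (2 * q)
      * φ (2 * Real.pi * ‖Real.sqrt τ • ξ‖) = τ ^ q * ((2 * Real.pi * ‖ξ‖) ^ (2 * q)
        * φ (Real.sqrt τ * (2 * Real.pi * ‖ξ‖))) := by
    intro ξ
    have h2 : 2 * Real.pi * ‖Real.sqrt τ • ξ‖ = Real.sqrt τ * (2 * Real.pi * ‖ξ‖) := by
      rw [norm_smul, Real.norm_of_nonneg hs.le]; ring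
    have h3 : Real.sqrt τ ^ (2 * q) = τ ^ q := by
      rw [Real.sqrt_eq_rpow, ← Real.rpow_mul hτ.le]; congr 1; ring
    rw [h2, Real.mul_rpow hs.le (by positivity), h3]; ring
  simp only [h1] at h
  rw [integral_const_mul, finrank_euclideanSpace, Fintype.card_fin, smul_eq_mul] at h
  have h4 : |(Real.sqrt τ ^ n)⁻¹| = τ ^ (-((n : ℝ) / 2)) := by
    rw [abs_of_pos (by positivity), Real.sqrt_eq_rpow, ← Real.rpow_natCast, ← Real.rpow_mul hτ.le,
      ← Real.rpow_neg hτ.le]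
    congr 1; ring
  rw [h4] at h
  have h5 : τ ^ (-((n : ℝ) / 2 + q)) = τ ^ (-q) * τ ^ (-((n : ℝ) / 2)) := by
    rw [← Real.rpow_add hτ]; congr 1; ring
  rw [h5, mul_assoc, ← h, ← mul_assoc, ← Real.rpow_add hτ]
  simp

theorem integrable_homWeight_gaussian (n : ℕ) {q b : ℝ} (hq : 0 ≤ q) (hb : 0 < b) :
    Integrable (fun ξ : Rn n => (2 * Real.pi * ‖ξ‖) ^ (2 * q)
      * Real.exp (-(b * (2 * Real.pi * ‖ξ‖) ^ 2))) volume := by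
  obtain ⟨K, hK, hle⟩ := exists_rpow_le_exp hq (half_pos hb)
  have hb' : 0 < b / 2 * (2 * Real.pi) ^ 2 := by positivity
  have h1 : Integrable (fun ξ : Rn n => K * Real.exp (-(b / 2 * (2 * Real.pi) ^ 2) * ‖ξ‖ ^ 2))
      volume := by
    have h := GaussianFourier.integrable_cexp_neg_mul_sq_norm_add (V := Rn n)
      (b := ((b / 2 * (2 * Real.pi) ^ 2 : ℝ) : ℂ)) (by rwa [Complex.ofReal_re]) 0 0
    refine (h.norm.const_mul K).congr (Eventually.of_forall fun ξ => ?_)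
    simp only [Complex.norm_exp]
    congr 2
    norm_cast
    simp
  refine h1.mono' ?_ (Eventually.of_forall fun ξ => ?_)
  · exact ((continuous_hom_weight hq).mul (by fun_prop)).aestronglyMeasurable
  · have h0 : 0 ≤ 2 * Real.pi * ‖ξ‖ := by positivity
    rw [Real.norm_of_nonneg (by positivity), Real.rpow_mul h0, Real.rpow_two]
    calc _ ≤ K * Real.exp (b / 2 * (2 * Real.pi * ‖ξ‖) ^ 2)
          * Real.exp (-(b * (2 * Real.pi * ‖ξ‖) ^ 2)) := by
          gcongr; exact hle _ (by positivity)
      _ = _ := by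
          rw [mul_assoc, ← Real.exp_add]; congr 2; ring

/-- The integrand is split at `r = 1`. For `r ≤ 1` the bound `x ≤ L`, later the `L¹` norm, leaves a
Gaussian; for `r ≥ 1` the exponent is at least `c t`, and the `H^s` density remains. The factor `2`
in the squared exponential compensates `1 + r² ≤ 2` below and `1 + r² ≤ 2 r²` above. -/
theorem min_rpow_mul_exp_le {s l c r t : ℝ} (hs : 0 ≤ s) (hl : 0 ≤ l) (hc : 0 < c) (hr : 0 ≤ r)
    (ht : 0 ≤ t) {x L : ℝ} (hx : 0 ≤ x) (hxL : x ≤ L) :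
    r ^ (2 * s) * (min r 1 ^ l * Real.exp (-(c * (r ^ 2 / (1 + r ^ 2)) * t)) * x) ^ 2
      ≤ Real.exp c * L ^ 2 * (r ^ (2 * (s + l)) * Real.exp (-(c * (Real.sqrt (1 + t) * r) ^ 2)))
        + Real.exp (-(c * t)) * ((1 + r ^ 2) ^ s * x ^ 2) := by
  have hm : 0 ≤ min r 1 := le_min hr zero_le_one
  have hexp : Real.exp (-(c * (r ^ 2 / (1 + r ^ 2)) * t)) ^ 2
      = Real.exp (-(c * (2 * r ^ 2 / (1 + r ^ 2)) * t)) := by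
    rw [← Real.exp_nat_mul]; congr 1; push_cast; ring
  rw [mul_pow, mul_pow, hexp]
  rcases le_total r 1 with h1 | h1
  · refine le_add_of_le_of_nonneg ?_ (by positivity)
    have h2 : r ^ 2 ≤ 2 * r ^ 2 / (1 + r ^ 2) := by
      rw [le_div_iff₀ (by positivity)]
      nlinarith [sq_nonneg r, mul_nonneg hr hr, pow_le_one₀ (n := 2) hr h1]
    -- The factor `exp c` replaces `t` by `1 + t` in the Gaussian, at no other cost since `c r² ≤
    -- c`. The estimate then holds down to `t = 0`.
    have h3 : Real.exp (-(c * (2 * r ^ 2 / (1 + r ^ 2)) * t))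
        ≤ Real.exp c * Real.exp (-(c * (Real.sqrt (1 + t) * r) ^ 2)) := by
      rw [← Real.exp_add, mul_pow, Real.sq_sqrt (by linarith)]
      refine Real.exp_le_exp.2 ?_
      have h4 : c * r ^ 2 * t ≤ c * (2 * r ^ 2 / (1 + r ^ 2)) * t := by gcongr
      have h5 : c * r ^ 2 ≤ c * 1 := by gcongr; exact pow_le_one₀ hr h1
      nlinarith
    have h6 : (min r 1 ^ l) ^ 2 = r ^ (2 * l) := by
      rw [min_eq_left h1, ← Real.rpow_two, ← Real.rpow_mul hr]; congr 1; ring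
    have h7 : r ^ (2 * (s + l)) = r ^ (2 * s) * r ^ (2 * l) := by
      rw [mul_add, Real.rpow_add_of_nonneg hr (by positivity) (by positivity)]
    rw [h6, h7]
    calc _ ≤ r ^ (2 * s) * (r ^ (2 * l)
          * (Real.exp c * Real.exp (-(c * (Real.sqrt (1 + t) * r) ^ 2))) * L ^ 2) := by gcongr
      _ = _ := by ring
  · refine le_add_of_nonneg_of_le (by positivity) ?_
    have h2 : 1 ≤ 2 * r ^ 2 / (1 + r ^ 2) := by
      rw [le_div_iff₀ (by positivity)]
      nlinarith
    have h3 : Real.exp (-(c * (2 * r ^ 2 / (1 + r ^ 2)) * t)) ≤ Real.exp (-(c * t)) := by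
      refine Real.exp_le_exp.2 ?_
      have : c * 1 * t ≤ c * (2 * r ^ 2 / (1 + r ^ 2)) * t := by gcongr
      linarith
    have h4 : r ^ (2 * s) ≤ (1 + r ^ 2) ^ s := by
      rw [Real.rpow_mul hr, Real.rpow_two]
      gcongr
      linarith
    rw [min_eq_right h1, Real.one_rpow, one_pow, one_mul]
    calc _ ≤ (1 + r ^ 2) ^ s * (Real.exp (-(c * t)) * x ^ 2) := by gcongr
      _ = _ := by ring

/-- Decay in `Ḣ^s` of a family whose Fourier transform is dominated by
`min(|ξ|, 1)^l exp(-c |ξ|² t / (1 + |ξ|²)) |F̂|`. -/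
theorem exists_homSobolevNorm_decay (n : ℕ) {s l c A : ℝ} (hs : 0 ≤ s) (hl : 0 ≤ l) (hc : 0 < c) :
    ∃ C : ℝ, 0 < C ∧ ∀ (F G : Fin 3 → L2 n) (t : ℝ), 0 ≤ t → InSobolev s F → InSobolev s G →
      (∀ i, Integrable (F i) volume) →
      (∀ᵐ ξ, ‖hat G ξ‖ ≤ A * (min (2 * Real.pi * ‖ξ‖) 1 ^ l * Real.exp (-(c *
        ((2 * Real.pi * ‖ξ‖) ^ 2 / (1 + (2 * Real.pi * ‖ξ‖) ^ 2)) * t)) * ‖hat F ξ‖)) →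
      homSobolevNorm s G ≤ C * (1 + t) ^ (-((n + 2 * s) / 4) - l / 2)
        * (sobolevNorm s F + lOneNorm F) := by
  set M : ℝ := ∫ ξ : Rn n, (2 * Real.pi * ‖ξ‖) ^ (2 * (s + l))
    * Real.exp (-(c * (2 * Real.pi * ‖ξ‖) ^ 2)) with hM
  have hM0 : 0 ≤ M := integral_nonneg fun ξ => by positivity
  set a : ℝ := n / 2 + (s + l) with ha
  have ha0 : 0 ≤ a := by positivity
  obtain ⟨K, hK, hKle⟩ := exists_rpow_le_exp ha0 hc
  set B : ℝ := 3 * A ^ 2 * (Real.exp c * M + K * Real.exp c) with hB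
  have hB0 : 0 ≤ B := by positivity
  refine ⟨Real.sqrt B + 1, by positivity, fun F G t ht hF hG hFi h => ?_⟩
  have hS := sobolevNorm_nonneg s F
  have hL := lOneNorm_nonneg F
  have ht1 : 0 < 1 + t := by linarith
  have hint1 : Integrable (fun ξ : Rn n => (2 * Real.pi * ‖ξ‖) ^ (2 * (s + l))
      * Real.exp (-(c * (Real.sqrt (1 + t) * (2 * Real.pi * ‖ξ‖)) ^ 2))) volume := by
    have := integrable_homWeight_gaussian n (q := s + l) (b := c * (1 + t)) (by positivity)
      (by positivity)
    refine this.congr (Eventually.of_forall fun ξ => ?_)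
    simp only [mul_pow (Real.sqrt (1 + t)), Real.sq_sqrt ht1.le, mul_assoc]
  have hint2 := (inSobolev_iff hs F).mp hF
  have hle : ∫ ξ, (2 * Real.pi * ‖ξ‖) ^ (2 * s) * ‖hat G ξ‖ ^ 2
      ≤ A ^ 2 * (Real.exp c * lOneNorm F ^ 2 * ((1 + t) ^ (-a) * M)
        + Real.exp (-(c * t)) * sobolevNorm s F ^ 2) := by
    have h1 : ∫ ξ, (2 * Real.pi * ‖ξ‖) ^ (2 * s) * ‖hat G ξ‖ ^ 2
        ≤ ∫ ξ, A ^ 2 * (Real.exp c * lOneNorm F ^ 2 * ((2 * Real.pi * ‖ξ‖) ^ (2 * (s + l))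
          * Real.exp (-(c * (Real.sqrt (1 + t) * (2 * Real.pi * ‖ξ‖)) ^ 2)))
          + Real.exp (-(c * t)) * ((1 + (2 * Real.pi * ‖ξ‖) ^ 2) ^ s * ‖hat F ξ‖ ^ 2)) := by
      refine integral_mono_ae (integrable_hom_weight hs hG)
        (((hint1.const_mul _).add (hint2.const_mul _)).const_mul _) ?_
      filter_upwards [h, norm_hat_le_lOneNorm hFi] with ξ hξ hξL
      have hr : 0 ≤ 2 * Real.pi * ‖ξ‖ := by positivity
      have h2 := min_rpow_mul_exp_le hs hl hc hr ht (norm_nonneg (hat F ξ)) hξL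
      have h3 : ‖hat G ξ‖ ^ 2 ≤ A ^ 2 * (min (2 * Real.pi * ‖ξ‖) 1 ^ l * Real.exp (-(c *
          ((2 * Real.pi * ‖ξ‖) ^ 2 / (1 + (2 * Real.pi * ‖ξ‖) ^ 2)) * t)) * ‖hat F ξ‖) ^ 2 := by
        rw [← mul_pow]
        exact pow_le_pow_left₀ (norm_nonneg _) hξ 2
      calc _ ≤ _ := mul_le_mul_of_nonneg_left h3 (by positivity)
        _ = A ^ 2 * ((2 * Real.pi * ‖ξ‖) ^ (2 * s) * (min (2 * Real.pi * ‖ξ‖) 1 ^ l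
            * Real.exp (-(c * ((2 * Real.pi * ‖ξ‖) ^ 2 / (1 + (2 * Real.pi * ‖ξ‖) ^ 2)) * t))
            * ‖hat F ξ‖) ^ 2) := by ring
        _ ≤ _ := mul_le_mul_of_nonneg_left h2 (by positivity)
    refine h1.trans ?_
    rw [integral_const_mul, integral_add (hint1.const_mul _) (hint2.const_mul _),
      integral_const_mul, integral_const_mul]
    rw [integral_homWeight_comp_mul n (s + l) (fun x => Real.exp (-(c * x ^ 2))) ht1]
    gcongr
    exact integral_weight_le_sobolevNorm_sq hs hF
  -- The exponentially small high-frequency part is absorbed into the polynomial rate of the low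
  -- frequencies.
  have hexp : Real.exp (-(c * t)) ≤ K * Real.exp c * (1 + t) ^ (-a) := by
    have h1 := hKle (1 + t) ht1.le
    rw [Real.rpow_neg ht1.le, ← div_eq_mul_inv, le_div_iff₀ (by positivity)]
    calc _ ≤ Real.exp (-(c * t)) * (K * Real.exp (c * (1 + t))) := by gcongr
      _ = K * (Real.exp (-(c * t)) * Real.exp (c * (1 + t))) := by ring
      _ = _ := by rw [← Real.exp_add]; congr 2; ring
  have hfin : homSobolevNorm s G ^ 2
      ≤ B * (1 + t) ^ (-a) * (sobolevNorm s F + lOneNorm F) ^ 2 := by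
    refine (homSobolevNorm_sq_le hs hG).trans ?_
    have h1 : sobolevNorm s F ^ 2 ≤ (sobolevNorm s F + lOneNorm F) ^ 2 := by gcongr; linarith
    have h2 : lOneNorm F ^ 2 ≤ (sobolevNorm s F + lOneNorm F) ^ 2 := by gcongr; linarith
    push_cast
    calc _ ≤ 3 * (A ^ 2 * (Real.exp c * (sobolevNorm s F + lOneNorm F) ^ 2 * ((1 + t) ^ (-a) * M)
        + K * Real.exp c * (1 + t) ^ (-a) * (sobolevNorm s F + lOneNorm F) ^ 2)) := by
          refine mul_le_mul_of_nonneg_left (hle.trans ?_) (by norm_num)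
          gcongr
      _ = _ := by rw [hB]; ring
  have hpow : (1 + t) ^ (-a) = ((1 + t) ^ (-((n + 2 * s) / 4) - l / 2)) ^ 2 := by
    rw [← Real.rpow_two, ← Real.rpow_mul ht1.le]; congr 1; rw [ha]; ring
  have hB' : B ≤ (Real.sqrt B + 1) ^ 2 := by nlinarith [Real.sq_sqrt hB0, Real.sqrt_nonneg B]
  refine le_of_sq_le_sq ?_ (by positivity)
  calc _ ≤ _ := hfin
    _ ≤ (Real.sqrt B + 1) ^ 2 * (1 + t) ^ (-a) * (sobolevNorm s F + lOneNorm F) ^ 2 := by gcongr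
    _ = _ := by rw [hpow]; ring

theorem homSobolevNorm_nonneg {n k : ℕ} (s : ℝ) (F : Fin k → L2 n) : 0 ≤ homSobolevNorm s F :=
  Real.sqrt_nonneg _

/-- For `s > 0` the weight vanishes at the origin. As `n ≥ 1`, the origin is a null set and a small
punctured ball has positive measure. -/
theorem integral_homWeight_ball_pos {n : ℕ} (hn : 1 ≤ n) {s : ℝ} (hs : 0 ≤ s) :
    Integrable (fun ξ : Rn n => (2 * Real.pi * ‖ξ‖) ^ (2 * s)
        * (Iic (1 : ℝ)).indicator (fun _ => (1 : ℝ)) (2 * Real.pi * ‖ξ‖)) volume ∧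
      0 < ∫ ξ : Rn n, (2 * Real.pi * ‖ξ‖) ^ (2 * s)
        * (Iic (1 : ℝ)).indicator (fun _ => (1 : ℝ)) (2 * Real.pi * ‖ξ‖) := by
  have : Nontrivial (Rn n) := by
    have : Nonempty (Fin n) := ⟨⟨0, hn⟩⟩
    infer_instance
  have hind : ∀ x : ℝ, 0 ≤ (Iic (1 : ℝ)).indicator (fun _ => (1 : ℝ)) x :=
    fun x => indicator_nonneg (fun _ _ => zero_le_one) x
  have hint : Integrable (fun ξ : Rn n => (2 * Real.pi * ‖ξ‖) ^ (2 * s)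
        * (Iic (1 : ℝ)).indicator (fun _ => (1 : ℝ)) (2 * Real.pi * ‖ξ‖)) volume := by
    refine ((integrable_homWeight_gaussian n hs one_pos).const_mul (Real.exp 1)).mono' ?_ ?_
    · refine (continuous_hom_weight hs).aestronglyMeasurable.mul ?_
      exact ((measurable_const.indicator measurableSet_Iic).comp
        (by fun_prop : Measurable fun ξ : Rn n => 2 * Real.pi * ‖ξ‖)).aestronglyMeasurable
    · refine Eventually.of_forall fun ξ => ?_
      have hr : 0 ≤ 2 * Real.pi * ‖ξ‖ := by positivity
      rw [Real.norm_of_nonneg (mul_nonneg (by positivity) (hind _)), mul_left_comm, ← Real.exp_add]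
      refine mul_le_mul_of_nonneg_left ?_ (by positivity)
      by_cases h : 2 * Real.pi * ‖ξ‖ ∈ Iic (1 : ℝ)
      · rw [indicator_of_mem h]
        have := pow_le_one₀ (n := 2) hr h
        exact Real.one_le_exp (by linarith)
      · rw [indicator_of_notMem h]
        positivity
  refine ⟨hint, ?_⟩
  rw [integral_pos_iff_support_of_nonneg (fun ξ => mul_nonneg (by positivity) (hind _)) hint]
  have h1 : 0 < volume (Metric.ball (0 : Rn n) (1 / (2 * Real.pi)) \ {0}) := by
    rw [measure_sdiff_null (measure_singleton _)]
    exact Metric.measure_ball_pos _ _ (by positivity)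
  refine h1.trans_le (measure_mono ?_)
  rintro ξ ⟨hξ, hξ0⟩
  have h2 : 0 < ‖ξ‖ := norm_pos_iff.2 hξ0
  have h3 : 2 * Real.pi * ‖ξ‖ ∈ Iic (1 : ℝ) := by
    rw [mem_ball_zero_iff, lt_div_iff₀ (by positivity)] at hξ
    rw [mem_Iic]; linarith
  rw [Function.mem_support, indicator_of_mem h3]
  positivity

theorem norm_meanVec_le {n : ℕ} (F : Fin 3 → L2 n) :
    ‖meanVec F‖ ≤ 2 * ‖fun i => ∫ x, F i x‖ := by
  rw [meanVec, EuclideanSpace.norm_eq]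
  refine Real.sqrt_le_iff.2 ⟨by positivity, ?_⟩
  have h : ∀ i, ‖∫ x, F i x‖ ≤ ‖fun i => ∫ x, F i x‖ :=
    fun i => norm_le_pi_norm (fun i => ∫ x, F i x) i
  calc _ ≤ ∑ _i : Fin 3, ‖fun i => ∫ x, F i x‖ ^ 2 := by
        refine Finset.sum_le_sum fun i _ => ?_
        exact pow_le_pow_left₀ (norm_nonneg _) (h i) 2
    _ ≤ _ := by simp; nlinarith [sq_nonneg ‖fun i => ∫ x, F i x‖]

/-- The transform of an integrable function is continuous and its value at `0` is the mean. The
Euclidean norm is at most twice the supremum norm, so `‖P‖/4` lies strictly below the value at `0`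
and survives nearby. -/
theorem exists_le_norm_hat {n : ℕ} {F : Fin 3 → L2 n} (hF : ∀ i, Integrable (F i) volume)
    (h0 : meanVec F ≠ 0) :
    ∃ δ : ℝ, 0 < δ ∧ ∀ᵐ ξ, 2 * Real.pi * ‖ξ‖ ≤ δ → ‖meanVec F‖ / 4 ≤ ‖hat F ξ‖ := by
  have hpos : 0 < ‖meanVec F‖ := norm_pos_iff.2 h0
  have hcont : Continuous (fun ξ : Rn n => ‖fun i => 𝓕 (F i : Rn n → ℂ) ξ‖) :=
    (continuous_pi fun i => continuous_fourier_of_integrable (hF i)).norm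
  have hval : ‖meanVec F‖ / 4 < ‖fun i => 𝓕 (F i : Rn n → ℂ) 0‖ := by
    simp only [fourier_apply_zero]
    linarith [norm_meanVec_le F]
  obtain ⟨δ, hδ, hball⟩ := Metric.eventually_nhds_iff.1
    (hcont.continuousAt.eventually (lt_mem_nhds hval))
  refine ⟨δ, hδ, ?_⟩
  filter_upwards [ae_all_iff.2 fun i => fourier_ae_eq_of_integrable (hF i)] with ξ hξ hle
  have h1 : hat F ξ = fun i => 𝓕 (F i : Rn n → ℂ) ξ := funext hξ
  rw [h1]
  rcases eq_or_ne ξ 0 with rfl | hne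
  · exact hval.le
  · refine (hball ?_).le
    have h2 : 0 < ‖ξ‖ := norm_pos_iff.2 hne
    rw [dist_zero_right]
    nlinarith [Real.pi_gt_three]

/-- Lower bound in `Ḣ^s` for a family whose Fourier transform dominates a heat kernel times
`|F̂|`, when `F` has nonzero mean. -/
theorem exists_homSobolevNorm_lower {n : ℕ} (hn : 1 ≤ n) {s κ : ℝ} (d : ℝ) (hs : 0 ≤ s)
    (hκ : 0 < κ) :
    ∃ c : ℝ, 0 < c ∧ ∀ (F : Fin 3 → L2 n) (G : ℝ → Fin 3 → L2 n),
      (∀ i, Integrable (F i) volume) → meanVec F ≠ 0 → (∀ t, 0 ≤ t → InSobolev s (G t)) →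
      (∀ t, 0 ≤ t → ∀ᵐ ξ, κ * (Real.exp (-(d * (2 * Real.pi * ‖ξ‖) ^ 2 * t)) * ‖hat F ξ‖)
        ≤ ‖hat (G t) ξ‖) →
      ∃ t₀ : ℝ, 1 ≤ t₀ ∧ ∀ t, t₀ ≤ t →
        c * t ^ (-((n + 2 * s) / 4)) * ‖meanVec F‖ ≤ homSobolevNorm s (G t) := by
  obtain ⟨hVint, hV⟩ := integral_homWeight_ball_pos hn hs
  set V : ℝ := ∫ ξ : Rn n, (2 * Real.pi * ‖ξ‖) ^ (2 * s)
        * (Iic (1 : ℝ)).indicator (fun _ => (1 : ℝ)) (2 * Real.pi * ‖ξ‖) with hVdef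
  set k : ℝ := κ * Real.exp (-|d|) / 4 with hk
  have hk0 : 0 < k := by positivity
  refine ⟨k * Real.sqrt V, by positivity, fun F G hF h0 hG h => ?_⟩
  obtain ⟨δ, hδ, hFδ⟩ := exists_le_norm_hat hF h0
  -- From this time on the ball `r ≤ t^(-1/2)` lies in the region `r ≤ δ` where `F̂` is bounded
  -- below. On that ball the heat factor is at least `exp(-|d|)`.
  refine ⟨max 1 (1 / δ ^ 2), le_max_left _ _, fun t ht => ?_⟩
  have ht1 : 1 ≤ t := (le_max_left _ _).trans ht
  have ht0 : 0 < t := by linarith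
  have htδ : 1 / δ ≤ Real.sqrt t := by
    refine Real.le_sqrt_of_sq_le ?_
    rw [div_pow, one_pow]
    exact (le_max_right _ _).trans ht
  have hst : 0 < Real.sqrt t := Real.sqrt_pos.2 ht0
  have hint : Integrable (fun ξ : Rn n => (2 * Real.pi * ‖ξ‖) ^ (2 * s)
        * (Iic (1 : ℝ)).indicator (fun _ => (1 : ℝ)) (Real.sqrt t * (2 * Real.pi * ‖ξ‖))) volume := by
    refine hVint.mono' ?_ (Eventually.of_forall fun ξ => ?_)
    · refine (continuous_hom_weight hs).aestronglyMeasurable.mul ?_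
      exact ((measurable_const.indicator measurableSet_Iic).comp
        (by fun_prop : Measurable fun ξ : Rn n =>
          Real.sqrt t * (2 * Real.pi * ‖ξ‖))).aestronglyMeasurable
    · rw [Real.norm_of_nonneg (mul_nonneg (by positivity)
        (indicator_nonneg (fun _ _ => zero_le_one) _))]
      refine mul_le_mul_of_nonneg_left ?_ (by positivity)
      by_cases hm : Real.sqrt t * (2 * Real.pi * ‖ξ‖) ∈ Iic (1 : ℝ)
      · have hm' : 2 * Real.pi * ‖ξ‖ ∈ Iic (1 : ℝ) := by
          rw [mem_Iic] at hm ⊢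
          refine le_trans ?_ hm
          exact le_mul_of_one_le_left (by positivity) (Real.one_le_sqrt.2 ht1)
        rw [indicator_of_mem hm, indicator_of_mem hm']
      · rw [indicator_of_notMem hm]
        exact indicator_nonneg (fun _ _ => zero_le_one) _
  have hle : (k * ‖meanVec F‖) ^ 2 * (t ^ (-((n : ℝ) / 2 + s)) * V) ≤ homSobolevNorm s (G t) ^ 2 := by
    refine le_trans ?_ (integral_hom_weight_le hs (hG t ht0.le))
    rw [hVdef, ← integral_homWeight_comp_mul n s _ ht0, ← integral_const_mul]
    refine integral_mono_ae (hint.const_mul _) (integrable_hom_weight hs (hG t ht0.le)) ?_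
    filter_upwards [h t ht0.le, hFδ] with ξ hξ hξδ
    by_cases hm : Real.sqrt t * (2 * Real.pi * ‖ξ‖) ∈ Iic (1 : ℝ)
    · have hr : 0 ≤ 2 * Real.pi * ‖ξ‖ := by positivity
      rw [indicator_of_mem hm]
      rw [mem_Iic] at hm
      have h1 : 2 * Real.pi * ‖ξ‖ ≤ δ := by
        have h2 : 2 * Real.pi * ‖ξ‖ ≤ 1 / Real.sqrt t := by
          rw [le_div_iff₀ hst]; linarith
        exact h2.trans (by rw [div_le_iff₀ hst, mul_comm]; rwa [div_le_iff₀ hδ] at htδ)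
      have h2 : (2 * Real.pi * ‖ξ‖) ^ 2 * t ≤ 1 := by
        have : (Real.sqrt t * (2 * Real.pi * ‖ξ‖)) ^ 2 ≤ 1 := pow_le_one₀ (by positivity) hm
        rw [mul_pow, Real.sq_sqrt ht0.le] at this
        linarith
      have h3 : Real.exp (-|d|) ≤ Real.exp (-(d * (2 * Real.pi * ‖ξ‖) ^ 2 * t)) := by
        refine Real.exp_le_exp.2 (neg_le_neg ?_)
        calc d * (2 * Real.pi * ‖ξ‖) ^ 2 * t ≤ |d| * ((2 * Real.pi * ‖ξ‖) ^ 2 * t) := by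
              rw [mul_assoc]; gcongr; exact le_abs_self d
          _ ≤ |d| * 1 := by gcongr
          _ = |d| := mul_one _
      have h4 : k * ‖meanVec F‖ ≤ ‖hat (G t) ξ‖ := by
        refine le_trans ?_ hξ
        rw [hk]
        calc _ = κ * (Real.exp (-|d|) * (‖meanVec F‖ / 4)) := by ring
          _ ≤ _ := by gcongr; exact hξδ h1
      calc _ = (2 * Real.pi * ‖ξ‖) ^ (2 * s) * (k * ‖meanVec F‖) ^ 2 := by ring
        _ ≤ _ := by gcongr
    · rw [indicator_of_notMem hm]
      simp only [mul_zero]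
      positivity
  refine le_of_sq_le_sq ?_ (homSobolevNorm_nonneg s (G t))
  refine le_trans (le_of_eq ?_) hle
  have hpow : t ^ (-((n : ℝ) / 2 + s)) = (t ^ (-((n + 2 * s) / 4))) ^ 2 := by
    rw [← Real.rpow_two, ← Real.rpow_mul ht0.le]; congr 1; ring
  rw [hpow, mul_pow, mul_pow, mul_pow, Real.sq_sqrt hV.le]
  ring

/-- A triangle inequality with a crude constant: `3 · 2 ≤ 3²`, the `3` from changing norms on `ℂ³`
and the `2` from squaring a sum. -/
theorem homSobolevNorm_le_add {n : ℕ} {s : ℝ} (hs : 0 ≤ s) {F G : Fin 3 → L2 n}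
    (hF : InSobolev s F) (hG : InSobolev s G) :
    homSobolevNorm s G ≤ 3 * (homSobolevNorm s F + homSobolevNorm s (F - G)) := by
  have hFG := hF.sub hG
  have h1 : ∫ ξ, (2 * Real.pi * ‖ξ‖) ^ (2 * s) * ‖hat G ξ‖ ^ 2
      ≤ 2 * (∫ ξ, (2 * Real.pi * ‖ξ‖) ^ (2 * s) * ‖hat F ξ‖ ^ 2)
        + 2 * ∫ ξ, (2 * Real.pi * ‖ξ‖) ^ (2 * s) * ‖hat (F - G) ξ‖ ^ 2 := by
    have hiF := (integrable_hom_weight hs hF).const_mul 2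
    have hiD := (integrable_hom_weight hs hFG).const_mul 2
    rw [← integral_const_mul, ← integral_const_mul, ← integral_add hiF hiD]
    refine integral_mono_ae (integrable_hom_weight hs hG) (hiF.add hiD) ?_
    filter_upwards [hat_sub_ae F G] with ξ hξ
    have h2 : ‖hat G ξ‖ ≤ ‖hat F ξ‖ + ‖hat (F - G) ξ‖ := by
      have : hat G ξ = hat F ξ - hat (F - G) ξ := by rw [hξ]; abel
      rw [this]; exact norm_sub_le _ _
    have h3 : ‖hat G ξ‖ ^ 2 ≤ 2 * ‖hat F ξ‖ ^ 2 + 2 * ‖hat (F - G) ξ‖ ^ 2 := by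
      nlinarith [norm_nonneg (hat G ξ), sq_nonneg (‖hat F ξ‖ - ‖hat (F - G) ξ‖)]
    calc _ ≤ (2 * Real.pi * ‖ξ‖) ^ (2 * s) * (2 * ‖hat F ξ‖ ^ 2 + 2 * ‖hat (F - G) ξ‖ ^ 2) := by
          gcongr
      _ = _ := by ring
  have h2 := homSobolevNorm_sq_le hs hG
  have h3 := integral_hom_weight_le hs hF
  have h4 := integral_hom_weight_le hs hFG
  have h5 := homSobolevNorm_nonneg s F
  have h6 := homSobolevNorm_nonneg s (F - G)
  refine le_of_sq_le_sq ?_ (by positivity)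
  push_cast at h2
  nlinarith [mul_nonneg h5 h6]

/-! ### Integrated equations by components, and the reference system. -/

theorem eq_zero_of_integrated_rows {n : ℕ} {C : ℝ} {P : Fin 3 → Fin 3 → Rn n → ℂ}
    (hP : ∀ i j ξ, ‖P i j ξ‖ ≤ C * (1 + ‖ξ‖ ^ 2)) {w : ℝ → Fin 3 → L2 n}
    (hw : ∀ j, ContinuousOn (fun t => w t j) (Ici 0))
    (h : ∀ t, 0 ≤ t → ∀ i, ∀ᵐ ξ, (𝓕 (w t i) : L2 n) ξ
      = ∑ j, P i j ξ * (𝓕 (∫ τ in 0..t, w τ j) : L2 n) ξ) :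
    ∀ t, 0 ≤ t → w t = 0 := by
  have hC : 0 ≤ C := by simpa using (norm_nonneg _).trans (hP 0 0 0)
  refine eq_zero_of_integrated (C := 3 * C) hw fun t ht => ?_
  filter_upwards [ae_all_iff.2 (h t ht)] with ξ hξ
  refine (pi_norm_le_iff_of_nonneg (by positivity)).2 fun i => ?_
  rw [hat, hξ i]
  calc _ ≤ ∑ j, ‖P i j ξ * (𝓕 (∫ τ in 0..t, w τ j) : L2 n) ξ‖ := norm_sum_le _ _
    _ ≤ ∑ _j : Fin 3, C * (1 + ‖ξ‖ ^ 2) * ‖hat (fun j => ∫ τ in 0..t, w τ j) ξ‖ := by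
        refine Finset.sum_le_sum fun j _ => ?_
        rw [norm_mul]
        exact mul_le_mul (hP i j ξ)
          (norm_le_pi_norm (hat (fun j => ∫ τ in 0..t, w τ j) ξ) j) (norm_nonneg _) (by positivity)
    _ = _ := by simp; ring

/-- The integrated form of an evolution equation for one component of a path starting at `0`. -/
theorem integrated_component {n : ℕ} {p : Fin 3 → Rn n → ℂ} {C : ℝ} (i : Fin 3)
    (hp : ∀ j, AEStronglyMeasurable (p j) volume) (hpC : ∀ j ξ, ‖p j ξ‖ ≤ C * (1 + ‖ξ‖ ^ 2))
    {w : ℝ → Fin 3 → L2 n} (hw : ∀ j, ContinuousOn (fun t => w t j) (Ici 0)) (h0 : w 0 = 0)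
    (h : ∀ t, 0 < t → ∀ η : 𝓢(Rn n, ℂ), HasDerivAt (fun τ => (w τ i : TD n) η)
      (∫ ξ, (∑ j, p j ξ * (𝓕 (w t j) : L2 n) ξ) * (𝓕⁻ η : 𝓢(Rn n, ℂ)) ξ) t)
    {t : ℝ} (ht : 0 ≤ t) :
    ∀ᵐ ξ, (𝓕 (w t i) : L2 n) ξ = ∑ j, p j ξ * (𝓕 (∫ τ in 0..t, w τ j) : L2 n) ξ := by
  have hC : 0 ≤ C := by simpa using (norm_nonneg _).trans (hpC 0 0)
  have hsum : ∀ (x : Fin 3 → ℂ), ∑ j, (Pi.single i 1 : Fin 3 → ℂ) j * x j = x i := by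
    intro x; simp [Pi.single_apply]
  have hle : ∀ j (ξ : Rn n), ‖(Pi.single i 1 : Fin 3 → ℂ) j‖ ≤ max C 1 * (1 + ‖ξ‖ ^ 2) := by
    intro j ξ
    have h1 : ‖(Pi.single i 1 : Fin 3 → ℂ) j‖ ≤ 1 := by
      rw [Pi.single_apply]; split_ifs <;> simp
    have h2 : (1 : ℝ) * 1 ≤ max C 1 * (1 + ‖ξ‖ ^ 2) :=
      mul_le_mul (le_max_right _ _) (by nlinarith [sq_nonneg ‖ξ‖]) zero_le_one (by positivity)
    linarith
  -- The unit row selects component `i` on the left-hand side; its entries have modulus at most `1`,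
  -- hence `max C 1`.
  have hint := integrated_equation (C := max C 1) (q := fun j _ => (Pi.single i 1 : Fin 3 → ℂ) j)
    (p := p) (fun j => aestronglyMeasurable_const) hle hp
    (fun j ξ => (hpC j ξ).trans (by gcongr; exact le_max_left _ _)) hw (fun t ht η => by
      refine (h t ht η).congr_of_eventuallyEq (Eventually.of_forall fun τ => ?_)
      simp only [hsum, toTD_apply_fourier]) ht
  have hz : ∀ᵐ ξ, (𝓕 (w 0 i) : L2 n) ξ = 0 := by
    filter_upwards [fourier_sub_ae (0 : L2 n) 0] with ξ hξ
    rw [h0, Pi.zero_apply]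
    rwa [sub_zero, sub_self] at hξ
  filter_upwards [hint, hz] with ξ hξ hξ0
  rw [hsum (fun j => (𝓕 (w t j) : L2 n) ξ - (𝓕 (w 0 j) : L2 n) ξ), hξ0, sub_zero] at hξ
  exact hξ

theorem norm_frequency_le {n : ℕ} (ξ : Rn n) :
    ‖((2 * Real.pi * ‖ξ‖ : ℝ) : ℂ)‖ ≤ (2 * Real.pi) ^ 2 * (1 + ‖ξ‖ ^ 2) := by
  have := one_add_frequency_sq_le ξ
  rw [Complex.norm_real, Real.norm_of_nonneg (by positivity)]
  nlinarith [sq_nonneg (2 * Real.pi * ‖ξ‖ - 1)]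

theorem norm_frequency_sq_le {n : ℕ} (ξ : Rn n) :
    ‖(((2 * Real.pi * ‖ξ‖) ^ 2 : ℝ) : ℂ)‖ ≤ (2 * Real.pi) ^ 2 * (1 + ‖ξ‖ ^ 2) := by
  have := one_add_frequency_sq_le ξ
  rw [Complex.norm_real, Real.norm_of_nonneg (by positivity)]
  linarith

theorem norm_frequency_combination_le {n : ℕ} (a b : ℂ) (ξ : Rn n) :
    ‖a * ((2 * Real.pi * ‖ξ‖ : ℝ) : ℂ) + b * (((2 * Real.pi * ‖ξ‖) ^ 2 : ℝ) : ℂ)‖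
      ≤ (‖a‖ + ‖b‖) * (2 * Real.pi) ^ 2 * (1 + ‖ξ‖ ^ 2) := by
  calc _ ≤ _ := norm_add_le _ _
    _ ≤ ‖a‖ * ((2 * Real.pi) ^ 2 * (1 + ‖ξ‖ ^ 2)) + ‖b‖ * ((2 * Real.pi) ^ 2 * (1 + ‖ξ‖ ^ 2)) := by
        rw [norm_mul, norm_mul]
        gcongr
        · exact norm_frequency_le ξ
        · exact norm_frequency_sq_le ξ
    _ = _ := by ring

theorem aestronglyMeasurable_frequency_combination {n : ℕ} (a b : ℂ) :
    AEStronglyMeasurable (fun ξ : Rn n => a * ((2 * Real.pi * ‖ξ‖ : ℝ) : ℂ)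
      + b * (((2 * Real.pi * ‖ξ‖) ^ 2 : ℝ) : ℂ)) volume := by
  have : Continuous (fun ξ : Rn n => a * ((2 * Real.pi * ‖ξ‖ : ℝ) : ℂ)
      + b * (((2 * Real.pi * ‖ξ‖) ^ 2 : ℝ) : ℂ)) := by fun_prop
  exact this.aestronglyMeasurable

theorem integrable_frequency_pairing {n : ℕ} (f : L2 n) (ψ : 𝓢(Rn n, ℂ)) :
    Integrable (fun ξ => ((2 * Real.pi * ‖ξ‖ : ℝ) : ℂ) * (𝓕 f : L2 n) ξ * ψ ξ) volume :=
  integrable_symbol_pairing (p := fun ξ => ((2 * Real.pi * ‖ξ‖ : ℝ) : ℂ))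
    (by fun_prop : Continuous fun ξ : Rn n => ((2 * Real.pi * ‖ξ‖ : ℝ) : ℂ)).aestronglyMeasurable
    norm_frequency_le f ψ

theorem integrable_frequency_sq_pairing {n : ℕ} (f : L2 n) (ψ : 𝓢(Rn n, ℂ)) :
    Integrable (fun ξ => (((2 * Real.pi * ‖ξ‖) ^ 2 : ℝ) : ℂ) * (𝓕 f : L2 n) ξ * ψ ξ) volume :=
  integrable_symbol_pairing (p := fun ξ => (((2 * Real.pi * ‖ξ‖) ^ 2 : ℝ) : ℂ))
    (by fun_prop :
      Continuous fun ξ : Rn n => (((2 * Real.pi * ‖ξ‖) ^ 2 : ℝ) : ℂ)).aestronglyMeasurable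
    norm_frequency_sq_le f ψ

theorem integral_frequency_combination {n : ℕ} (a b : ℂ) (f g : L2 n) (ψ : 𝓢(Rn n, ℂ)) :
    ∫ ξ, (a * (((2 * Real.pi * ‖ξ‖ : ℝ) : ℂ) * (𝓕 f : L2 n) ξ * ψ ξ)
        + b * ((((2 * Real.pi * ‖ξ‖) ^ 2 : ℝ) : ℂ) * (𝓕 g : L2 n) ξ * ψ ξ))
      = a * (∫ ξ, ((2 * Real.pi * ‖ξ‖ : ℝ) : ℂ) * (𝓕 f : L2 n) ξ * ψ ξ)
        + b * ∫ ξ, (((2 * Real.pi * ‖ξ‖) ^ 2 : ℝ) : ℂ) * (𝓕 g : L2 n) ξ * ψ ξ := by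
  rw [integral_add ((integrable_frequency_pairing f ψ).const_mul a)
    ((integrable_frequency_sq_pairing g ψ).const_mul b), integral_const_mul, integral_const_mul]

theorem laplacian_toTD_apply' {n : ℕ} (f : L2 n) (η : 𝓢(Rn n, ℂ)) :
    (Δ (f : TD n)) η = -∫ ξ, (((2 * Real.pi * ‖ξ‖) ^ 2 : ℝ) : ℂ) * (𝓕 f : L2 n) ξ *
      (𝓕⁻ η : 𝓢(Rn n, ℂ)) ξ := by
  rw [laplacian_toTD_apply, ← integral_neg]
  simp only [neg_mul]

theorem IsAbsD.laplacian_apply' {n : ℕ} {u : TD n} {g : L2 n} (hu : IsAbsD u g)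
    (η : 𝓢(Rn n, ℂ)) : (Δ u) η = -∫ ξ, ((2 * Real.pi * ‖ξ‖ : ℝ) : ℂ) * (𝓕 g : L2 n) ξ *
      (𝓕⁻ η : 𝓢(Rn n, ℂ)) ξ := by
  rw [hu.laplacian_apply, ← integral_neg]
  simp only [neg_mul]

namespace AcousticParams

variable (p : AcousticParams) {n : ℕ}

theorem reference_pairing (f : L2 n) (j : Fin 3) (η : 𝓢(Rn n, ℂ)) :
    -(p.waveCoeff j * symbolPairing (fun ξ => (‖ξ‖ : ℂ)) f η)
        + p.diffCoeff j * (Δ (f : TD n)) η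
      = ∫ ξ, (-p.waveCoeff j * ((2 * Real.pi * ‖ξ‖ : ℝ) : ℂ)
        + -p.diffCoeff j * (((2 * Real.pi * ‖ξ‖) ^ 2 : ℝ) : ℂ)) * (𝓕 f : L2 n) ξ *
        (𝓕⁻ η : 𝓢(Rn n, ℂ)) ξ := by
  have h := integral_frequency_combination (-p.waveCoeff j) (-p.diffCoeff j) f f (𝓕⁻ η)
  rw [symbolPairing_norm, laplacian_toTD_apply']
  rw [show ∀ x y : ℂ, -(p.waveCoeff j * x) + p.diffCoeff j * -y
    = -p.waveCoeff j * x + -p.diffCoeff j * y from fun x y => by ring, ← h]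
  refine integral_congr_ae (Eventually.of_forall fun ξ => ?_)
  simp only
  ring

/-- The solution of the reference system with given initial value. -/
noncomputable def referenceEvolution (F₀ : Fin 3 → L2 n) (t : ℝ) : Fin 3 → L2 n :=
  evolution p.refWaveSymbol p.refDampSymbol F₀ t

theorem isReferenceSolution_referenceEvolution {s : ℝ} (hs : 0 ≤ s) {F₀ : Fin 3 → L2 n}
    (hF : InSobolev s F₀) : IsReferenceSolution p s F₀ (p.referenceEvolution F₀) where
  init := evolution_zero p.refPropagator_bound F₀
  equation := by
    intro t ht j η
    rw [reference_pairing]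
    have h := hasDerivAt_evolution_pairing p.refPropagator_bound F₀ ht j (𝓕⁻ η)
    simp only [toTD_apply_fourier]
    refine h.congr_deriv (integral_congr_ae (Eventually.of_forall fun ξ => ?_))
    simp only [refSymbol_apply]
    simp only [hat, referenceEvolution]
    push_cast
    ring
  cont := continuousInSobolev_evolution hs p.refPropagator_bound hF

theorem referenceSolution_unique {s : ℝ} (hs : 0 ≤ s) {F₀ : Fin 3 → L2 n}
    {Ψ Ψ' : ℝ → Fin 3 → L2 n} (h : IsReferenceSolution p s F₀ Ψ)
    (h' : IsReferenceSolution p s F₀ Ψ') {t : ℝ} (ht : 0 ≤ t) : Ψ' t = Ψ t := by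
  set P : Fin 3 → Fin 3 → Rn n → ℂ := fun i j ξ => if j = i then
    -p.waveCoeff i * ((2 * Real.pi * ‖ξ‖ : ℝ) : ℂ)
        + -p.diffCoeff i * (((2 * Real.pi * ‖ξ‖) ^ 2 : ℝ) : ℂ) else 0 with hPdef
  set C : ℝ := ∑ i, (‖-p.waveCoeff i‖ + ‖-p.diffCoeff i‖) * (2 * Real.pi) ^ 2 with hC
  have hP : ∀ i j ξ, ‖P i j ξ‖ ≤ C * (1 + ‖ξ‖ ^ 2) := by
    intro i j ξ
    have h1 : (‖-p.waveCoeff i‖ + ‖-p.diffCoeff i‖) * (2 * Real.pi) ^ 2 ≤ C :=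
      Finset.single_le_sum (f := fun i => (‖-p.waveCoeff i‖ + ‖-p.diffCoeff i‖) * (2 * Real.pi) ^ 2)
        (fun i _ => by positivity) (Finset.mem_univ i)
    have hC0 : 0 ≤ C := le_trans (by positivity) h1
    simp only [hPdef]
    split_ifs
    · exact (norm_frequency_combination_le _ _ ξ).trans (by gcongr)
    · rw [norm_zero]; positivity
  have hPm : ∀ i j, AEStronglyMeasurable (P i j) volume := by
    intro i j
    simp only [hPdef]
    split_ifs
    · exact aestronglyMeasurable_frequency_combination _ _
    · exact aestronglyMeasurable_const
  have hw : ∀ j, ContinuousOn (fun t => (Ψ' t - Ψ t) j) (Ici 0) := fun j =>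
    (h'.cont.continuousOn hs j).sub (h.cont.continuousOn hs j)
  have key := eq_zero_of_integrated_rows hP hw (fun t ht i =>
    integrated_component i (hPm i) (hP i) hw (by rw [h.init, h'.init, sub_self])
      (fun t ht η => by
        have hd := (h'.equation t ht i η).sub (h.equation t ht i η)
        have hfun : ∀ τ, (((Ψ' τ - Ψ τ) i : L2 n) : TD n) η
            = (Ψ' τ i : TD n) η - (Ψ τ i : TD n) η := by
          intro τ
          rw [Pi.sub_apply, toTD_sub]; rfl
        simp only [hfun]
        refine hd.congr_deriv ?_
        obtain ⟨Λ, hΛ⟩ := exists_row_clm (hPm i) (hP i) (𝓕⁻ η)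
        have hrow : ∀ F : Fin 3 → L2 n, -(p.waveCoeff i * symbolPairing (fun ξ => (‖ξ‖ : ℂ)) (F i) η)
            + p.diffCoeff i * (Δ (F i : TD n)) η = Λ F := by
          intro F
          rw [hΛ, reference_pairing]
          simp [hPdef]
        rw [hrow, hrow, ← map_sub, hΛ]) ht)
  exact sub_eq_zero.1 (key t ht)

end AcousticParams

/-! ### Uniqueness for the acoustic system. -/

/-- At `ξ ≠ 0` some coordinate is nonzero, and the Riesz symbol in that direction can be cancelled.
The origin is negligible because `n ≥ 1`. -/
theorem eq_of_riesz_eq {n : ℕ} (hn : 1 ≤ n) {x y : Rn n → ℂ}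
    (h : ∀ m : Rn n, ∀ᵐ ξ, Complex.I * ((inner ℝ m ξ / ‖ξ‖ : ℝ) : ℂ) * x ξ
      = Complex.I * ((inner ℝ m ξ / ‖ξ‖ : ℝ) : ℂ) * y ξ) : x =ᵐ[volume] y := by
  have : Nontrivial (Rn n) := by
    have : Nonempty (Fin n) := ⟨⟨0, hn⟩⟩
    infer_instance
  have h0 : ∀ᵐ ξ : Rn n, ξ ≠ 0 := by
    simp [ae_iff]
  filter_upwards [ae_all_iff.2 fun i : Fin n => h (EuclideanSpace.single i 1), h0] with ξ hξ hξ0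
  obtain ⟨i, hi⟩ : ∃ i, ξ i ≠ 0 := by
    by_contra! hc
    exact hξ0 (by ext i; simpa using hc i)
  refine mul_left_cancel₀ ?_ (hξ i)
  have h1 : inner ℝ (EuclideanSpace.single i (1 : ℝ)) ξ = ξ i := by
    simp [EuclideanSpace.inner_single_left]
  rw [h1]
  have h2 : ξ i / ‖ξ‖ ≠ 0 := div_ne_zero hi (norm_ne_zero_iff.2 hξ0)
  exact mul_ne_zero Complex.I_ne_zero (Complex.ofReal_ne_zero.2 h2)

theorem norm_riesz_le {n : ℕ} (m ξ : Rn n) :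
    ‖Complex.I * ((inner ℝ m ξ / ‖ξ‖ : ℝ) : ℂ)‖ ≤ ‖m‖ := by
  rw [norm_mul, Complex.norm_I, one_mul, Complex.norm_real, Real.norm_eq_abs]
  exact abs_inner_div_norm_le m ξ

theorem IsAbsD.unique {n : ℕ} (hn : 1 ≤ n) {u : TD n} {g g' : L2 n} (h : IsAbsD u g)
    (h' : IsAbsD u g') : g' = g := by
  have hloc : ∀ (m : Rn n) (f : L2 n), LocallyIntegrable
      (fun ξ => Complex.I * ((inner ℝ m ξ / ‖ξ‖ : ℝ) : ℂ) * (𝓕 f : L2 n) ξ) volume := by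
    intro m f
    refine locallyIntegrable_of_le (C := ‖m‖)
      ((measurable_riesz m).aestronglyMeasurable.mul (aestronglyMeasurable_fourier f))
      (memLp_fourier f) (Eventually.of_forall fun ξ => ?_)
    rw [norm_mul]
    gcongr
    refine (norm_riesz_le m ξ).trans (le_mul_of_one_le_right (norm_nonneg m) ?_)
    nlinarith [sq_nonneg ‖ξ‖]
  have h1 : (𝓕 g' : L2 n) =ᵐ[volume] (𝓕 g : L2 n) := eq_of_riesz_eq hn fun m =>
    ae_eq_of_pairing (hloc m g') (hloc m g) fun η => by
      rw [← symbolPairing_riesz, ← symbolPairing_riesz, ← h m η, ← h' m η]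
  have h2 : (𝓕 g' : L2 n) = 𝓕 g := Lp.ext h1
  rw [← FourierTransform.fourierInv_fourier_eq (E := L2 n) (F := L2 n) g', h2,
    FourierTransform.fourierInv_fourier_eq]

namespace AcousticParams

variable (p : AcousticParams) {n : ℕ}

/-- The matrix which recovers `(φ_t, |D|φ, T)` from the energy term. -/
noncomputable def energyMatrix : Matrix (Fin 3) (Fin 3) ℂ :=
  !![1 / 2, 1 / 2, 0; -Complex.I / (2 * p.speed), Complex.I / (2 * p.speed), 0; 0, 0, 1]

/-- The components `(φ_t, |D|φ, T)` of an energy term. -/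
noncomputable def energyCoords (F : Fin 3 → L2 n) : Fin 3 → L2 n := matAct p.energyMatrix F

theorem energyCoords_zero (F : Fin 3 → L2 n) :
    p.energyCoords F 0 = (1 / 2 : ℂ) • (F 0 + F 1) := by
  simp [energyCoords, matAct, energyMatrix, Fin.sum_univ_three]

theorem energyCoords_one (F : Fin 3 → L2 n) :
    p.energyCoords F 1 = (-Complex.I / (2 * p.speed)) • (F 0 - F 1) := by
  simp only [energyCoords, matAct, energyMatrix, Fin.sum_univ_three]
  simp
  module

theorem energyCoords_two (F : Fin 3 → L2 n) : p.energyCoords F 2 = F 2 := by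
  simp [energyCoords, matAct, energyMatrix, Fin.sum_univ_three]

theorem energyCoords_spec (v g θ : L2 n) :
    p.energyCoords ![v + (Complex.I * (p.speed : ℂ)) • g, v - (Complex.I * (p.speed : ℂ)) • g, θ]
      = ![v, g, θ] := by
  have ha : (p.speed : ℂ) ≠ 0 := by exact_mod_cast p.speed_pos.ne'
  ext1 i
  fin_cases i
  · change p.energyCoords _ 0 = v
    rw [energyCoords_zero]
    simp only [Matrix.cons_val_zero, Matrix.cons_val_one]
    module
  · change p.energyCoords _ 1 = g
    rw [energyCoords_one]
    simp only [Matrix.cons_val_zero, Matrix.cons_val_one]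
    rw [add_sub_sub_cancel, ← add_smul, smul_smul]
    have : -Complex.I / (2 * p.speed) * (Complex.I * p.speed + Complex.I * p.speed) = 1 := by
      field_simp
      linear_combination -2 * Complex.I_sq
    rw [this, one_smul]
  · change p.energyCoords _ 2 = θ
    rw [energyCoords_two]
    rfl

theorem eq_of_energyCoords (F : Fin 3 → L2 n) :
    F = ![p.energyCoords F 0 + (Complex.I * (p.speed : ℂ)) • p.energyCoords F 1,
      p.energyCoords F 0 - (Complex.I * (p.speed : ℂ)) • p.energyCoords F 1,
      p.energyCoords F 2] := by
  have ha : (p.speed : ℂ) ≠ 0 := by exact_mod_cast p.speed_pos.ne'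
  have h1 : Complex.I * p.speed * (-Complex.I / (2 * p.speed)) = 1 / 2 := by
    field_simp
    linear_combination -Complex.I_sq
  rw [energyCoords_zero, energyCoords_one, energyCoords_two, smul_smul, h1]
  ext1 i
  fin_cases i
  · change F 0 = (1 / 2 : ℂ) • (F 0 + F 1) + (1 / 2 : ℂ) • (F 0 - F 1)
    module
  · change F 1 = (1 / 2 : ℂ) • (F 0 + F 1) - (1 / 2 : ℂ) • (F 0 - F 1)
    module
  · rfl

theorem isEnergyTerm_iff {φ φt T : TD n} {Φ : Fin 3 → L2 n} :
    IsEnergyTerm p φ φt T Φ ↔ φt = (p.energyCoords Φ 0 : TD n) ∧ IsAbsD φ (p.energyCoords Φ 1) ∧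
      T = (p.energyCoords Φ 2 : TD n) := by
  constructor
  · rintro ⟨v, g, θ, h1, h2, h3, rfl⟩
    rw [energyCoords_spec]
    exact ⟨h1, h2, h3⟩
  · rintro ⟨h1, h2, h3⟩
    exact ⟨_, _, _, h1, h2, h3, p.eq_of_energyCoords Φ⟩

theorem energyCoords_injective {F G : Fin 3 → L2 n} (h : p.energyCoords F = p.energyCoords G) :
    F = G := by
  rw [p.eq_of_energyCoords F, p.eq_of_energyCoords G, h]

theorem IsEnergyTerm.unique (hn : 1 ≤ n) {φ φt T : TD n} {Φ Φ' : Fin 3 → L2 n}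
    (h : IsEnergyTerm p φ φt T Φ) (h' : IsEnergyTerm p φ φt T Φ') : Φ' = Φ := by
  obtain ⟨h1, h2, h3⟩ := p.isEnergyTerm_iff.1 h
  obtain ⟨h1', h2', h3'⟩ := p.isEnergyTerm_iff.1 h'
  refine p.energyCoords_injective (funext fun i => ?_)
  fin_cases i
  · exact toTD_injective (h1'.symm.trans h1)
  · exact h2.unique hn h2'
  · exact toTD_injective (h3'.symm.trans h3)

/-- The symbol of the system for `(φ_t, |D|φ, T)`. -/
noncomputable def coordSymbol (i j : Fin 3) (ξ : Rn n) : ℂ :=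
  (!![0, -(p.c0 ^ 2 + p.αp * p.c0 ^ 2 * ((p.γ - 1) / p.αp)), 0; 1, 0, 0;
      0, (p.γ - 1) / p.αp, 0] : Matrix (Fin 3) (Fin 3) ℂ) i j * ((2 * Real.pi * ‖ξ‖ : ℝ) : ℂ)
    + (!![-((1 + p.β) * p.ν0), 0, p.αp * p.c0 ^ 2 * (p.γ * p.Dth); 0, 0, 0;
      0, 0, -(p.γ * p.Dth)] : Matrix (Fin 3) (Fin 3) ℂ) i j
      * (((2 * Real.pi * ‖ξ‖) ^ 2 : ℝ) : ℂ)

theorem aestronglyMeasurable_coordSymbol (i j : Fin 3) :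
    AEStronglyMeasurable (p.coordSymbol (n := n) i j) volume :=
  aestronglyMeasurable_frequency_combination _ _

theorem exists_coordSymbol_bound :
    ∃ C : ℝ, ∀ i j (ξ : Rn n), ‖p.coordSymbol i j ξ‖ ≤ C * (1 + ‖ξ‖ ^ 2) := by
  have h : ∀ i j, ∃ C : ℝ, 0 ≤ C ∧ ∀ ξ : Rn n, ‖p.coordSymbol i j ξ‖ ≤ C * (1 + ‖ξ‖ ^ 2) :=
    fun i j => ⟨_, by positivity, fun ξ => norm_frequency_combination_le _ _ ξ⟩
  choose C hC0 hC using h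
  refine ⟨∑ i, ∑ j, C i j, fun i j ξ => (hC i j ξ).trans ?_⟩
  have h1 : C i j ≤ ∑ j, C i j := Finset.single_le_sum (fun j _ => hC0 i j) (Finset.mem_univ j)
  have h2 : ∑ j, C i j ≤ ∑ i, ∑ j, C i j := Finset.single_le_sum
    (f := fun i => ∑ j, C i j) (fun i _ => Finset.sum_nonneg fun j _ => hC0 i j) (Finset.mem_univ i)
  gcongr
  exact h1.trans h2

theorem heat_pairing {φ : TD n} {F : Fin 3 → L2 n} (hφ : IsAbsD φ (F 1)) (η : 𝓢(Rn n, ℂ)) :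
    ((p.γ * p.Dth) • Δ (F 2 : TD n) - ((p.γ - 1) / p.αp) • Δ φ) η
      = ∫ ξ, (∑ j, p.coordSymbol 2 j ξ * (𝓕 (F j) : L2 n) ξ) * (𝓕⁻ η : 𝓢(Rn n, ℂ)) ξ := by
  change (p.γ * p.Dth) • (Δ (F 2 : TD n)) η - ((p.γ - 1) / p.αp) • (Δ φ) η = _
  have h := integral_frequency_combination ((p.γ - 1) / p.αp) (-(p.γ * p.Dth)) (F 1) (F 2) (𝓕⁻ η)
  rw [hφ.laplacian_apply', laplacian_toTD_apply', Complex.real_smul, Complex.real_smul]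
  push_cast
  rw [show ∀ x y : ℂ, p.γ * p.Dth * -y - (p.γ - 1) / p.αp * -x
    = (p.γ - 1) / p.αp * x + -(p.γ * p.Dth) * y from fun x y => by ring]
  push_cast at h
  rw [← h]
  refine integral_congr_ae (Eventually.of_forall fun ξ => ?_)
  simp [coordSymbol, Fin.sum_univ_three]
  ring

/-- `T_t` is eliminated from the momentum equation by means of the heat equation. This adds `(γ-1)
c₀²` to the squared wave speed, raising it to `γ c₀²`, and produces a heat flux of order two in `T`.
-/
theorem momentum_pairing {φ : TD n} {F : Fin 3 → L2 n} (hφ : IsAbsD φ (F 1)) (η : 𝓢(Rn n, ℂ)) :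
    ((p.c0 ^ 2) • Δ φ + ((1 + p.β) * p.ν0) • Δ (F 0 : TD n) - (p.αp * p.c0 ^ 2) •
        ((p.γ * p.Dth) • Δ (F 2 : TD n) - ((p.γ - 1) / p.αp) • Δ φ)) η
      = ∫ ξ, (∑ j, p.coordSymbol 0 j ξ * (𝓕 (F j) : L2 n) ξ) * (𝓕⁻ η : 𝓢(Rn n, ℂ)) ξ := by
  change (p.c0 ^ 2) • (Δ φ) η + ((1 + p.β) * p.ν0) • (Δ (F 0 : TD n)) η - (p.αp * p.c0 ^ 2) •
        ((p.γ * p.Dth) • (Δ (F 2 : TD n)) η - ((p.γ - 1) / p.αp) • (Δ φ) η) = _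
  have h := integral_frequency_combination
    (-(p.c0 ^ 2 + p.αp * p.c0 ^ 2 * ((p.γ - 1) / p.αp))) (-((1 + p.β) * p.ν0)) (F 1) (F 0) (𝓕⁻ η)
  have hi1 := ((integrable_frequency_pairing (F 1) (𝓕⁻ η)).const_mul
    (-((p.c0 : ℂ) ^ 2 + p.αp * p.c0 ^ 2 * ((p.γ - 1) / p.αp)))).add
      ((integrable_frequency_sq_pairing (F 0) (𝓕⁻ η)).const_mul (-(((1 : ℂ) + p.β) * p.ν0)))
  have hi2 := (integrable_frequency_sq_pairing (F 2) (𝓕⁻ η)).const_mul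
    ((p.αp : ℂ) * p.c0 ^ 2 * (p.γ * p.Dth))
  have h3 := integral_add hi1 hi2
  rw [integral_const_mul] at h3
  simp only [Pi.add_apply] at h3
  rw [h] at h3
  rw [hφ.laplacian_apply', laplacian_toTD_apply', laplacian_toTD_apply']
  simp only [Complex.real_smul]
  push_cast
  push_cast at h3
  rw [show ∀ x y z : ℂ, (p.c0 : ℂ) ^ 2 * -x + (1 + p.β) * p.ν0 * -y - p.αp * p.c0 ^ 2 *
      (p.γ * p.Dth * -z - (p.γ - 1) / p.αp * -x)
    = -((p.c0 : ℂ) ^ 2 + p.αp * p.c0 ^ 2 * ((p.γ - 1) / p.αp)) * x + -((1 + p.β) * p.ν0) * y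
      + p.αp * p.c0 ^ 2 * (p.γ * p.Dth) * z from fun x y z => by ring]
  rw [← h3]
  refine integral_congr_ae (Eventually.of_forall fun ξ => ?_)
  simp [coordSymbol, Fin.sum_univ_three]
  ring

end AcousticParams

theorem continuousOn_matAct {n : ℕ} (U : Matrix (Fin 3) (Fin 3) ℂ) {F : ℝ → Fin 3 → L2 n}
    {S : Set ℝ} (hF : ∀ i, ContinuousOn (fun t => F t i) S) (i : Fin 3) :
    ContinuousOn (fun t => matAct U (F t) i) S :=
  continuousOn_finsetSum _ fun j _ => (hF j).const_smul (U i j)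

namespace AcousticParams

variable {p : AcousticParams} {n : ℕ} {s : ℝ} {φ0 φ1 T0 : TD n} {φ φt T : ℝ → TD n}
  {Φ : ℝ → Fin 3 → L2 n}

theorem _root_.IsEnergySolution.coords (h : IsEnergySolution p s φ0 φ1 T0 φ φt T Φ)
    {t : ℝ} (ht : 0 ≤ t) :
    φt t = (p.energyCoords (Φ t) 0 : TD n) ∧ IsAbsD (φ t) (p.energyCoords (Φ t) 1) ∧
      T t = (p.energyCoords (Φ t) 2 : TD n) :=
  p.isEnergyTerm_iff.1 (h.energy t ht)

theorem _root_.IsEnergySolution.hasDerivAt_momentum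
    (h : IsEnergySolution p s φ0 φ1 T0 φ φt T Φ) {t : ℝ} (ht : 0 < t)
    (η : 𝓢(Rn n, ℂ)) :
    HasDerivAt (fun τ => (p.energyCoords (Φ τ) 0 : TD n) η)
      (∫ ξ, (∑ j, p.coordSymbol 0 j ξ * (𝓕 (p.energyCoords (Φ t) j) : L2 n) ξ)
        * (𝓕⁻ η : 𝓢(Rn n, ℂ)) ξ) t := by
  obtain ⟨φtt, Tt, heq⟩ := h.equations
  obtain ⟨hφ, -, h1, h2⟩ := heq t ht
  obtain ⟨c0, c1, c2⟩ := h.coords ht.le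
  have hd := (hφ η).hasDerivAt (Ici_mem_nhds ht)
  have hrhs : φtt t = (p.c0 ^ 2) • Δ (φ t) + ((1 + p.β) * p.ν0) • Δ (φt t) - (p.αp * p.c0 ^ 2) •
        ((p.γ * p.Dth) • Δ (T t) - ((p.γ - 1) / p.αp) • Δ (φ t)) := by
    have h3 : (p.γ * p.Dth) • Δ (T t) - ((p.γ - 1) / p.αp) • Δ (φ t) = Tt t := by
      rw [eq_comm, ← sub_eq_zero, ← h2]; abel
    rw [h3, ← sub_eq_zero, ← h1]; abel
  rw [← p.momentum_pairing c1, ← c0, ← c2, ← hrhs]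
  refine hd.congr_of_eventuallyEq ?_
  filter_upwards [Ioi_mem_nhds ht] with τ hτ
  rw [(h.coords (le_of_lt hτ)).1]

theorem _root_.IsEnergySolution.hasDerivAt_heat
    (h : IsEnergySolution p s φ0 φ1 T0 φ φt T Φ) {t : ℝ} (ht : 0 < t)
    (η : 𝓢(Rn n, ℂ)) :
    HasDerivAt (fun τ => (p.energyCoords (Φ τ) 2 : TD n) η)
      (∫ ξ, (∑ j, p.coordSymbol 2 j ξ * (𝓕 (p.energyCoords (Φ t) j) : L2 n) ξ)
        * (𝓕⁻ η : 𝓢(Rn n, ℂ)) ξ) t := by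
  obtain ⟨φtt, Tt, heq⟩ := h.equations
  obtain ⟨-, hT, h1, h2⟩ := heq t ht
  obtain ⟨c0, c1, c2⟩ := h.coords ht.le
  have hd := (hT η).hasDerivAt (Ici_mem_nhds ht)
  have hrhs : Tt t = (p.γ * p.Dth) • Δ (T t) - ((p.γ - 1) / p.αp) • Δ (φ t) := by
    rw [← sub_eq_zero, ← h2]; abel
  rw [← p.heat_pairing c1, ← c2, ← hrhs]
  refine hd.congr_of_eventuallyEq ?_
  filter_upwards [Ioi_mem_nhds ht] with τ hτ
  rw [(h.coords (le_of_lt hτ)).2.2]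

/-- `|D|φ` is accessible only through the gradient of `φ`, so the equation `(|D|φ)_t = |D|φ_t` is
obtained multiplied by each Riesz symbol. -/
theorem _root_.IsEnergySolution.hasDerivAt_potential
    (h : IsEnergySolution p s φ0 φ1 T0 φ φt T Φ) {t : ℝ} (ht : 0 < t) (m : Rn n)
    (η : 𝓢(Rn n, ℂ)) :
    HasDerivAt (fun τ => ∫ ξ, Complex.I * ((inner ℝ m ξ / ‖ξ‖ : ℝ) : ℂ)
        * (𝓕 (p.energyCoords (Φ τ) 1) : L2 n) ξ * (𝓕⁻ η : 𝓢(Rn n, ℂ)) ξ)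
      (∫ ξ, Complex.I * ((inner ℝ m ξ / ‖ξ‖ : ℝ) : ℂ) * ((2 * Real.pi * ‖ξ‖ : ℝ) : ℂ)
        * (𝓕 (p.energyCoords (Φ t) 0) : L2 n) ξ * (𝓕⁻ η : 𝓢(Rn n, ℂ)) ξ) t := by
  have hd := ((h.deriv_phi t ht.le (∂_{m} η)).hasDerivAt (Ici_mem_nhds ht)).neg
  refine (hd.congr_of_eventuallyEq ?_).congr_deriv ?_
  · filter_upwards [Ioi_mem_nhds ht] with τ hτ
    rw [← symbolPairing_riesz, ← (h.coords (le_of_lt hτ)).2.1 m η,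
      TemperedDistribution.lineDerivOp_apply_apply, map_neg]
    rfl
  · rw [(h.coords ht.le).1, toTD_apply_fourier, ← integral_neg]
    refine integral_congr_ae (Eventually.of_forall fun ξ => ?_)
    simp only [fourierInv_lineDeriv_apply]
    rw [real_inner_comm ξ m]
    rcases eq_or_ne ξ 0 with rfl | hξ
    · simp
    · have : (‖ξ‖ : ℂ) ≠ 0 := Complex.ofReal_ne_zero.2 (norm_ne_zero_iff.2 hξ)
      push_cast
      field_simp

/-- Uniqueness of the energy term. -/
theorem _root_.IsEnergySolution.energyTerm_unique (hn : 1 ≤ n) (hs : 0 ≤ s)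
    {φ' φt' T' : ℝ → TD n} {Φ' : ℝ → Fin 3 → L2 n}
    (h : IsEnergySolution p s φ0 φ1 T0 φ φt T Φ)
    (h' : IsEnergySolution p s φ0 φ1 T0 φ' φt' T' Φ') {t : ℝ} (ht : 0 ≤ t) : Φ' t = Φ t := by
  obtain ⟨C, hC⟩ := p.exists_coordSymbol_bound (n := n)
  set w : ℝ → Fin 3 → L2 n := fun t => p.energyCoords (Φ' t) - p.energyCoords (Φ t) with hwdef
  have hc : ∀ {φ0 φ1 T0 : TD n} {φ φt T : ℝ → TD n} {Φ : ℝ → Fin 3 → L2 n},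
      IsEnergySolution p s φ0 φ1 T0 φ φt T Φ → ∀ j,
      ContinuousOn (fun t => p.energyCoords (Φ t) j) (Ici 0) := fun h j =>
    continuousOn_matAct _ (fun i => h.cont.continuousOn hs i) j
  have hw : ∀ j, ContinuousOn (fun t => w t j) (Ici 0) := fun j => (hc h' j).sub (hc h j)
  have hw0 : w 0 = 0 := by
    have e := h.energy 0 le_rfl
    have e' := h'.energy 0 le_rfl
    rw [h.init_phi, h.init_phit, h.init_T] at e
    rw [h'.init_phi, h'.init_phit, h'.init_T] at e'
    rw [hwdef]
    simp only [IsEnergyTerm.unique p hn e e', sub_self]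
  have hsub : ∀ i, (∀ {φ φt T : ℝ → TD n} {Φ : ℝ → Fin 3 → L2 n},
      IsEnergySolution p s φ0 φ1 T0 φ φt T Φ → ∀ {t : ℝ}, 0 < t → ∀ η : 𝓢(Rn n, ℂ),
      HasDerivAt (fun τ => (p.energyCoords (Φ τ) i : TD n) η)
      (∫ ξ, (∑ j, p.coordSymbol i j ξ * (𝓕 (p.energyCoords (Φ t) j) : L2 n) ξ)
        * (𝓕⁻ η : 𝓢(Rn n, ℂ)) ξ) t) → ∀ t, 0 ≤ t → ∀ᵐ ξ, (𝓕 (w t i) : L2 n) ξ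
      = ∑ j, p.coordSymbol i j ξ * (𝓕 (∫ τ in 0..t, w τ j) : L2 n) ξ := by
    intro i hrow t ht
    refine integrated_component i (p.aestronglyMeasurable_coordSymbol i) (hC i) hw hw0
      (fun t ht η => ?_) ht
    have hfun : ∀ τ, ((w τ i : L2 n) : TD n) η
        = (p.energyCoords (Φ' τ) i : TD n) η - (p.energyCoords (Φ τ) i : TD n) η := by
      intro τ
      simp only [hwdef]
      rw [Pi.sub_apply, toTD_sub]; rfl
    simp only [hfun]
    refine ((hrow h' ht η).sub (hrow h ht η)).congr_deriv ?_
    obtain ⟨Λ, hΛ⟩ := exists_row_clm (p.aestronglyMeasurable_coordSymbol i) (hC i) (𝓕⁻ η)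
    rw [← hΛ, ← hΛ, ← hΛ, ← map_sub]
  -- The row of `|D|φ` is integrated once for every direction `m`; `eq_of_riesz_eq` then removes the
  -- Riesz symbols.
  have hpot : ∀ t, 0 ≤ t → ∀ᵐ ξ, (𝓕 (w t 1) : L2 n) ξ
      = ∑ j, p.coordSymbol 1 j ξ * (𝓕 (∫ τ in 0..t, w τ j) : L2 n) ξ := by
    intro t ht
    refine eq_of_riesz_eq hn fun m => ?_
    set q : Fin 3 → Rn n → ℂ :=
      ![0, fun ξ => Complex.I * ((inner ℝ m ξ / ‖ξ‖ : ℝ) : ℂ), 0] with hq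
    set r : Fin 3 → Rn n → ℂ := ![fun ξ => Complex.I * ((inner ℝ m ξ / ‖ξ‖ : ℝ) : ℂ)
      * ((2 * Real.pi * ‖ξ‖ : ℝ) : ℂ), 0, 0] with hr
    have hpi : 1 ≤ (2 * Real.pi) ^ 2 := by nlinarith [Real.pi_gt_three]
    have hqm : ∀ j, AEStronglyMeasurable (q j) volume := by
      intro j
      fin_cases j
      · exact aestronglyMeasurable_const
      · exact (measurable_riesz m).aestronglyMeasurable
      · exact aestronglyMeasurable_const
    have hrm : ∀ j, AEStronglyMeasurable (r j) volume := by
      intro j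
      fin_cases j
      · exact ((measurable_riesz m).mul (by fun_prop)).aestronglyMeasurable
      · exact aestronglyMeasurable_const
      · exact aestronglyMeasurable_const
    have hqC : ∀ j ξ, ‖q j ξ‖ ≤ ‖m‖ * (2 * Real.pi) ^ 2 * (1 + ‖ξ‖ ^ 2) := by
      intro j ξ
      fin_cases j
      · change ‖(0 : ℂ)‖ ≤ _
        rw [norm_zero]; positivity
      · refine (norm_riesz_le m ξ).trans ?_
        rw [mul_assoc]
        refine le_mul_of_one_le_right (norm_nonneg m) ?_
        nlinarith [sq_nonneg ‖ξ‖]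
      · change ‖(0 : ℂ)‖ ≤ _
        rw [norm_zero]; positivity
    have hrC : ∀ j ξ, ‖r j ξ‖ ≤ ‖m‖ * (2 * Real.pi) ^ 2 * (1 + ‖ξ‖ ^ 2) := by
      intro j ξ
      fin_cases j
      · change ‖Complex.I * ((inner ℝ m ξ / ‖ξ‖ : ℝ) : ℂ) * ((2 * Real.pi * ‖ξ‖ : ℝ) : ℂ)‖ ≤ _
        rw [norm_mul, mul_assoc ‖m‖]
        exact mul_le_mul (norm_riesz_le m ξ) (norm_frequency_le ξ) (norm_nonneg _) (norm_nonneg m)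
      · change ‖(0 : ℂ)‖ ≤ _
        rw [norm_zero]; positivity
      · change ‖(0 : ℂ)‖ ≤ _
        rw [norm_zero]; positivity
    have hint := integrated_equation hqm hqC hrm hrC hw (fun t ht η => by
      obtain ⟨Λ, hΛ⟩ := exists_row_clm hqm hqC (𝓕⁻ η)
      obtain ⟨M, hM⟩ := exists_row_clm hrm hrC (𝓕⁻ η)
      have hrow : ∀ {φ φt T : ℝ → TD n} {Φ : ℝ → Fin 3 → L2 n},
          IsEnergySolution p s φ0 φ1 T0 φ φt T Φ →
          HasDerivAt (fun τ => Λ (p.energyCoords (Φ τ))) (M (p.energyCoords (Φ t))) t := by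
        intro φ φt T Φ h
        simp only [hΛ, hM]
        simpa [hq, hr, Fin.sum_univ_three] using h.hasDerivAt_potential ht m η
      simp only [← hΛ, ← hM]
      simp only [hwdef, map_sub]
      exact (hrow h').sub (hrow h)) ht
    have hz : ∀ᵐ ξ, (𝓕 (w 0 1) : L2 n) ξ = 0 := by
      filter_upwards [fourier_sub_ae (0 : L2 n) 0] with ξ hξ
      rw [hw0, Pi.zero_apply]
      rwa [sub_zero, sub_self] at hξ
    filter_upwards [hint, hz] with ξ hξ hξ0
    have e1 : ∀ x : Fin 3 → ℂ, ∑ j, q j ξ * x j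
        = Complex.I * ((inner ℝ m ξ / ‖ξ‖ : ℝ) : ℂ) * x 1 := fun x => by
      simp [hq, Fin.sum_univ_three]
    have e2 : ∀ x : Fin 3 → ℂ, ∑ j, r j ξ * x j = Complex.I * ((inner ℝ m ξ / ‖ξ‖ : ℝ) : ℂ)
        * ((2 * Real.pi * ‖ξ‖ : ℝ) : ℂ) * x 0 := fun x => by
      simp [hr, Fin.sum_univ_three]
    have e3 : ∀ x : Fin 3 → ℂ, ∑ j, p.coordSymbol 1 j ξ * x j
        = ((2 * Real.pi * ‖ξ‖ : ℝ) : ℂ) * x 0 := fun x => by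
      simp [coordSymbol, Fin.sum_univ_three]
    rw [e1 (fun j => (𝓕 (w t j) : L2 n) ξ - (𝓕 (w 0 j) : L2 n) ξ), hξ0, sub_zero,
      e2 (fun j => (𝓕 (∫ τ in 0..t, w τ j) : L2 n) ξ)] at hξ
    rw [e3 (fun j => (𝓕 (∫ τ in 0..t, w τ j) : L2 n) ξ), hξ, mul_assoc (Complex.I * _)]
  have key := eq_zero_of_integrated_rows hC hw (fun t ht i => by
    fin_cases i
    · exact hsub 0 (fun h _ ht η => h.hasDerivAt_momentum ht η) t ht
    · exact hpot t ht
    · exact hsub 2 (fun h _ ht η => h.hasDerivAt_heat ht η) t ht)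
  exact p.energyCoords_injective (sub_eq_zero.1 (key t ht))

/-- The energy term determines `φ_t` and `T` but not a constant in `φ`. The potential is recovered
from `φ_t` and its initial value. -/
theorem _root_.IsEnergySolution.unique (hn : 1 ≤ n) (hs : 0 ≤ s)
    {φ' φt' T' : ℝ → TD n} {Φ' : ℝ → Fin 3 → L2 n}
    (h : IsEnergySolution p s φ0 φ1 T0 φ φt T Φ)
    (h' : IsEnergySolution p s φ0 φ1 T0 φ' φt' T' Φ') {t : ℝ} (ht : 0 ≤ t) :
    φ' t = φ t ∧ φt' t = φt t ∧ T' t = T t ∧ Φ' t = Φ t := by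
  have hΦ : ∀ {t : ℝ}, 0 ≤ t → Φ' t = Φ t := fun ht => h.energyTerm_unique hn hs h' ht
  have hφt : ∀ {t : ℝ}, 0 ≤ t → φt' t = φt t := fun ht => by
    rw [(h'.coords ht).1, (h.coords ht).1, hΦ ht]
  refine ⟨?_, hφt ht, ?_, hΦ ht⟩
  · ext η
    have hd : ∀ τ, 0 ≤ τ → HasDerivWithinAt (fun τ => φ' τ η - φ τ η) 0 (Ici 0) τ := by
      intro τ hτ
      have := (h'.deriv_phi τ hτ η).sub (h.deriv_phi τ hτ η)
      rwa [hφt hτ, sub_self] at this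
    have := constant_of_has_deriv_right_zero (a := 0) (b := t)
      (fun τ hτ => ((hd τ hτ.1).continuousWithinAt).mono Icc_subset_Ici_self)
      (fun τ hτ => (hd τ hτ.1).mono (Ici_subset_Ici.2 hτ.1)) t ⟨ht, le_rfl⟩
    rw [h.init_phi, h'.init_phi, sub_self, sub_eq_zero] at this
    exact this
  · rw [(h'.coords ht).2.2, (h.coords ht).2.2, hΦ ht]

end AcousticParams

/-! ### Existence for the acoustic system. -/

theorem integrable_symbolOf_pairing {n : ℕ} (B₁ B₂ : (Fin 3 → ℂ) →L[ℂ] (Fin 3 → ℂ))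
    (F : Fin 3 → L2 n) (i : Fin 3) (ψ : 𝓢(Rn n, ℂ)) :
    Integrable (fun ξ => symbolOf B₁ B₂ (2 * Real.pi * ‖ξ‖) (hat F ξ) i * ψ ξ) volume := by
  have hm : AEStronglyMeasurable (fun ξ => symbolOf B₁ B₂ (2 * Real.pi * ‖ξ‖) (hat F ξ) i)
      volume := (continuous_apply i).comp_aestronglyMeasurable (aestronglyMeasurable_clm_apply
        ((continuous_symbolOf B₁ B₂).comp continuous_frequency) (aestronglyMeasurable_hat F))
  refine integrable_mul_schwartz (C := (‖B₁‖ + ‖B₂‖) * (2 * Real.pi) ^ 2) hm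
    (memLp_hat F).norm.ofReal (Eventually.of_forall fun ξ => ?_) ψ
  calc _ ≤ ‖symbolOf B₁ B₂ (2 * Real.pi * ‖ξ‖) (hat F ξ)‖ := norm_le_pi_norm _ i
    _ ≤ ‖symbolOf B₁ B₂ (2 * Real.pi * ‖ξ‖)‖ * ‖hat F ξ‖ := ContinuousLinearMap.le_opNorm _ _
    _ ≤ (‖B₁‖ + ‖B₂‖) * ((2 * Real.pi) ^ 2 * (1 + ‖ξ‖ ^ 2)) * ‖hat F ξ‖ := by
        gcongr
        exact (norm_symbolOf_le _ _ _).trans (by gcongr; exact one_add_frequency_sq_le ξ)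
    _ = _ := by
        have : ‖(RCLike.ofReal ‖hat F ξ‖ : ℂ)‖ = ‖hat F ξ‖ := by simp
        rw [this]; ring

theorem toTD_half_add {n : ℕ} (f g : L2 n) (η : 𝓢(Rn n, ℂ)) :
    (((1 / 2 : ℂ) • (f + g) : L2 n) : TD n) η = 1 / 2 * ((f : TD n) η + (g : TD n) η) := by
  rw [toTD_smul, toTD_add]; rfl

namespace AcousticParams

variable (p : AcousticParams) {n : ℕ}

theorem neg_speed_sq_eq : (-(p.αp * p.c0 ^ 2 * ((p.γ - 1) / p.αp)) + -p.c0 ^ 2 : ℂ)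
    = -(p.speed : ℂ) ^ 2 := by
  have h := p.speed_sq
  have h2 := p.αp_pos.ne'
  have h3 : -(p.αp * p.c0 ^ 2 * ((p.γ - 1) / p.αp)) + -p.c0 ^ 2 = -p.speed ^ 2 := by
    rw [h]; field_simp; ring
  exact_mod_cast h3

theorem hat_energyCoords_ae (F : Fin 3 → L2 n) : ∀ᵐ ξ,
    (𝓕 (p.energyCoords F 0) : L2 n) ξ = (hat F ξ 0 + hat F ξ 1) / 2 ∧
    (𝓕 (p.energyCoords F 1) : L2 n) ξ = -Complex.I / (2 * p.speed) * (hat F ξ 0 - hat F ξ 1) ∧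
    (𝓕 (p.energyCoords F 2) : L2 n) ξ = hat F ξ 2 := by
  filter_upwards [hat_matAct_ae p.energyMatrix F] with ξ hξ
  have h : ∀ i, (𝓕 (p.energyCoords F i) : L2 n) ξ = p.energyMatrix.mulVec (hat F ξ) i :=
    fun i => congrFun hξ i
  refine ⟨?_, ?_, ?_⟩
  · rw [h]
    simp [energyMatrix, Matrix.mulVec, dotProduct, Fin.sum_univ_three]
    ring
  · rw [h]
    simp [energyMatrix, Matrix.mulVec, dotProduct, Fin.sum_univ_three]
    ring
  · rw [h]
    simp [energyMatrix, Matrix.mulVec, dotProduct, Fin.sum_univ_three]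

theorem coordSymbol_zero_apply (F : Fin 3 → L2 n) : ∀ᵐ ξ,
    ∑ j, p.coordSymbol 0 j ξ * (𝓕 (p.energyCoords F j) : L2 n) ξ
      = (symbolOf p.waveSymbol p.dampSymbol (2 * Real.pi * ‖ξ‖) (hat F ξ) 0
        + symbolOf p.waveSymbol p.dampSymbol (2 * Real.pi * ‖ξ‖) (hat F ξ) 1) / 2 := by
  have ha : (p.speed : ℂ) ≠ 0 := by exact_mod_cast p.speed_pos.ne'
  filter_upwards [p.hat_energyCoords_ae F] with ξ hξ
  obtain ⟨h0, h1, h2⟩ := hξ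
  rw [Fin.sum_univ_three, h0, h1, h2, symbol_apply_zero, symbol_apply_one]
  have hf : (p.flux : ℂ) = p.αp * p.c0 ^ 2 * (p.γ * p.Dth) := by
    rw [flux, speed_sq]; push_cast; ring
  have hv : (p.visc : ℂ) = (1 + p.β) * p.ν0 := by rw [visc]; push_cast; ring
  simp [coordSymbol]
  rw [p.neg_speed_sq_eq, hf, hv]
  field_simp
  ring

theorem coordSymbol_two_apply (F : Fin 3 → L2 n) : ∀ᵐ ξ,
    ∑ j, p.coordSymbol 2 j ξ * (𝓕 (p.energyCoords F j) : L2 n) ξ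
      = symbolOf p.waveSymbol p.dampSymbol (2 * Real.pi * ‖ξ‖) (hat F ξ) 2 := by
  have ha : (p.speed : ℂ) ≠ 0 := by exact_mod_cast p.speed_pos.ne'
  filter_upwards [p.hat_energyCoords_ae F] with ξ hξ
  obtain ⟨h0, h1, h2⟩ := hξ
  rw [Fin.sum_univ_three, h0, h1, h2, symbol_apply_two]
  have hk : ((p.γ - 1) / p.αp : ℂ) = p.entropyCoeff * p.speed ^ 2 := by
    exact_mod_cast p.entropyCoeff_mul_speed_sq.symm
  simp [coordSymbol]
  rw [hk]
  field_simp
  ring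

/-- The energy term of the solution with a given initial energy term. -/
noncomputable def energyEvolution (F₀ : Fin 3 → L2 n) (t : ℝ) : Fin 3 → L2 n :=
  evolution p.waveSymbol p.dampSymbol F₀ t

/-- The displacement `φ(t) - φ(0)` of the solution with a given initial energy term. -/
noncomputable def displacement (F₀ : Fin 3 → L2 n) (t : ℝ) : L2 n :=
  p.energyCoords (evolutionIntegral p.waveSymbol p.dampSymbol F₀ t) 0

theorem hasDerivAt_energyEvolution_zero (F₀ : Fin 3 → L2 n) {t : ℝ} (ht : 0 < t)
    (η : 𝓢(Rn n, ℂ)) :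
    HasDerivAt (fun τ => (p.energyCoords (p.energyEvolution F₀ τ) 0 : TD n) η)
      (∫ ξ, (∑ j, p.coordSymbol 0 j ξ
        * (𝓕 (p.energyCoords (p.energyEvolution F₀ t) j) : L2 n) ξ)
        * (𝓕⁻ η : 𝓢(Rn n, ℂ)) ξ) t := by
  obtain ⟨C, hC⟩ := p.exists_propagator_bound
  have h0 := hasDerivAt_evolution_pairing hC F₀ ht 0 (𝓕⁻ η)
  have h1 := hasDerivAt_evolution_pairing hC F₀ ht 1 (𝓕⁻ η)
  simp only [energyCoords_zero, toTD_half_add]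
  simp only [toTD_apply_fourier]
  refine ((h0.add h1).const_mul (1 / 2 : ℂ)).congr_deriv ?_
  rw [← integral_add (integrable_symbolOf_pairing _ _ _ _ _)
    (integrable_symbolOf_pairing _ _ _ _ _), ← integral_const_mul]
  refine integral_congr_ae ?_
  filter_upwards [p.coordSymbol_zero_apply (p.energyEvolution F₀ t)] with ξ hξ
  rw [hξ]
  simp only [energyEvolution]
  ring

theorem hasDerivAt_energyEvolution_two (F₀ : Fin 3 → L2 n) {t : ℝ} (ht : 0 < t)
    (η : 𝓢(Rn n, ℂ)) :
    HasDerivAt (fun τ => (p.energyCoords (p.energyEvolution F₀ τ) 2 : TD n) η)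
      (∫ ξ, (∑ j, p.coordSymbol 2 j ξ
        * (𝓕 (p.energyCoords (p.energyEvolution F₀ t) j) : L2 n) ξ)
        * (𝓕⁻ η : 𝓢(Rn n, ℂ)) ξ) t := by
  obtain ⟨C, hC⟩ := p.exists_propagator_bound
  have h := hasDerivAt_evolution_pairing hC F₀ ht 2 (𝓕⁻ η)
  simp only [energyCoords_two, toTD_apply_fourier]
  refine h.congr_deriv (integral_congr_ae ?_)
  filter_upwards [p.coordSymbol_two_apply (p.energyEvolution F₀ t)] with ξ hξ
  rw [hξ, energyEvolution]

/-- The potential is constructed as `φ0` plus the time integral of `φ_t`, so that `φ0` may be any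
tempered distribution with `|D|φ0 ∈ L²`. -/
theorem hasDerivWithinAt_displacement {s : ℝ} (hs : 0 ≤ s) {F₀ : Fin 3 → L2 n}
    (hF : InSobolev s F₀) {t : ℝ} (ht : 0 ≤ t) (η : 𝓢(Rn n, ℂ)) :
    HasDerivWithinAt (fun τ => (p.displacement F₀ τ : TD n) η)
      ((p.energyCoords (p.energyEvolution F₀ t) 0 : TD n) η) (Ici 0) t := by
  obtain ⟨C, hC⟩ := p.exists_propagator_bound
  have hpos : ∀ {t : ℝ}, 0 < t → HasDerivAt (fun τ => (p.displacement F₀ τ : TD n) η)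
      ((p.energyCoords (p.energyEvolution F₀ t) 0 : TD n) η) t := by
    intro t ht
    have h0 := hasDerivAt_evolutionIntegral_pairing hC F₀ ht 0 (𝓕⁻ η)
    have h1 := hasDerivAt_evolutionIntegral_pairing hC F₀ ht 1 (𝓕⁻ η)
    simp only [displacement, energyCoords_zero, toTD_half_add]
    simp only [toTD_apply_fourier]
    exact (h0.add h1).const_mul (1 / 2 : ℂ)
  rcases ht.eq_or_lt with rfl | ht
  · have hcont : ContinuousOn (fun τ => p.displacement F₀ τ) (Icc 0 1) :=
      continuousOn_matAct p.energyMatrix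
        (fun i => continuousOn_evolutionIntegral hs hC hF zero_le_one i) 0
    have hcont' : ContinuousOn (fun τ => p.energyCoords (p.energyEvolution F₀ τ) 0) (Ici 0) :=
      continuousOn_matAct p.energyMatrix
        (fun i => (continuousInSobolev_evolution hs hC hF).continuousOn hs i) 0
    -- At time `0` the one-sided derivative is the limit of the derivatives at positive times, which
    -- exists by continuity of the evolution.
    refine hasDerivWithinAt_Ici_of_tendsto_deriv (s := Ioo 0 1)
      (fun τ hτ => (hpos hτ.1).differentiableAt.differentiableWithinAt) ?_
      (Ioo_mem_nhdsGT one_pos) ?_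
    · exact ((continuousOn_toTD_apply hcont η) 0 ⟨le_rfl, zero_le_one⟩).mono Ioo_subset_Icc_self
    · have h := ((continuousOn_toTD_apply hcont' η) 0 self_mem_Ici).mono Ioi_subset_Ici_self
      refine Tendsto.congr' ?_ h
      filter_upwards [self_mem_nhdsWithin] with τ hτ
      exact (hpos hτ).deriv.symm
  · exact (hpos ht).hasDerivWithinAt

/-- The difference of rows `0` and `1` of `propagator_sub_one` says that the change of `|D|φ` has
transform `r` times that of the displacement, since damping and heat flux enter both rows equally.
-/
theorem isAbsD_displacement {φ0 : TD n} {F₀ : Fin 3 → L2 n} (h0 : IsAbsD φ0 (p.energyCoords F₀ 1))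
    {t : ℝ} (ht : 0 ≤ t) : IsAbsD (φ0 + (p.displacement F₀ t : TD n))
      (p.energyCoords (p.energyEvolution F₀ t) 1) := by
  obtain ⟨C, hC⟩ := p.exists_propagator_bound
  have ha : (p.speed : ℂ) ≠ 0 := by exact_mod_cast p.speed_pos.ne'
  have h1 : IsAbsD (p.displacement F₀ t : TD n)
      (p.energyCoords (p.energyEvolution F₀ t) 1 - p.energyCoords F₀ 1) := by
    refine isAbsD_of_fourier ?_
    filter_upwards [fourier_sub_ae (p.energyCoords (p.energyEvolution F₀ t) 1)
      (p.energyCoords F₀ 1), p.hat_energyCoords_ae (p.energyEvolution F₀ t),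
      p.hat_energyCoords_ae F₀,
      p.hat_energyCoords_ae (evolutionIntegral p.waveSymbol p.dampSymbol F₀ t),
      hat_evolution_ae hC F₀ ht, hat_evolutionIntegral_ae hC F₀ ht] with ξ e1 e2 e3 e4 e5 e6
    rw [e1, e2.2.1, e3.2.1, displacement, e4.1, energyEvolution, e5]
    have h := DFunLike.congr_fun (propagator_sub_one p.waveSymbol p.dampSymbol t
      (2 * Real.pi * ‖ξ‖)) (hat F₀ ξ)
    change propagator p.waveSymbol p.dampSymbol t (2 * Real.pi * ‖ξ‖) (hat F₀ ξ) - hat F₀ ξ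
      = symbolOf p.waveSymbol p.dampSymbol (2 * Real.pi * ‖ξ‖)
        (propagatorIntegral p.waveSymbol p.dampSymbol t (2 * Real.pi * ‖ξ‖) (hat F₀ ξ)) at h
    rw [← e6] at h
    have g0 := congrFun h 0
    have g1 := congrFun h 1
    rw [Pi.sub_apply, symbol_apply_zero] at g0
    rw [Pi.sub_apply, symbol_apply_one] at g1
    have hI : Complex.I / p.speed * (Complex.I * p.speed) = -1 := by
      field_simp
      exact Complex.I_sq
    linear_combination (-Complex.I / (2 * p.speed)) * (g0 - g1)
      - ((2 * Real.pi * ‖ξ‖ : ℝ) : ℂ) / 2 *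
        (hat (evolutionIntegral p.waveSymbol p.dampSymbol F₀ t) ξ 0
          + hat (evolutionIntegral p.waveSymbol p.dampSymbol F₀ t) ξ 1) * hI
  have := h0.add h1
  rwa [add_sub_cancel] at this

theorem isEnergySolution_energyEvolution {s : ℝ} (hs : 0 ≤ s) {φ0 φ1 T0 : TD n}
    {F₀ : Fin 3 → L2 n} (h : IsEnergyTerm p φ0 φ1 T0 F₀) (hF : InSobolev s F₀) :
    IsEnergySolution p s φ0 φ1 T0 (fun t => φ0 + (p.displacement F₀ t : TD n))
      (fun t => (p.energyCoords (p.energyEvolution F₀ t) 0 : TD n))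
      (fun t => (p.energyCoords (p.energyEvolution F₀ t) 2 : TD n)) (p.energyEvolution F₀) := by
  obtain ⟨C, hC⟩ := p.exists_propagator_bound
  obtain ⟨h0, h1, h2⟩ := p.isEnergyTerm_iff.1 h
  have hinit : p.energyEvolution F₀ 0 = F₀ := evolution_zero hC F₀
  exact
    { init_phi := by
        simp only [displacement]
        rw [evolutionIntegral_zero hC, energyCoords_zero]
        simp only [Pi.zero_apply, add_zero, smul_zero]
        rw [show ((0 : L2 n) : TD n) = 0 from map_zero (Lp.toTemperedDistributionCLM ℂ volume 2),
          add_zero]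
      init_phit := by simp only [hinit, h0]
      init_T := by simp only [hinit, h2]
      deriv_phi := fun t ht η => (p.hasDerivWithinAt_displacement hs hF ht η).const_add _
      equations := by
        -- The second derivative of `φ` and `T_t` are defined by the two equations, which then hold
        -- trivially; the content is that they are the time derivatives.
        refine ⟨fun t => (p.c0 ^ 2) • Δ (φ0 + (p.displacement F₀ t : TD n))
          + ((1 + p.β) * p.ν0) • Δ (p.energyCoords (p.energyEvolution F₀ t) 0 : TD n)
          - (p.αp * p.c0 ^ 2) •
            ((p.γ * p.Dth) • Δ (p.energyCoords (p.energyEvolution F₀ t) 2 : TD n)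
            - ((p.γ - 1) / p.αp) • Δ (φ0 + (p.displacement F₀ t : TD n))),
          fun t => (p.γ * p.Dth) • Δ (p.energyCoords (p.energyEvolution F₀ t) 2 : TD n)
            - ((p.γ - 1) / p.αp) • Δ (φ0 + (p.displacement F₀ t : TD n)), fun t ht => ?_⟩
        have habs := p.isAbsD_displacement h1 ht.le
        refine ⟨fun η => ?_, fun η => ?_, by module, by module⟩
        · rw [p.momentum_pairing habs]
          exact (p.hasDerivAt_energyEvolution_zero F₀ ht η).hasDerivWithinAt
        · rw [p.heat_pairing habs]
          exact (p.hasDerivAt_energyEvolution_two F₀ ht η).hasDerivWithinAt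
      energy := fun t ht => p.isEnergyTerm_iff.2 ⟨rfl, p.isAbsD_displacement h1 ht, rfl⟩
      cont := continuousInSobolev_evolution hs hC hF }

end AcousticParams

/-! ### Assembly of the bounds, the decay rates and the profile. -/

theorem norm_mulVec_le (U : Matrix (Fin 3) (Fin 3) ℂ) (x : Fin 3 → ℂ) :
    ‖U.mulVec x‖ ≤ ‖matrixCLM U‖ * ‖x‖ := (matrixCLM U).le_opNorm x

theorem InSobolev.matAct {n : ℕ} {s : ℝ} (hs : 0 ≤ s) (U : Matrix (Fin 3) (Fin 3) ℂ)
    {F : Fin 3 → L2 n} (hF : InSobolev s F) : InSobolev s (matAct U F) := by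
  refine inSobolev_of_hat_le hs hF (C := ‖matrixCLM U‖) ?_
  filter_upwards [hat_matAct_ae U F] with ξ hξ
  rw [hξ]
  exact norm_mulVec_le U _

namespace AcousticParams

variable (p : AcousticParams)

/-- Each component decays exactly at its own rate `Dth` or `Γ0`, and the sum of the two exceeds
both. -/
theorem norm_le_exp_mul_norm_refPropagator {t r : ℝ} (ht : 0 ≤ t) (x : Fin 3 → ℂ) :
    Real.exp (-((p.Dth + p.Γ0) * r ^ 2 * t)) * ‖x‖
      ≤ ‖propagator p.refWaveSymbol p.refDampSymbol t r x‖ := by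
  rw [Real.exp_neg, inv_mul_le_iff₀ (Real.exp_pos _)]
  refine (pi_norm_le_iff_of_nonneg (by positivity)).2 fun j => ?_
  have h1 : (p.diffCoeff j).re ≤ p.Dth + p.Γ0 := by
    have := p.Dth_pos
    have := p.Γ0_pos
    fin_cases j <;> simp [diffCoeff] <;> linarith
  have h2 : Real.exp (-((p.Dth + p.Γ0) * r ^ 2 * t)) * ‖x j‖
      ≤ ‖propagator p.refWaveSymbol p.refDampSymbol t r x j‖ := by
    refine le_of_sq_le_sq ?_ (norm_nonneg _)
    rw [norm_refPropagator_sq p ht, mul_pow, ← Real.exp_nat_mul]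
    gcongr
    have := mul_le_mul_of_nonneg_right h1 (by positivity : 0 ≤ r ^ 2 * t)
    push_cast
    nlinarith
  rw [Real.exp_neg, inv_mul_le_iff₀ (Real.exp_pos _)] at h2
  exact h2.trans (by gcongr; exact norm_le_pi_norm _ j)

theorem exists_profile_lower : ∃ κ : ℝ, 0 < κ ∧ ∀ t r, 0 ≤ t → ∀ x : Fin 3 → ℂ,
    κ * (Real.exp (-((p.Dth + p.Γ0) * r ^ 2 * t)) * ‖x‖) ≤ ‖p.U1.mulVec
      (propagator p.refWaveSymbol p.refDampSymbol t r (p.U1⁻¹.mulVec x))‖ := by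
  set N := (‖matrixCLM p.U1‖ + 1) * (‖matrixCLM p.U1⁻¹‖ + 1) with hN
  have hN0 : 0 < N := by positivity
  refine ⟨N⁻¹, by positivity, fun t r ht x => ?_⟩
  rw [inv_mul_le_iff₀ hN0]
  set z := p.U1⁻¹.mulVec x with hz
  set y := propagator p.refWaveSymbol p.refDampSymbol t r z with hy
  have h1 : ‖x‖ ≤ (‖matrixCLM p.U1‖ + 1) * ‖z‖ := by
    have : x = p.U1.mulVec z := (p.U1_mulVec_inv x).symm
    calc ‖x‖ = ‖p.U1.mulVec z‖ := by rw [← this]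
      _ ≤ _ := (norm_mulVec_le _ _).trans (by gcongr; linarith)
  have h2 : ‖y‖ ≤ (‖matrixCLM p.U1⁻¹‖ + 1) * ‖p.U1.mulVec y‖ := by
    have : y = p.U1⁻¹.mulVec (p.U1.mulVec y) := (p.U1_inv_mulVec y).symm
    calc ‖y‖ = ‖p.U1⁻¹.mulVec (p.U1.mulVec y)‖ := by rw [← this]
      _ ≤ _ := (norm_mulVec_le _ _).trans (by gcongr; linarith)
  have h3 := p.norm_le_exp_mul_norm_refPropagator (r := r) ht z
  calc _ ≤ Real.exp (-((p.Dth + p.Γ0) * r ^ 2 * t)) * ((‖matrixCLM p.U1‖ + 1) * ‖z‖) := by gcongr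
    _ = (‖matrixCLM p.U1‖ + 1) * (Real.exp (-((p.Dth + p.Γ0) * r ^ 2 * t)) * ‖z‖) := by ring
    _ ≤ (‖matrixCLM p.U1‖ + 1) * ((‖matrixCLM p.U1⁻¹‖ + 1) * ‖p.U1.mulVec y‖) :=
        mul_le_mul_of_nonneg_left (h3.trans h2) (by positivity)
    _ = _ := by rw [hN]; ring

/-- The asymptotic profile `U₁ Ψ`. -/
noncomputable def profile {n : ℕ} (F₀ : Fin 3 → L2 n) (t : ℝ) : Fin 3 → L2 n :=
  matAct p.U1 (p.referenceEvolution (matAct p.U1⁻¹ F₀) t)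

theorem hat_profile_ae {n : ℕ} (F₀ : Fin 3 → L2 n) {t : ℝ} (ht : 0 ≤ t) :
    ∀ᵐ ξ, hat (p.profile F₀ t) ξ = p.U1.mulVec (propagator p.refWaveSymbol p.refDampSymbol t
      (2 * Real.pi * ‖ξ‖) (p.U1⁻¹.mulVec (hat F₀ ξ))) := by
  filter_upwards [hat_matAct_ae p.U1 (p.referenceEvolution (matAct p.U1⁻¹ F₀) t),
    hat_evolution_ae p.refPropagator_bound (matAct p.U1⁻¹ F₀) ht,
    hat_matAct_ae p.U1⁻¹ F₀] with ξ h1 h2 h3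
  rw [profile, h1, referenceEvolution, h2, h3]

theorem inSobolev_profile {n : ℕ} {s : ℝ} (hs : 0 ≤ s) {F₀ : Fin 3 → L2 n} (hF : InSobolev s F₀)
    {t : ℝ} (ht : 0 ≤ t) : InSobolev s (p.profile F₀ t) :=
  .matAct hs _ ((continuousInSobolev_evolution hs p.refPropagator_bound (hF.matAct hs _)).1 t ht)

theorem inSobolev_energyEvolution {n : ℕ} {s : ℝ} (hs : 0 ≤ s) {F₀ : Fin 3 → L2 n}
    (hF : InSobolev s F₀) {t : ℝ} (ht : 0 ≤ t) : InSobolev s (p.energyEvolution F₀ t) := by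
  obtain ⟨C, hC⟩ := p.exists_propagator_bound
  exact (continuousInSobolev_evolution hs hC hF).1 t ht

theorem exists_sobolevNorm_bound (n : ℕ) {s : ℝ} (hs : 0 ≤ s) :
    ∃ C : ℝ, 0 < C ∧ ∀ F₀ : Fin 3 → L2 n, InSobolev s F₀ → ∀ t, 0 ≤ t →
      sobolevNorm s (p.energyEvolution F₀ t) ≤ C * sobolevNorm s F₀ := by
  obtain ⟨C, hC⟩ := p.exists_propagator_bound
  have hC0 : 0 ≤ C := (norm_nonneg _).trans (hC 0 0 le_rfl le_rfl)
  refine ⟨2 * C + 1, by positivity, fun F₀ hF t ht => ?_⟩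
  have h : sobolevNorm s (p.energyEvolution F₀ t) ≤ 2 * C * sobolevNorm s F₀ := by
    refine sobolevNorm_le_of_hat_le hs hC0 hF ?_
    filter_upwards [hat_evolution_ae hC F₀ ht] with ξ hξ
    rw [energyEvolution, hξ]
    exact (ContinuousLinearMap.le_opNorm _ _).trans
      (by gcongr; exact hC _ _ ht (by positivity))
  exact h.trans (mul_le_mul_of_nonneg_right (by linarith) (sobolevNorm_nonneg s F₀))

theorem exists_energy_decay (n : ℕ) {s : ℝ} (hs : 0 ≤ s) :
    ∃ C : ℝ, 0 < C ∧ ∀ F₀ : Fin 3 → L2 n, InSobolev s F₀ → (∀ i, Integrable (F₀ i) volume) →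
      ∀ t, 0 ≤ t → homSobolevNorm s (p.energyEvolution F₀ t)
        ≤ C * (1 + t) ^ (-((n + 2 * s) / 4)) * (sobolevNorm s F₀ + lOneNorm F₀) := by
  obtain ⟨B, hB⟩ := p.exists_propagator_bound
  obtain ⟨c, A, hc, hA, hdec⟩ := p.exists_propagator_decay
  obtain ⟨C, hC, h⟩ := exists_homSobolevNorm_decay n (A := A) hs le_rfl hc
  refine ⟨C, hC, fun F₀ hF hFi t ht => ?_⟩
  have := h F₀ (p.energyEvolution F₀ t) t ht hF (p.inSobolev_energyEvolution hs hF ht) hFi ?_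
  · simpa using this
  filter_upwards [hat_evolution_ae hB F₀ ht] with ξ hξ
  rw [energyEvolution, hξ, Real.rpow_zero, one_mul, ← mul_assoc]
  exact hdec t _ ht (by positivity) _

/-- The factor `min r 1` of `exists_profile_estimate` is the case `l = 1` of the general decay lemma
and yields the additional `(1+t)^(-1/2)`. -/
theorem exists_profile_decay (n : ℕ) {s : ℝ} (hs : 0 ≤ s) :
    ∃ C : ℝ, 0 < C ∧ ∀ F₀ : Fin 3 → L2 n, InSobolev s F₀ → (∀ i, Integrable (F₀ i) volume) →
      ∀ t, 0 ≤ t → homSobolevNorm s (p.energyEvolution F₀ t - p.profile F₀ t)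
        ≤ C * (1 + t) ^ (-((n + 2 * s) / 4) - 1 / 2) * (sobolevNorm s F₀ + lOneNorm F₀) := by
  obtain ⟨B, hB⟩ := p.exists_propagator_bound
  obtain ⟨c, A, hc, hA, hdec⟩ := p.exists_profile_estimate
  obtain ⟨C, hC, h⟩ := exists_homSobolevNorm_decay n (A := A) hs zero_le_one hc
  refine ⟨C, hC, fun F₀ hF hFi t ht => ?_⟩
  refine h F₀ _ t ht hF ((p.inSobolev_energyEvolution hs hF ht).sub
    (p.inSobolev_profile hs hF ht)) hFi ?_
  filter_upwards [hat_evolution_ae hB F₀ ht, p.hat_profile_ae F₀ ht,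
    hat_sub_ae (p.energyEvolution F₀ t) (p.profile F₀ t)] with ξ h1 h2 h3
  rw [h3, h2, energyEvolution, h1, Real.rpow_one, ← mul_assoc, ← mul_assoc]
  exact hdec t _ ht (by positivity) _

/-- The lower bound is proved for the profile, where the moduli are explicit, and transferred to the
solution because their difference decays faster by `t^(-1/2)`. -/
theorem exists_energy_lower {n : ℕ} (hn : 1 ≤ n) {s : ℝ} (hs : 0 ≤ s) :
    ∃ c : ℝ, 0 < c ∧ ∀ F₀ : Fin 3 → L2 n, InSobolev s F₀ → (∀ i, Integrable (F₀ i) volume) →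
      meanVec F₀ ≠ 0 → ∃ t₀ : ℝ, 1 ≤ t₀ ∧ ∀ t, t₀ ≤ t →
        c * t ^ (-((n + 2 * s) / 4)) * ‖meanVec F₀‖ ≤ homSobolevNorm s (p.energyEvolution F₀ t) := by
  obtain ⟨κ, hκ, hlow⟩ := p.exists_profile_lower
  obtain ⟨c, hc, h⟩ := exists_homSobolevNorm_lower hn (p.Dth + p.Γ0) hs hκ
  obtain ⟨C, hC, hprof⟩ := p.exists_profile_decay n hs
  -- The triangle inequality with constant `3` leaves `c / 3`. Once `√t ≥ R` the profile error uses
  -- at most half of it.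
  refine ⟨c / 6, by positivity, fun F₀ hF hFi hP => ?_⟩
  obtain ⟨t₁, ht₁, hbound⟩ := h F₀ (p.profile F₀) hFi hP
    (fun t ht => p.inSobolev_profile hs hF ht) (fun t ht => by
      filter_upwards [p.hat_profile_ae F₀ ht] with ξ hξ
      rw [hξ]
      exact hlow t _ ht _)
  have hP0 : 0 < ‖meanVec F₀‖ := norm_pos_iff.2 hP
  set N := sobolevNorm s F₀ + lOneNorm F₀ with hN
  have hN0 : 0 ≤ N := add_nonneg (sobolevNorm_nonneg s F₀) (lOneNorm_nonneg F₀)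
  set R := 6 * C * N / (c * ‖meanVec F₀‖) with hR
  refine ⟨max t₁ (R ^ 2), ht₁.trans (le_max_left _ _), fun t ht => ?_⟩
  have ht1 : t₁ ≤ t := (le_max_left _ _).trans ht
  have ht0 : 0 < t := by linarith
  have hst : R ≤ Real.sqrt t := Real.le_sqrt_of_sq_le ((le_max_right _ _).trans ht)
  have hs0 : 0 < Real.sqrt t := Real.sqrt_pos.2 ht0
  have hX : 0 < t ^ (-((n + 2 * s) / 4)) := Real.rpow_pos_of_pos ht0 _
  set X := t ^ (-((n + 2 * s) / 4)) with hXdef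
  have h1 := hbound t ht1
  have h2 := homSobolevNorm_le_add hs (p.inSobolev_energyEvolution hs hF ht0.le)
    (p.inSobolev_profile hs hF ht0.le)
  have h3 := hprof F₀ hF hFi t ht0.le
  have h4 : (1 + t) ^ (-((n + 2 * s) / 4) - 1 / 2) ≤ X / Real.sqrt t := by
    refine (Real.rpow_le_rpow_of_nonpos ht0 (by linarith : t ≤ 1 + t) ?_).trans (le_of_eq ?_)
    · have : (0 : ℝ) ≤ n := Nat.cast_nonneg n
      linarith
    · rw [Real.rpow_sub ht0, Real.sqrt_eq_rpow]
  have h5 : C * (1 + t) ^ (-((n + 2 * s) / 4) - 1 / 2) * N ≤ c * ‖meanVec F₀‖ / 6 * X := by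
    calc _ ≤ C * (X / Real.sqrt t) * N := by gcongr
      _ = (C * N / Real.sqrt t) * X := by ring
      _ ≤ _ := by
        refine mul_le_mul_of_nonneg_right ?_ hX.le
        rw [div_le_iff₀ hs0]
        rw [hR, div_le_iff₀ (by positivity)] at hst
        linarith
  rw [← hXdef] at h1
  nlinarith

end AcousticParams

theorem theorem2p1 (n : ℕ) (hn : 1 ≤ n) (p : AcousticParams) (s : ℝ) (hs : 0 ≤ s) :
    ∃ c C : ℝ, 0 < c ∧ 0 < C ∧
      ∀ (φ0 φ1 T0 : TD n) (Φ0 : Fin 3 → L2 n),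
        IsEnergyTerm p φ0 φ1 T0 Φ0 → InSobolev s Φ0 →
        ∃ (φ φt T : ℝ → TD n) (Φ : ℝ → Fin 3 → L2 n),
          -- existence, uniqueness and continuous dependence on the data
          IsEnergySolution p s φ0 φ1 T0 φ φt T Φ ∧
          (∀ (φ' φt' T' : ℝ → TD n) (Φ' : ℝ → Fin 3 → L2 n),
            IsEnergySolution p s φ0 φ1 T0 φ' φt' T' Φ' →
            ∀ t, 0 ≤ t → φ' t = φ t ∧ φt' t = φt t ∧ T' t = T t ∧ Φ' t = Φ t) ∧
          Φ 0 = Φ0 ∧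
          (∀ t, 0 ≤ t → sobolevNorm s (Φ t) ≤ C * sobolevNorm s Φ0) ∧
          ((∀ i, Integrable (Φ0 i) volume) →
            -- optimal decay estimates
            (∀ t, 1 ≤ t → homSobolevNorm s (Φ t) ≤
              C * t ^ (-((n + 2 * s) / 4)) * (sobolevNorm s Φ0 + lOneNorm Φ0)) ∧
            (meanVec Φ0 ≠ 0 →
              (∃ t₀ : ℝ, 1 ≤ t₀ ∧ ∀ t, t₀ ≤ t →
                c * t ^ (-((n + 2 * s) / 4)) * ‖meanVec Φ0‖ ≤ homSobolevNorm s (Φ t)) ∧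
              (fun t => homSobolevNorm s (Φ t)) =Θ[atTop]
                (fun t : ℝ => t ^ (-((n + 2 * s) / 4)))) ∧
            -- asymptotic profile
            ∃ Ψ : ℝ → Fin 3 → L2 n,
              IsReferenceSolution p s (matAct p.U1⁻¹ Φ0) Ψ ∧
              (∀ Ψ' : ℝ → Fin 3 → L2 n, IsReferenceSolution p s (matAct p.U1⁻¹ Φ0) Ψ' →
                ∀ t, 0 ≤ t → Ψ' t = Ψ t) ∧
              ∀ t, 0 ≤ t → homSobolevNorm s (Φ t - matAct p.U1 (Ψ t)) ≤
                C * (1 + t) ^ (-((n + 2 * s) / 4) - 1 / 2) *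
                  (sobolevNorm s Φ0 + lOneNorm Φ0)) := by
  obtain ⟨B, hB⟩ := p.exists_propagator_bound
  obtain ⟨C₁, hC₁, hbound⟩ := p.exists_sobolevNorm_bound n hs
  obtain ⟨C₂, hC₂, hdecay⟩ := p.exists_energy_decay n hs
  obtain ⟨C₃, hC₃, hprof⟩ := p.exists_profile_decay n hs
  obtain ⟨c, hc, hlower⟩ := p.exists_energy_lower hn hs
  refine ⟨c, C₁ + C₂ + C₃, hc, by positivity, fun φ0 φ1 T0 Φ0 hE hF => ?_⟩
  have hsol := p.isEnergySolution_energyEvolution hs hE hF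
  have hS := sobolevNorm_nonneg s Φ0
  have hN : 0 ≤ sobolevNorm s Φ0 + lOneNorm Φ0 := add_nonneg hS (lOneNorm_nonneg Φ0)
  refine ⟨_, _, _, p.energyEvolution Φ0, hsol,
    fun φ' φt' T' Φ' h' t ht => hsol.unique hn hs h' ht, evolution_zero hB Φ0,
    fun t ht => (hbound Φ0 hF t ht).trans
      (mul_le_mul_of_nonneg_right (by linarith) hS), fun hFi => ?_⟩
  have hup : ∀ t, 1 ≤ t → homSobolevNorm s (p.energyEvolution Φ0 t) ≤
      (C₁ + C₂ + C₃) * t ^ (-((n + 2 * s) / 4)) * (sobolevNorm s Φ0 + lOneNorm Φ0) := by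
    intro t ht
    have ht0 : 0 < t := by linarith
    refine (hdecay Φ0 hF hFi t ht0.le).trans (mul_le_mul_of_nonneg_right ?_ hN)
    have h1 : (1 + t) ^ (-((n + 2 * s) / 4)) ≤ t ^ (-((n + 2 * s) / 4)) := by
      refine Real.rpow_le_rpow_of_nonpos ht0 (by linarith) ?_
      have : (0 : ℝ) ≤ n := Nat.cast_nonneg n
      linarith
    exact mul_le_mul (by linarith) h1 (by positivity) (by positivity)
  refine ⟨hup, fun hP => ?_, p.referenceEvolution (matAct p.U1⁻¹ Φ0),
    p.isReferenceSolution_referenceEvolution hs (hF.matAct hs _),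
    fun Ψ' hΨ' t ht => p.referenceSolution_unique hs
      (p.isReferenceSolution_referenceEvolution hs (hF.matAct hs _)) hΨ' ht,
    fun t ht => (hprof Φ0 hF hFi t ht).trans ?_⟩
  · obtain ⟨t₀, ht₀, hlow⟩ := hlower Φ0 hF hFi hP
    have hP0 : 0 < ‖meanVec Φ0‖ := norm_pos_iff.2 hP
    refine ⟨⟨t₀, ht₀, hlow⟩, ?_, ?_⟩
    · refine Asymptotics.IsBigO.of_bound
        ((C₁ + C₂ + C₃) * (sobolevNorm s Φ0 + lOneNorm Φ0)) ?_
      filter_upwards [eventually_ge_atTop 1] with t ht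
      rw [Real.norm_of_nonneg (homSobolevNorm_nonneg _ _),
        Real.norm_of_nonneg (Real.rpow_nonneg (by linarith) _)]
      exact (hup t ht).trans (le_of_eq (by ring))
    · refine Asymptotics.IsBigO.of_bound (1 / (c * ‖meanVec Φ0‖)) ?_
      filter_upwards [eventually_ge_atTop t₀] with t ht
      rw [Real.norm_of_nonneg (homSobolevNorm_nonneg _ _),
        Real.norm_of_nonneg (Real.rpow_nonneg (by linarith) _), div_mul_eq_mul_div, one_mul,
        le_div_iff₀ (by positivity)]
      exact (le_of_eq (by ring)).trans (hlow t ht)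
  · exact mul_le_mul_of_nonneg_right
      (mul_le_mul_of_nonneg_right (by linarith) (by positivity)) hN
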